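/- Let $M$ be a compact oriented smooth four-dimensional Riemannian manifold without boundary (for example the round sphere $S^4$ with the rotation action of $\mathbb T^2$), with Riemannian volume $\nu$, carrying a smooth isometric action $\sigma$ of a torus $\mathbb T^n=\mathbb R^n/\mathbb Z^n$, and let $\theta$ be a real antisymmetric $n\times n$ matrix. Let $\Omega(M)$ be the complex smooth differential forms; $\sigma_s$ acts on them by pull-back, and each $\omega\in\Omega(M)$ is a rapidly convergent sum $\omega=\sum_{r\in\mathbb Z^n}\omega_r$ with $\sigma_s(\omega_r)=e^{2\pi i r\cdot s}\omega_r$. Let $\Omega(M_\theta)$ be the vector space $\Omega(M)$ with the product $\omega\times_\theta\rho=\sum_r\omega_r\wedge\sigma_{\frac12 r\cdot\theta}(\rho)$ (all products below are of this kind), the exterior derivative $d$, the involution $^*$ given by complex conjugation, and the Hodge operator $*_\theta$ which is the classical $*$ of the oriented Riemannian manifold $M$; put $C^\infty(M_\theta)=\Omega^0(M_\theta)$. Define $(\alpha,\beta)_2=\int_M *_\theta(\alpha^*\,{*_\theta\beta})\,d\nu$ for $\alpha,\beta\in\Omega^k(M_\theta)$. Let $p=p^2=p^*\in M_N(C^\infty(M_\theta))$,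 and let $\mathcal E=p\,C^\infty(M_\theta)^N$ be the corresponding finite projective right module with the Hermitian structure $\langle\xi,\eta\rangle=\sum_i\xi_i^*\eta_i$; identify $\mathcal E\otimes\Omega^k(M_\theta)$ with $p\,\Omega^k(M_\theta)^N$ and $\mathrm{Hom}_{C^\infty(M_\theta)}(\mathcal E,\mathcal E\otimes\Omega^k(M_\theta))$ with $p\,M_N(\Omega^k(M_\theta))\,p$. On the latter put $(S,T)_2=\sum_{i,j}(S_{ij},T_{ij})_2$ and let $*_\theta$ act on entries. A compatible connection is a family of $\mathbb C$-linear maps $\nabla:\mathcal E\otimes\Omega^k(M_\theta)\to\mathcal E\otimes\Omega^{k+1}(M_\theta)$, $k\ge0$, with $\nabla(\omega\rho)=(\nabla\omega)\rho+(-1)^k\omega\,d\rho$ for $\omega\in\mathcal E\otimes\Omega^k(M_\theta)$, $\rho\in\Omega(M_\theta)$, and $\langle\nabla\eta,\xi\rangle+\langle\eta,\nabla\xi\rangle=d\langle\eta,\xi\rangle$ for $\eta,\xi\in\mathcal E$. Its curvature is $F=\nabla^2|_{\mathcal E}\in p\,M_N(\Omega^2(M_\theta))\,p$. Put $\mathrm{YM}(\nabla)=(F,F)_2$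 and let the topological action be $(F,*_\theta F)_2$. A gauge transformation is a unitary $u\in\mathrm{End}(\mathcal E)=p\,M_N(C^\infty(M_\theta))\,p$, $u^*u=uu^*=p$, and $\nabla^u=u^*\nabla u$. Then: 1. (Gauge invariance.) For every compatible connection $\nabla$ and every gauge transformation $u$, $\nabla^u$ is a compatible connection and $\mathrm{YM}(\nabla^u)=\mathrm{YM}(\nabla)$. 2. (Positivity.) $\mathrm{YM}(\nabla)$ is real and $\ge 0$ for every compatible connection $\nabla$. 3. (Topological invariance.) $(F,*_\theta F)_2$ is the same number, $\mathrm{Top}(\mathcal E)$, for all compatible connections on $\mathcal E$. 4. (Bound.) $\mathrm{YM}(\nabla)\ge|\mathrm{Top}(\mathcal E)|$ for every compatible connection $\nabla$, with equality if and only if $*_\theta F=F$ or $*_\theta F=-F$. 5. (Minima.) If $\nabla$ is a compatible connection with $*_\theta F=F$ or $*_\theta F=-F$, then $\mathrm{YM}(\nabla)\le\mathrm{YM}(\nabla')$ for every compatible connection $\nabla'$ on $\mathcal E$. -/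

import Mathlib

open scoped Manifold ContDiff
open MeasureTheory

noncomputable section

namespace NCYM

/-! ## Complex differential forms on a four-manifold -/

/-- The model space `ℝ⁴`. By definition `TangentSpace (𝓡 4) x = E4` for every point `x` of a
four-manifold, the identification being the one given by the preferred chart at `x`. -/
abbrev E4 : Type := EuclideanSpace ℝ (Fin 4)

/-- The `i`-th standard basis vector of `ℝ⁴`. -/
def stdVec (i : Fin 4) : E4 := EuclideanSpace.single i (1 : ℝ)

/-- A complex-valued `k`-covector on `ℝ⁴`. -/
abbrev Cov (k : ℕ) : Type := E4 [⋀^Fin k]→L[ℝ] ℂ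

/-- (Not necessarily smooth) complex `k`-forms on `M`. A `0`-form is a complex function. -/
abbrev Form (M : Type*) (k : ℕ) : Type _ := M → Cov k

/-- Positions of the first `p` among `r = p + q` arguments. -/
def leftPos {p q r : ℕ} (h : p + q = r) (i : Fin p) : Fin r := Fin.cast h (Fin.castAdd q i)

/-- Positions of the last `q` among `r = p + q` arguments. -/
def rightPos {p q r : ℕ} (h : p + q = r) (j : Fin q) : Fin r := Fin.cast h (Fin.natAdd p j)

theorem leftPos_injective {p q r : ℕ} (h : p + q = r) : Function.Injective (leftPos h) := by
  intro i j hij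
  simpa [leftPos, Fin.ext_iff] using hij

theorem rightPos_injective {p q r : ℕ} (h : p + q = r) : Function.Injective (rightPos h) := by
  intro i j hij
  simpa [rightPos, Fin.ext_iff] using hij

theorem leftPos_ne_rightPos {p q r : ℕ} (h : p + q = r) (i : Fin p) (j : Fin q) :
    leftPos h i ≠ rightPos h j := by
  intro hij
  have h1 : (i : ℕ) = p + (j : ℕ) := by simpa [leftPos, rightPos, Fin.ext_iff] using hij
  omega

theorem pos_cases {p q r : ℕ} (h : p + q = r) (k : Fin r) :
    (∃ i, leftPos h i = k) ∨ ∃ j, rightPos h j = k := by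
  subst h
  refine Fin.addCases (fun i => Or.inl ⟨i, ?_⟩) (fun j => Or.inr ⟨j, ?_⟩) k
  · simp [leftPos]
  · simp [rightPos]

/-- `v ↦ α(v₁,…,v_p) β(v_{p+1},…,v_{p+q})`. -/
def mulMultilinear {p q r : ℕ} (h : p + q = r) (α : Cov p) (β : Cov q) :
    ContinuousMultilinearMap ℝ (fun _ : Fin r => E4) ℂ where
  toFun v := α (v ∘ leftPos h) * β (v ∘ rightPos h)
  map_update_add' := by
    intro inst v k x y
    obtain rfl : inst = instDecidableEqFin r := Subsingleton.elim _ _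
    rcases pos_cases h k with ⟨i, rfl⟩ | ⟨j, rfl⟩
    · have hn : leftPos h i ∉ Set.range (rightPos h) := by
        rintro ⟨j, hj⟩; exact leftPos_ne_rightPos h i j hj.symm
      simp only [Function.update_comp_eq_of_injective _ (leftPos_injective h),
        Function.update_comp_eq_of_notMem_range _ _ hn, α.map_update_add, add_mul]
    · have hn : rightPos h j ∉ Set.range (leftPos h) := by
        rintro ⟨i, hi⟩; exact leftPos_ne_rightPos h i j hi
      simp only [Function.update_comp_eq_of_injective _ (rightPos_injective h),
        Function.update_comp_eq_of_notMem_range _ _ hn, β.map_update_add, mul_add]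
  map_update_smul' := by
    intro inst v k c x
    obtain rfl : inst = instDecidableEqFin r := Subsingleton.elim _ _
    rcases pos_cases h k with ⟨i, rfl⟩ | ⟨j, rfl⟩
    · have hn : leftPos h i ∉ Set.range (rightPos h) := by
        rintro ⟨j, hj⟩; exact leftPos_ne_rightPos h i j hj.symm
      simp only [Function.update_comp_eq_of_injective _ (leftPos_injective h),
        Function.update_comp_eq_of_notMem_range _ _ hn, α.map_update_smul, smul_mul_assoc]
    · have hn : rightPos h j ∉ Set.range (leftPos h) := by
        rintro ⟨i, hi⟩; exact leftPos_ne_rightPos h i j hi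
      simp only [Function.update_comp_eq_of_injective _ (rightPos_injective h),
        Function.update_comp_eq_of_notMem_range _ _ hn, β.map_update_smul, mul_smul_comm]
  cont := by
    have h1 : Continuous fun v : Fin r → E4 => v ∘ leftPos h :=
      continuous_pi fun i => continuous_apply _
    have h2 : Continuous fun v : Fin r → E4 => v ∘ rightPos h :=
      continuous_pi fun i => continuous_apply _
    exact (α.cont.comp h1).mul (β.cont.comp h2)

/-- The wedge product
`(α ∧ β)(v) = (1 / (p! q!)) ∑_σ sgn(σ) α(v_{σ(1)},…,v_{σ(p)}) β(v_{σ(p+1)},…,v_{σ(p+q)})`. -/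
def wedge {p q r : ℕ} (h : p + q = r) (α : Cov p) (β : Cov q) : Cov r :=
  ((p.factorial * q.factorial : ℕ) : ℂ)⁻¹ •
    ContinuousMultilinearMap.alternatization (mulMultilinear h α β)

theorem append_update {p q r : ℕ} (h : p + q = r) (u : Fin p → E4) (v : Fin q → E4)
    (j : Fin q) (x : E4) :
    (fun k : Fin r => Fin.append u (Function.update v j x) (Fin.cast h.symm k)) =
      Function.update (fun k : Fin r => Fin.append u v (Fin.cast h.symm k)) (rightPos h j) x := by
  funext k
  rcases pos_cases h k with ⟨i, rfl⟩ | ⟨l, rfl⟩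
  · rw [Function.update_of_ne (leftPos_ne_rightPos h i j)]
    simp [leftPos]
  · by_cases hl : l = j
    · subst hl
      simp [rightPos]
    · rw [Function.update_of_ne (fun e => hl (rightPos_injective h e))]
      simp [rightPos, hl]

/-- `v ↦ μ(u₁,…,u_p,v₁,…,v_q)`. -/
def insertFirst {p q : ℕ} (h : p + q = 4) (μ : Cov 4) (u : Fin p → E4) : Cov q where
  toFun v := μ fun k => Fin.append u v (Fin.cast h.symm k)
  map_update_add' := by
    intro inst v k x y
    obtain rfl : inst = instDecidableEqFin q := Subsingleton.elim _ _
    have e := append_update h u v k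
    exact (congrArg μ (e (x + y))).trans ((μ.map_update_add _ _ _ _).trans
      (congrArg₂ (· + ·) (congrArg μ (e x)).symm (congrArg μ (e y)).symm))
  map_update_smul' := by
    intro inst v k c x
    obtain rfl : inst = instDecidableEqFin q := Subsingleton.elim _ _
    have e := append_update h u v k
    exact (congrArg μ (e (c • x))).trans ((μ.map_update_smul _ _ _ _).trans
      (congrArg (c • ·) (congrArg μ (e x)).symm))
  map_eq_zero_of_eq' := by
    intro v i j hv hij
    refine μ.map_eq_zero_of_eq _ (i := rightPos h i) (j := rightPos h j) ?_ ?_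
    · simpa [rightPos] using hv
    · exact fun e => hij (rightPos_injective h e)
  cont := by
    refine μ.cont.comp (continuous_pi fun k => ?_)
    rcases pos_cases h k with ⟨i, rfl⟩ | ⟨j, rfl⟩
    · simpa [leftPos] using continuous_const
    · simpa [rightPos] using continuous_apply j

/-- Complex conjugation of forms. This is the involution `*` of `Ω(M_θ)`; it satisfies
`(α₁α₂)^* = (-1)^{d₁d₂} α₂^* α₁^*` for the deformed product. -/
def conjForm {M : Type*} {k : ℕ} (α : Form M k) : Form M k := fun x =>
  (Complex.conjCLE : ℂ →L[ℝ] ℂ).compContinuousAlternatingMap (α x)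

section Manifold

variable {M : Type*} [TopologicalSpace M] [ChartedSpace E4 M]

/-- The derivative of the inverse of the chart `c` at `y ∈ ℝ⁴`. -/
def chartSymmDeriv (c : M) (y : E4) : E4 →L[ℝ] E4 :=
  mfderiv (𝓡 4) (𝓡 4) (chartAt E4 c).symm y

/-- The coordinate expression of a form in the preferred chart at `c`: its pull-back to the
target of the chart. -/
def inChart {k : ℕ} (c : M) (α : Form M k) : E4 → Cov k := fun y =>
  (α ((chartAt E4 c).symm y)).compContinuousLinearMap (chartSymmDeriv c y)

/-- Smooth forms: smooth coordinate expressions in all preferred charts. -/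
def IsSmooth {k : ℕ} (α : Form M k) : Prop :=
  ∀ c : M, ContDiffOn ℝ ∞ (inChart c α) (chartAt E4 c).target

/-- The exterior derivative, computed at `x` in the preferred chart at `x`. -/
def extd {k : ℕ} (α : Form M k) : Form M (k + 1) := fun x =>
  (extDeriv (inChart x α) (chartAt E4 x x)).compContinuousLinearMap
    (mfderiv (𝓡 4) (𝓡 4) (chartAt E4 x) x : E4 →L[ℝ] E4)

/-- The pull-back of a form by a map. -/
def pullback {k : ℕ} (f : M → M) (α : Form M k) : Form M k := fun x =>
  (α (f x)).compContinuousLinearMap (mfderiv (𝓡 4) (𝓡 4) f x : E4 →L[ℝ] E4)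

variable [IsManifold (𝓡 4) ∞ M]

/-- Smooth Riemannian metrics on `M`. -/
abbrev Metric4 (M : Type*) [TopologicalSpace M] [ChartedSpace E4 M] [IsManifold (𝓡 4) ∞ M] :
    Type _ :=
  Bundle.ContMDiffRiemannianMetric (𝓡 4) ∞ E4 (fun x : M => TangentSpace (𝓡 4) x)

/-- The Gram matrix of four tangent vectors at `x`. -/
def gram (g : Metric4 M) (x : M) (v : Fin 4 → E4) : Matrix (Fin 4) (Fin 4) ℝ :=
  Matrix.of fun i j => g.inner x (v i) (v j)

/-- The part of the Riemannian volume in the domain of the preferred chart at `c`: it has density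
`√det (g_{ij})` with respect to Lebesgue measure in the coordinates. -/
def chartVolume [MeasurableSpace M] (g : Metric4 M) (c : M) : Measure M :=
  ((volume.restrict (chartAt E4 c).target).withDensity fun y =>
    ENNReal.ofReal (Real.sqrt (gram g ((chartAt E4 c).symm y)
      fun i => chartSymmDeriv c y (stdVec i)).det)).map (chartAt E4 c).symm

/-- The Riemannian volume measure: the least measure that dominates all the (mutually compatible)
chart volumes, i.e. the one obtained by gluing them. -/
def riemannianVolume [MeasurableSpace M] (g : Metric4 M) : Measure M :=
  ⨆ c : M, chartVolume g c

end Manifold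

/-! ## Toric noncommutative four-manifolds -/

/-- The classical data of a toric noncommutative manifold `M_θ` of dimension four: a Riemannian
metric on `M`, an orientation given through its Riemannian volume form, an isometric smooth action
`σ` of the torus `𝕋ⁿ = ℝⁿ/ℤⁿ`, and a real antisymmetric `n × n` matrix `θ`. -/
structure ToricData (M : Type*) [TopologicalSpace M] [ChartedSpace E4 M]
    [IsManifold (𝓡 4) ∞ M] (n : ℕ) where
  metric : Metric4 M
  vol : Form M 4
  vol_smooth : IsSmooth vol
  /-- The value of the volume form on four vectors is real and equal to plus or minus the square
  root of their Gram determinant. -/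
  vol_sq : ∀ (x : M) (v : Fin 4 → E4), vol x v ^ 2 = (((gram metric x v).det : ℝ) : ℂ)
  act : (Fin n → ℝ) → M → M
  act_zero : ∀ x, act 0 x = x
  act_add : ∀ s t x, act (s + t) x = act s (act t x)
  act_periodic : ∀ (k : Fin n → ℤ) (x : M), act (fun j => (k j : ℝ)) x = x
  act_smooth : ContMDiff (𝓘(ℝ, Fin n → ℝ).prod (𝓡 4)) (𝓡 4) ∞
    (fun q : (Fin n → ℝ) × M => act q.1 q.2)
  act_isometric : ∀ (s : Fin n → ℝ) (x : M) (v w : TangentSpace (𝓡 4) x),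
    metric.inner (act s x) (mfderiv (𝓡 4) (𝓡 4) (act s) x v) (mfderiv (𝓡 4) (𝓡 4) (act s) x w)
      = metric.inner x v w
  theta : Matrix (Fin n) (Fin n) ℝ
  theta_antisymm : theta.transpose = -theta

section Toric

variable {M : Type*} [TopologicalSpace M] [ChartedSpace E4 M] [IsManifold (𝓡 4) ∞ M] {n : ℕ}
variable (X : ToricData M n)

/-- The action `σ_s` on forms, by pull-back. -/
def sigma {k : ℕ} (s : Fin n → ℝ) (α : Form M k) : Form M k := pullback (X.act s) α

/-- The component `α_r` of degree `r ∈ ℤⁿ` of a form `α = ∑_r α_r`, for which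
`σ_s(α_r) = e^{2πi r·s} α_r`: the integral of `e^{-2πi r·s} σ_s(α)` over the torus. -/
def component {k : ℕ} (r : Fin n → ℤ) (α : Form M k) : Form M k := fun x =>
  ∫ s in Set.Icc (0 : Fin n → ℝ) 1,
    Complex.exp (-(2 * Real.pi * Complex.I * ∑ j, (r j : ℂ) * (s j : ℂ))) • sigma X s α x

/-- The deformed product
`α ×_θ ρ = ∑_r α_r ∧ σ_{½ r·θ}(ρ)`, i.e. `α_r ×_θ ρ_{r'} = e^{πi r·θ·r'} α_r ∧ ρ_{r'}`. -/
def starMul {p q r : ℕ} (h : p + q = r) (α : Form M p) (ρ : Form M q) : Form M r := fun x =>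
  ∑' m : Fin n → ℤ, wedge h (component X m α x)
    (sigma X ((1 / 2 : ℝ) • Matrix.vecMul (fun j => (m j : ℝ)) X.theta) ρ x)

/-- The Hodge operator `*_θ`, which is the classical one on the vector space
`Ω(M_θ) = Ω(M)`: in a basis `b` of the tangent space, with inverse Gram matrix `G^{ij}`,
`(*α)(v) = (1/p!) ∑_{i,j} G^{i₁j₁}⋯G^{i_pj_p} α(b_{i₁},…,b_{i_p}) vol(b_{j₁},…,b_{j_p},v)`. -/
def hodge {p q : ℕ} (h : p + q = 4) (α : Form M p) : Form M q := fun x =>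
  ((p.factorial : ℕ) : ℂ)⁻¹ • ∑ i : Fin p → Fin 4, ∑ j : Fin p → Fin 4,
    (((∏ k, (gram X.metric x stdVec)⁻¹ (i k) (j k) : ℝ) : ℂ) * α x (stdVec ∘ i)) •
      insertFirst h (X.vol x) (stdVec ∘ j)

/-- The noncommutative integral on `C^∞(M_θ) = C^∞(M)`, that is, integration with respect to the
Riemannian volume. -/
def ncInt [MeasurableSpace M] (f : Form M 0) : ℂ := ∫ x, f x ![] ∂(riemannianVolume X.metric)

/-- The inner product `(α, β)₂ = ∫ *_θ(α^* *_θ β)` on `Ω^p(M_θ)`. -/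
def formInner [MeasurableSpace M] {p q : ℕ} (h : p + q = 4) (α β : Form M p) : ℂ :=
  ncInt X (hodge X (show 4 + 0 = 4 from rfl) (starMul X h (conjForm α) (hodge X h β)))

/-! ## Gauge theory on `𝓔 = p C^∞(M_θ)^N` -/

/-- Matrices of `k`-forms. -/
abbrev MForm (M : Type*) (N k : ℕ) : Type _ := Fin N → Fin N → Form M k

variable {N : ℕ}

/-- The matrix `A` of `a`-forms applied to the column `ξ` of `k`-forms. -/
def applyMat {a k l : ℕ} (h : a + k = l) (A : MForm M N a) (ξ : Fin N → Form M k) :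
    Fin N → Form M l :=
  fun i => ∑ j, starMul X h (A i j) (ξ j)

/-- Product of matrices of functions, in `M_N(C^∞(M_θ))`. -/
def matMul (A B : MForm M N 0) : MForm M N 0 :=
  fun i j => ∑ l, starMul X (show 0 + 0 = 0 from rfl) (A i l) (B l j)

/-- The adjoint of a matrix of functions, in `M_N(C^∞(M_θ))`. -/
def adj (A : MForm M N 0) : MForm M N 0 := fun i j => conjForm (A j i)

/-- `P` is a (self-adjoint) projection in `M_N(C^∞(M_θ))`. -/
structure IsProjection (P : MForm M N 0) : Prop where
  smooth : ∀ i j, IsSmooth (P i j)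
  idem : matMul X P P = P
  selfAdj : adj P = P

/-- The elements of `𝓔 ⊗ Ω^k(M_θ) = p (Ω^k(M_θ))^N`. For `k = 0` this is the right module
`𝓔 = p C^∞(M_θ)^N`. -/
def IsSection (P : MForm M N 0) {k : ℕ} (ξ : Fin N → Form M k) : Prop :=
  (∀ i, IsSmooth (ξ i)) ∧ applyMat X (Nat.zero_add k) P ξ = ξ

/-- The right action `ξ ρ` of `Ω^q(M_θ)` on `𝓔 ⊗ Ω^k(M_θ)`. -/
def rightMul {k q r : ℕ} (h : k + q = r) (ξ : Fin N → Form M k) (ρ : Form M q) :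
    Fin N → Form M r :=
  fun i => starMul X h (ξ i) ρ

/-- The Hermitian structure `⟨ξ, η⟩ = ∑_i ξ_i^* η_i`, for `ξ`, `η` with values in forms. -/
def herm {k l r : ℕ} (h : k + l = r) (ξ : Fin N → Form M k) (η : Fin N → Form M l) : Form M r :=
  ∑ i, starMul X h (conjForm (ξ i)) (η i)

/-- A family of operators `𝓔 ⊗ Ω^k → 𝓔 ⊗ Ω^{k+1}`, `k ≥ 0`. Only the values on elements of
`𝓔 ⊗ Ω^k` matter below. -/
abbrev Operator (M : Type*) (N : ℕ) : Type _ :=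
  ∀ k : ℕ, (Fin N → Form M k) → (Fin N → Form M (k + 1))

/-- `D` is a connection on `𝓔 = p C^∞(M_θ)^N` that is compatible with the Hermitian structure. -/
structure IsConnection (P : MForm M N 0) (D : Operator M N) : Prop where
  maps : ∀ k (ξ : Fin N → Form M k), IsSection X P ξ → IsSection X P (D k ξ)
  map_add : ∀ k (ξ η : Fin N → Form M k), IsSection X P ξ → IsSection X P η →
    D k (ξ + η) = D k ξ + D k η
  map_smul : ∀ k (c : ℂ) (ξ : Fin N → Form M k), IsSection X P ξ → D k (c • ξ) = c • D k ξ
  leibniz : ∀ (k q r : ℕ) (h : k + q = r) (ξ : Fin N → Form M k) (ρ : Form M q),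
    IsSection X P ξ → IsSmooth ρ →
    D r (rightMul X h ξ ρ) =
      rightMul X (show k + 1 + q = r + 1 by omega) (D k ξ) ρ +
        (-1 : ℂ) ^ k • rightMul X (show k + (q + 1) = r + 1 by omega) ξ (extd ρ)
  compatible : ∀ ξ η : Fin N → Form M 0, IsSection X P ξ → IsSection X P η →
    herm X (show 1 + 0 = 1 from rfl) (D 0 ξ) η + herm X (show 0 + 1 = 1 from rfl) ξ (D 0 η) =
      extd (herm X (show 0 + 0 = 0 from rfl) ξ η)

/-- The curvature `F = ∇² : 𝓔 → 𝓔 ⊗ Ω²`, understood as an element of `p M_N(Ω²(M_θ)) p`: its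
`j`-th column is the value of `∇²` at the `j`-th column `p e_j ∈ 𝓔` of `p`. -/
def curvature (P : MForm M N 0) (D : Operator M N) : MForm M N 2 :=
  fun i j => D 1 (D 0 fun l => P l j) i

/-- The inner product `(S, T)₂ = ∑_{ij} (S_{ij}, T_{ij})₂` on `Hom(𝓔, 𝓔 ⊗ Ω²) = p M_N(Ω²) p`,
given by the trace over internal indices. -/
def homInner [MeasurableSpace M] (S T : MForm M N 2) : ℂ :=
  ∑ i, ∑ j, formInner X (show 2 + 2 = 4 from rfl) (S i j) (T i j)

/-- `*_θ` on `Hom(𝓔, 𝓔 ⊗ Ω²) = p M_N(Ω²) p`. -/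
def hodgeMat (S : MForm M N 2) : MForm M N 2 :=
  fun i j => hodge X (show 2 + 2 = 4 from rfl) (S i j)

/-- The Yang–Mills functional `YM(∇) = (F, F)₂`. -/
def YM [MeasurableSpace M] (P : MForm M N 0) (D : Operator M N) : ℂ :=
  homInner X (curvature P D) (curvature P D)

/-- The topological action `(F, *_θ F)₂`, computed from the connection `∇`. -/
def topAction [MeasurableSpace M] (P : MForm M N 0) (D : Operator M N) : ℂ :=
  homInner X (curvature P D) (hodgeMat X (curvature P D))

/-- `*_θ F = F` -/
def IsSelfDual (P : MForm M N 0) (D : Operator M N) : Prop :=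
  hodgeMat X (curvature P D) = curvature P D

/-- `*_θ F = -F` -/
def IsAntiSelfDual (P : MForm M N 0) (D : Operator M N) : Prop :=
  hodgeMat X (curvature P D) = -curvature P D

/-- Gauge transformations of `𝓔`: the unitary elements of `End(𝓔) = p M_N(C^∞(M_θ)) p`. -/
structure IsGauge (P u : MForm M N 0) : Prop where
  smooth : ∀ i j, IsSmooth (u i j)
  left : matMul X P u = u
  right : matMul X u P = u
  adj_mul : matMul X (adj u) u = P
  mul_adj : matMul X u (adj u) = P

/-- The transformed connection `∇^u = u^* ∇ u`. -/
def gaugeTransform (u : MForm M N 0) (D : Operator M N) : Operator M N := fun k ξ =>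
  applyMat X (Nat.zero_add (k + 1)) (adj u) (D k (applyMat X (Nat.zero_add k) u ξ))

end Toric

end NCYM

end

open scoped Manifold ContDiff
open MeasureTheory

noncomputable section

namespace NCYM

/-! ## The algebra of covectors -/

/-! The deformation enters only through the product, and three facts about that product reduce the
theorem to algebra.

(a) Smooth forms with `starMul`, `extd` and conjugation are an associative graded differential
algebra with involution (`starMul_assoc`, `extd_starMul`, `conjForm_starMul`). The analytic input is
the rapid decay of Fourier components, uniform on compact sets of a chart
(`IsSmoothPeriodic.exists_decay`), which makes the product smooth and differentiable term by term
(`contDiffOn_twSum`, `hasFDerivAt_twSum`). The Leibniz rule survives because `d` commutes with the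
torus action.

(b) The integral τ of top-degree forms is a closed graded trace (`intTrace`). The volume is
invariant under the action, so τ sees only the invariant component of a form. In the invariant
component of a product the degrees m and -m meet, with a phase whose exponent is a multiple of m·θ·m
= 0. Hence under the integral the deformed product is the ordinary wedge product (`topInt_starMul`),
and cyclicity and Stokes' theorem are the classical ones.

(c) The classical Hodge operator commutes with the action, so it is linear over functions on both
sides of the deformed product. On two-forms it is an involution, symmetric for the pairing ∫ α ∧ *β.
By (b), (S, T)₂ = τ(tr S* *T) is the classical L² product, and it is positive definite
(`pair_conj_self`).

A compatible connection is p d + A with pA = Ap = A and A* = -A, and F = A² + A dp + p dA + p dp dp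
(`IsConnection.exists_potential`). A gauge transformation replaces F by u* F u, so the energy is
unchanged by cyclicity and u u* = p (`SMat.inner_gauge`). Since F* = -F and ** = 1, the topological
action is -τ(tr F²). As in Chern–Weil theory this depends on p alone: all terms containing A cancel
(`ClosedTrace.total_curvature_sq`).

Finally, with a = (F, F)₂ and b = (F, *F)₂, the squared norms of F ± *F are 2(a ± b). Their
nonnegativity gives a ≥ |b|, and definiteness gives the case of equality (`SMat.exists_energy`). A
solution of *F = ±F attains a bound that is common to all connections, hence is a minimum. -/

open Equiv in
/-- Antisymmetrization of a function of `r` vectors, without normalization. -/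
def alt {r : ℕ} (F : (Fin r → E4) → ℂ) (v : Fin r → E4) : ℂ :=
  ∑ σ : Perm (Fin r), ((Perm.sign σ : ℤ) : ℂ) * F (v ∘ σ)

/-- The juxtaposition product of two functions of several vectors. -/
def jux {p q r : ℕ} (h : p + q = r) (F : (Fin p → E4) → ℂ) (G : (Fin q → E4) → ℂ)
    (v : Fin r → E4) : ℂ :=
  F (v ∘ leftPos h) * G (v ∘ rightPos h)

theorem wedge_apply {p q r : ℕ} (h : p + q = r) (α : Cov p) (β : Cov q) (v : Fin r → E4) :
    wedge h α β v = ((p.factorial * q.factorial : ℕ) : ℂ)⁻¹ * alt (jux h α β) v := by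
  simp only [wedge, ContinuousAlternatingMap.smul_apply,
    ContinuousMultilinearMap.alternatization_apply_apply, alt, smul_eq_mul, Units.smul_def,
    zsmul_eq_mul]
  rfl

theorem alt_const_mul {r : ℕ} (c : ℂ) (F : (Fin r → E4) → ℂ) (v : Fin r → E4) :
    alt (fun w => c * F w) v = c * alt F v := by
  simp only [alt, Finset.mul_sum]
  exact Finset.sum_congr rfl fun σ _ => by ring

theorem sign_sq {r : ℕ} (σ : Equiv.Perm (Fin r)) :
    ((Equiv.Perm.sign σ : ℤ) : ℂ) * ((Equiv.Perm.sign σ : ℤ) : ℂ) = 1 := by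
  rcases Int.units_eq_one_or (Equiv.Perm.sign σ) with h | h <;> simp [h]

theorem alt_comp_perm {r : ℕ} (τ : Equiv.Perm (Fin r)) (F : (Fin r → E4) → ℂ) (v : Fin r → E4) :
    alt (fun w => F (w ∘ τ)) v = ((Equiv.Perm.sign τ : ℤ) : ℂ) * alt F v := by
  simp only [alt, Finset.mul_sum]
  refine Fintype.sum_equiv (Equiv.mulRight τ) _ _ fun σ => ?_
  simp only [Equiv.coe_mulRight, Equiv.Perm.sign_mul, Units.val_mul, Int.cast_mul,
    Equiv.Perm.coe_mul, Function.comp_assoc]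
  linear_combination (-((Equiv.Perm.sign σ : ℤ) : ℂ) * F (v ∘ (σ ∘ τ))) * sign_sq τ

/-- Partial antisymmetrization before a full one only contributes a factor. -/
theorem alt_partial {a r : ℕ} (ι : Equiv.Perm (Fin a) → Equiv.Perm (Fin r))
    (hι : ∀ τ, Equiv.Perm.sign (ι τ) = Equiv.Perm.sign τ) (F : (Fin r → E4) → ℂ)
    (v : Fin r → E4) :
    alt (fun w => ∑ τ : Equiv.Perm (Fin a), ((Equiv.Perm.sign τ : ℤ) : ℂ) * F (w ∘ ι τ)) v =
      (a.factorial : ℂ) * alt F v := by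
  have h : ∀ τ : Equiv.Perm (Fin a),
      ((Equiv.Perm.sign τ : ℤ) : ℂ) * alt (fun w => F (w ∘ ι τ)) v = alt F v := fun τ => by
    rw [alt_comp_perm, hι, ← mul_assoc, sign_sq, one_mul]
  calc _ = ∑ τ : Equiv.Perm (Fin a), ((Equiv.Perm.sign τ : ℤ) : ℂ) *
        alt (fun w => F (w ∘ ι τ)) v := by
        simp only [alt, Finset.mul_sum]
        rw [Finset.sum_comm]
        exact Finset.sum_congr rfl fun σ _ => Finset.sum_congr rfl fun τ _ => by ring
    _ = _ := by
        simp [h, Fintype.card_perm]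

/-- The positions of the two blocks as an equivalence. -/
def blockEquiv {p q r : ℕ} (h : p + q = r) : Fin p ⊕ Fin q ≃ Fin r :=
  finSumFinEquiv.trans (finCongr h)

theorem blockEquiv_inl {p q r : ℕ} (h : p + q = r) (i : Fin p) :
    blockEquiv h (Sum.inl i) = leftPos h i := rfl

theorem blockEquiv_inr {p q r : ℕ} (h : p + q = r) (i : Fin q) :
    blockEquiv h (Sum.inr i) = rightPos h i := rfl

/-- A pair of permutations acting on the two blocks. -/
def blockPerm {p q r : ℕ} (h : p + q = r) (σ : Equiv.Perm (Fin p)) (τ : Equiv.Perm (Fin q)) :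
    Equiv.Perm (Fin r) :=
  (blockEquiv h).permCongr (Equiv.sumCongr σ τ)

theorem sign_blockPerm {p q r : ℕ} (h : p + q = r) (σ : Equiv.Perm (Fin p))
    (τ : Equiv.Perm (Fin q)) :
    Equiv.Perm.sign (blockPerm h σ τ) = Equiv.Perm.sign σ * Equiv.Perm.sign τ := by
  rw [blockPerm, Equiv.Perm.sign_permCongr]
  exact Equiv.Perm.sign_sumCongr σ τ

theorem blockPerm_leftPos {p q r : ℕ} (h : p + q = r) (σ : Equiv.Perm (Fin p))
    (τ : Equiv.Perm (Fin q)) : blockPerm h σ τ ∘ leftPos h = leftPos h ∘ σ := by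
  funext i
  simp [blockPerm, ← blockEquiv_inl]

theorem blockPerm_rightPos {p q r : ℕ} (h : p + q = r) (σ : Equiv.Perm (Fin p))
    (τ : Equiv.Perm (Fin q)) : blockPerm h σ τ ∘ rightPos h = rightPos h ∘ τ := by
  funext i
  simp [blockPerm, ← blockEquiv_inr]

/-- The inner antisymmetrization is a sum over permutations of the left block only, so `alt_partial`
absorbs it into the outer one. This is how iterated wedge products become a single
antisymmetrization. -/
theorem alt_jux_alt_left {p q r : ℕ} (h : p + q = r) (F : (Fin p → E4) → ℂ)
    (G : (Fin q → E4) → ℂ) (v : Fin r → E4) :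
    alt (jux h (alt F) G) v = (p.factorial : ℂ) * alt (jux h F G) v := by
  rw [← alt_partial (fun τ => blockPerm h τ 1) (fun τ => by simp [sign_blockPerm])]
  congr 1
  funext w
  simp [jux, alt, Finset.sum_mul, mul_assoc, Function.comp_assoc, blockPerm_leftPos,
    blockPerm_rightPos]

theorem alt_jux_alt_right {p q r : ℕ} (h : p + q = r) (F : (Fin p → E4) → ℂ)
    (G : (Fin q → E4) → ℂ) (v : Fin r → E4) :
    alt (jux h F (alt G)) v = (q.factorial : ℂ) * alt (jux h F G) v := by
  rw [← alt_partial (fun τ => blockPerm h 1 τ) (fun τ => by simp [sign_blockPerm])]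
  congr 1
  funext w
  simp only [jux, alt, Finset.mul_sum, Function.comp_assoc, blockPerm_leftPos,
    blockPerm_rightPos]
  exact Finset.sum_congr rfl fun τ _ => by simp; ring

theorem jux_assoc {p q s a b r : ℕ} (h1 : p + q = a) (h2 : a + s = r) (h3 : q + s = b)
    (h4 : p + b = r) (F : (Fin p → E4) → ℂ) (G : (Fin q → E4) → ℂ) (H : (Fin s → E4) → ℂ) :
    jux h2 (jux h1 F G) H = jux h4 F (jux h3 G H) := by
  funext v
  have e1 : leftPos h2 ∘ leftPos h1 = leftPos h4 := by
    funext i; simp [leftPos, Fin.ext_iff]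
  have e2 : leftPos h2 ∘ rightPos h1 = rightPos h4 ∘ leftPos h3 := by
    funext i; simp [leftPos, rightPos, Fin.ext_iff]
  have e3 : rightPos h2 = rightPos h4 ∘ rightPos h3 := by
    funext i; simp [rightPos, Fin.ext_iff]; omega
  simp only [jux, Function.comp_assoc, e1, e2, e3, mul_assoc]

/-- Both sides are the antisymmetrized triple juxtaposition divided by p! q! s!: the factor a! (or
b!) gained from the inner antisymmetrization cancels the one in the outer normalization. -/
theorem wedge_assoc {p q s a b r : ℕ} (h1 : p + q = a) (h2 : a + s = r) (h3 : q + s = b)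
    (h4 : p + b = r) (α : Cov p) (β : Cov q) (γ : Cov s) :
    wedge h2 (wedge h1 α β) γ = wedge h4 α (wedge h3 β γ) := by
  ext v
  have e1 : jux h2 (wedge h1 α β) γ = fun w =>
      ((p.factorial * q.factorial : ℕ) : ℂ)⁻¹ * jux h2 (alt (jux h1 α β)) γ w := by
    funext w; simp only [jux, wedge_apply]; ring
  have e2 : jux h4 α (wedge h3 β γ) = fun w =>
      ((q.factorial * s.factorial : ℕ) : ℂ)⁻¹ * jux h4 α (alt (jux h3 β γ)) w := by
    funext w; simp only [jux, wedge_apply]; ring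
  rw [wedge_apply, wedge_apply, e1, e2, alt_const_mul, alt_const_mul, alt_jux_alt_left,
    alt_jux_alt_right, jux_assoc h1 h2 h3 h4]
  have ha : (a.factorial : ℂ) ≠ 0 := by exact_mod_cast a.factorial_ne_zero
  have hb : (b.factorial : ℂ) ≠ 0 := by exact_mod_cast b.factorial_ne_zero
  push_cast
  field_simp

theorem finRotate_pow_val (r k : ℕ) (i : Fin r) :
    (((finRotate r) ^ k) i : ℕ) = (i + k) % r := by
  induction k with
  | zero => simp [Nat.mod_eq_of_lt i.2]
  | succ k ih =>
    rw [pow_succ', Equiv.Perm.mul_apply]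
    obtain ⟨m, rfl⟩ : ∃ m, r = m + 1 := ⟨r - 1, by have := i.2; omega⟩
    rw [finRotate_apply, Fin.val_add, ih]
    rcases m with _ | m
    · simp
    · rw [Fin.val_one, ← Nat.add_assoc]
      simp [Nat.add_mod]

/-- Rotation by p places exchanges the two blocks. Its sign is (-1)^((p+q-1)p), and (p+q-1)p has the
parity of pq because p(p-1) is even. -/
theorem wedge_comm {p q r : ℕ} (h : p + q = r) (h' : q + p = r) (α : Cov p) (β : Cov q) :
    wedge h α β = (-1 : ℂ) ^ (p * q) • wedge h' β α := by
  -- The sign formula for rotations is stated for a nonempty set of positions, so degree zero is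
  -- separate.
  rcases Nat.eq_zero_or_pos r with hr | hr
  · obtain rfl : p = 0 := by omega
    obtain rfl : q = 0 := by omega
    subst hr
    have hj : jux h α β = jux h' β α := by
      funext w
      simp only [jux]
      rw [mul_comm]
      congr 2 <;> exact Subsingleton.elim _ _
    ext v
    simp [wedge_apply, hj]
  ext v
  have hj : jux h α β = fun w => jux h' β α (w ∘ (finRotate r ^ p)) := by
    funext w
    simp only [jux]
    rw [mul_comm]
    congr 2
    · funext j
      simp only [Function.comp_apply]
      congr 1
      ext
      rw [finRotate_pow_val]
      have := j.2
      simp [leftPos, rightPos]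
      rw [Nat.mod_eq_of_lt (by omega)]; omega
    · funext j
      simp only [Function.comp_apply]
      congr 1
      ext
      rw [finRotate_pow_val]
      have := j.2
      simp [leftPos, rightPos]
      rw [show q + (j : ℕ) + p = j + r by omega, Nat.add_mod_right, Nat.mod_eq_of_lt (by omega)]
  have hs : ((Equiv.Perm.sign (finRotate r ^ p) : ℤ) : ℂ) = (-1) ^ (p * q) := by
    obtain ⟨m, rfl⟩ : ∃ m, r = m + 1 := ⟨r - 1, by omega⟩
    rw [map_pow, sign_finRotate]
    push_cast
    rw [← pow_mul]
    rcases p with _ | p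
    · simp
    · obtain rfl : m = p + q := by omega
      have e : Even ((p + 1) * p) := by rw [mul_comm]; exact Nat.even_mul_succ_self p
      rw [add_mul, pow_add, mul_comm p, e.neg_one_pow, one_mul, mul_comm]
  rw [wedge_apply, hj, alt_comp_perm, hs, ContinuousAlternatingMap.smul_apply, wedge_apply,
    smul_eq_mul, mul_comm (q.factorial)]
  ring

theorem wedge_compContinuousLinearMap {p q r : ℕ} (h : p + q = r) (α : Cov p) (β : Cov q)
    (L : E4 →L[ℝ] E4) :
    (wedge h α β).compContinuousLinearMap L =
      wedge h (α.compContinuousLinearMap L) (β.compContinuousLinearMap L) := by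
  ext v
  simp only [ContinuousAlternatingMap.compContinuousLinearMap_apply, wedge_apply, alt, jux]
  rfl

/-- Complex conjugation of covectors. -/
def conjCov {k : ℕ} (α : Cov k) : Cov k :=
  (Complex.conjCLE : ℂ →L[ℝ] ℂ).compContinuousAlternatingMap α

theorem conjCov_apply {k : ℕ} (α : Cov k) (v : Fin k → E4) :
    conjCov α v = (starRingEnd ℂ) (α v) := rfl

theorem conjCov_wedge {p q r : ℕ} (h : p + q = r) (α : Cov p) (β : Cov q) :
    conjCov (wedge h α β) = wedge h (conjCov α) (conjCov β) := by
  ext v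
  simp only [wedge_apply, alt, jux, conjCov_apply, map_mul, map_sum, map_inv₀]
  simp

theorem wedge_add_left {p q r : ℕ} (h : p + q = r) (α α' : Cov p) (β : Cov q) :
    wedge h (α + α') β = wedge h α β + wedge h α' β := by
  ext v
  simp only [wedge_apply, alt, jux, ContinuousAlternatingMap.add_apply, Finset.mul_sum,
    ← Finset.sum_add_distrib]
  exact Finset.sum_congr rfl fun σ _ => by ring

theorem wedge_add_right {p q r : ℕ} (h : p + q = r) (α : Cov p) (β β' : Cov q) :
    wedge h α (β + β') = wedge h α β + wedge h α β' := by
  ext v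
  simp only [wedge_apply, alt, jux, ContinuousAlternatingMap.add_apply, Finset.mul_sum,
    ← Finset.sum_add_distrib]
  exact Finset.sum_congr rfl fun σ _ => by ring

theorem wedge_smul_left {p q r : ℕ} (h : p + q = r) (c : ℂ) (α : Cov p) (β : Cov q) :
    wedge h (c • α) β = c • wedge h α β := by
  ext v
  simp only [wedge_apply, alt, jux, ContinuousAlternatingMap.smul_apply, Finset.mul_sum,
    smul_eq_mul]
  exact Finset.sum_congr rfl fun σ _ => by ring

theorem wedge_smul_right {p q r : ℕ} (h : p + q = r) (c : ℂ) (α : Cov p) (β : Cov q) :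
    wedge h α (c • β) = c • wedge h α β := by
  ext v
  simp only [wedge_apply, alt, jux, ContinuousAlternatingMap.smul_apply, Finset.mul_sum,
    smul_eq_mul]
  exact Finset.sum_congr rfl fun σ _ => by ring

/-- Finite dimension makes linear maps on covectors automatically continuous; this is how the wedge
product becomes a bounded bilinear map. -/
instance finiteDimensional_cov (k : ℕ) : FiniteDimensional ℂ (Cov k) := by
  have : Module.Finite ℝ (Cov k) := by
    let f : Cov k →ₗ[ℝ] MultilinearMap ℝ (fun _ : Fin k => E4) ℂ :=
      { toFun := fun α => α.toContinuousMultilinearMap.toMultilinearMap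
        map_add' := fun _ _ => rfl
        map_smul' := fun _ _ => rfl }
    exact Module.Finite.of_injective f fun α β h => by
      ext v
      exact congrArg (fun g : MultilinearMap ℝ (fun _ : Fin k => E4) ℂ => g v) h
  exact Module.Finite.of_restrictScalars_finite ℝ ℂ (Cov k)

/-- The wedge product as a continuous bilinear map. -/
def wedgeL {p q r : ℕ} (h : p + q = r) : Cov p →L[ℂ] Cov q →L[ℂ] Cov r :=
  LinearMap.toContinuousLinearMap
    { toFun := fun α => LinearMap.toContinuousLinearMap
        { toFun := fun β => wedge h α β
          map_add' := wedge_add_right h α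
          map_smul' := fun c β => wedge_smul_right h c α β }
      map_add' := fun α α' => by ext1 β; exact wedge_add_left h α α' β
      map_smul' := fun c α => by ext1 β; exact wedge_smul_left h c α β }

/-- `(v₀,…,v_p) ↦ A(v₀)(v₁,…,v_p)` -/
def headTail {p : ℕ} (A : E4 → (Fin p → E4) → ℂ) (v : Fin (p + 1) → E4) : ℂ :=
  A (v 0) (Fin.tail v)

theorem alt_alternating {r : ℕ} (α : Cov r) (v : Fin r → E4) :
    alt α v = (r.factorial : ℂ) * α v := by
  have h : ∀ σ : Equiv.Perm (Fin r), ((Equiv.Perm.sign σ : ℤ) : ℂ) * α (v ∘ σ) = α v := fun σ => by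
    have := α.toAlternatingMap.map_perm v σ
    simp only [ContinuousAlternatingMap.coe_toAlternatingMap] at this
    rw [this, Units.smul_def, zsmul_eq_mul, ← mul_assoc, sign_sq, one_mul]
  simp [alt, h, Fintype.card_perm]

/-- The operator `alternatizeUncurryFin` is an alternating sum over the vector put into the head
slot, and each summand is `headTail` composed with a cycle of sign (-1)^i. Antisymmetrizing the
alternating sum multiplies it by (p+1)!, while its p+1 summands all antisymmetrize to the same
function; the quotient is p!. -/
theorem alt_headTail {p : ℕ} (A : E4 →L[ℝ] Cov p) (v : Fin (p + 1) → E4) :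
    alt (headTail fun x => A x) v =
      (p.factorial : ℂ) * ContinuousAlternatingMap.alternatizeUncurryFin A v := by
  have h1 := alt_alternating (ContinuousAlternatingMap.alternatizeUncurryFin A) v
  have h2 : (ContinuousAlternatingMap.alternatizeUncurryFin A : (Fin (p + 1) → E4) → ℂ) =
      fun w => ∑ i : Fin (p + 1), (-1 : ℂ) ^ (i : ℕ) *
        headTail (fun x => A x) (w ∘ i.cycleRange.symm) := by
    funext w
    rw [ContinuousAlternatingMap.alternatizeUncurryFin_apply]
    refine Finset.sum_congr rfl fun i _ => ?_
    have : Fin.tail (w ∘ i.cycleRange.symm) = i.removeNth w := by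
      funext j
      simp [Fin.tail, Fin.removeNth]
    simp [headTail, this]
  have h3 : alt (ContinuousAlternatingMap.alternatizeUncurryFin A) v =
      (p + 1 : ℂ) * alt (headTail fun x => A x) v := by
    rw [h2]
    calc _ = ∑ i : Fin (p + 1), (-1 : ℂ) ^ (i : ℕ) *
          alt (fun w => headTail (fun x => A x) (w ∘ i.cycleRange.symm)) v := by
          simp only [alt, Finset.mul_sum]
          rw [Finset.sum_comm]
          exact Finset.sum_congr rfl fun σ _ => Finset.sum_congr rfl fun τ _ => by ring
      _ = ∑ i : Fin (p + 1), alt (headTail fun x => A x) v := by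
          refine Finset.sum_congr rfl fun i _ => ?_
          rw [alt_comp_perm, Equiv.Perm.sign_symm, Fin.sign_cycleRange]
          push_cast
          rw [← mul_assoc, ← mul_pow]
          simp
      _ = _ := by simp
  have hp : (p + 1 : ℂ) ≠ 0 := by exact_mod_cast Nat.succ_ne_zero p
  apply mul_left_cancel₀ hp
  rw [← h3, h1, Nat.factorial_succ]
  push_cast
  ring

/-- `decomposeFin.symm (0, τ)` fixes the head and permutes the tail by `τ`, with the same sign, so
`alt_partial` applies. -/
theorem alt_headTail_alt {p : ℕ} (A : E4 → (Fin p → E4) → ℂ) (v : Fin (p + 1) → E4) :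
    alt (headTail fun x => alt (A x)) v = (p.factorial : ℂ) * alt (headTail A) v := by
  rw [← alt_partial (fun τ => Equiv.Perm.decomposeFin.symm (0, τ)) (fun τ => by simp)]
  congr 1

/-- The algebraic half of the Leibniz rule. With the derivative slot in front, both sides are
multiples of the same antisymmetrized juxtaposition, and only the factorials have to be compared. -/
theorem alternatizeUncurryFin_wedge_left {p q r : ℕ} (h : p + q = r) (h' : p + 1 + q = r + 1)
    (A : E4 →L[ℝ] Cov p) (B : E4 →L[ℝ] Cov r) (β : Cov q) (hB : ∀ x, B x = wedge h (A x) β) :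
    ContinuousAlternatingMap.alternatizeUncurryFin B =
      wedge h' (ContinuousAlternatingMap.alternatizeUncurryFin A) β := by
  have hr : (r.factorial : ℂ) ≠ 0 := by exact_mod_cast r.factorial_ne_zero
  have hp : (p.factorial : ℂ) ≠ 0 := by exact_mod_cast p.factorial_ne_zero
  have hp1 : ((p + 1).factorial : ℂ) ≠ 0 := by exact_mod_cast (p + 1).factorial_ne_zero
  ext v
  apply mul_left_cancel₀ hr
  have e1 : (headTail fun x => B x) = fun w => ((p.factorial * q.factorial : ℕ) : ℂ)⁻¹ *
      headTail (fun x => alt (jux h (A x) β)) w := by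
    funext w
    simp only [headTail, hB, wedge_apply]
  have e2 : (headTail fun x => jux h (A x) β) = jux h' (headTail fun x => A x) β := by
    funext w
    simp only [headTail, jux]
    have a1 : (w ∘ leftPos h') 0 = w 0 := by
      simp [leftPos]
      congr 1
    have a2 : Fin.tail (w ∘ leftPos h') = Fin.tail w ∘ leftPos h := by
      funext j
      simp only [Fin.tail, Function.comp_apply]
      congr 1
    have a3 : w ∘ rightPos h' = Fin.tail w ∘ rightPos h := by
      funext j
      simp only [Fin.tail, Function.comp_apply]
      congr 1
      ext
      simp [rightPos]
      omega
    rw [a1, a2, a3]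
  have e3 : jux h' (ContinuousAlternatingMap.alternatizeUncurryFin A) β = fun w =>
      (p.factorial : ℂ)⁻¹ * jux h' (alt (headTail fun x => A x)) β w := by
    funext w
    simp only [jux, alt_headTail]
    field_simp
  rw [← alt_headTail, e1, alt_const_mul, alt_headTail_alt, e2, wedge_apply, e3, alt_const_mul,
    alt_jux_alt_left]
  push_cast
  field_simp

/-- Graded commutativity before and after reduces this to the left version. The exponents pq and
(q+1)p add up to p modulo 2, which is the sign of the Leibniz rule. -/
theorem alternatizeUncurryFin_wedge_right {p q r : ℕ} (h : p + q = r) (h' : p + (q + 1) = r + 1)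
    (A : E4 →L[ℝ] Cov q) (B : E4 →L[ℝ] Cov r) (α : Cov p) (hB : ∀ x, B x = wedge h α (A x)) :
    ContinuousAlternatingMap.alternatizeUncurryFin B =
      (-1 : ℂ) ^ p • wedge h' α (ContinuousAlternatingMap.alternatizeUncurryFin A) := by
  have hB' : ∀ x, ((-1 : ℂ) ^ (p * q) • B) x = wedge (show q + p = r by omega) (A x) α := fun x => by
    rw [_root_.smul_apply, hB, wedge_comm h (show q + p = r by omega), smul_smul,
      ← mul_pow]
    simp
  have := alternatizeUncurryFin_wedge_left (show q + p = r by omega)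
    (show q + 1 + p = r + 1 by omega) A _ α hB'
  rw [ContinuousAlternatingMap.alternatizeUncurryFin_smul,
    wedge_comm (show q + 1 + p = r + 1 by omega) h'] at this
  have h2 := congrArg (fun z => (-1 : ℂ) ^ (p * q) • z) this
  simp only [smul_smul, ← mul_pow, ← pow_add] at h2
  rw [show ((-1 : ℂ) * -1) ^ (p * q) = 1 by simp, one_smul] at h2
  rw [h2]
  congr 1
  rw [show p * q + (q + 1) * p = 2 * (p * q) + p by ring, pow_add, pow_mul]
  simp

/-! ## Fourier series of periodic functions -/

section Fourier

variable {n : ℕ} {V : Type*} [NormedAddCommGroup V] [NormedSpace ℝ V] [NormedSpace ℂ V]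

/-- `ℤⁿ`-periodic functions on `ℝⁿ`. -/
def IsPeriodic {Y : Type*} (f : (Fin n → ℝ) → Y) : Prop :=
  ∀ (k : Fin n → ℤ) (s : Fin n → ℝ), f (s + fun j => (k j : ℝ)) = f s

/-- The character `s ↦ e^{2πi m·s}`. -/
def expChar (m : Fin n → ℤ) (s : Fin n → ℝ) : ℂ :=
  Complex.exp (2 * Real.pi * Complex.I * ∑ j, (m j : ℂ) * (s j : ℂ))

/-- The Fourier coefficient of a periodic function. -/
def fcoef (f : (Fin n → ℝ) → V) (m : Fin n → ℤ) : V :=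
  ∫ s in Set.Icc (0 : Fin n → ℝ) 1,
    Complex.exp (-(2 * Real.pi * Complex.I * ∑ j, (m j : ℂ) * (s j : ℂ))) • f s

theorem expChar_neg (m : Fin n → ℤ) (s : Fin n → ℝ) :
    Complex.exp (-(2 * Real.pi * Complex.I * ∑ j, (m j : ℂ) * (s j : ℂ))) = expChar (-m) s := by
  simp [expChar]

theorem fcoef_eq (f : (Fin n → ℝ) → V) (m : Fin n → ℤ) :
    fcoef f m = ∫ s in Set.Icc (0 : Fin n → ℝ) 1, expChar (-m) s • f s := by
  simp only [fcoef, expChar_neg]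

theorem expChar_zero_left (s : Fin n → ℝ) : expChar 0 s = 1 := by simp [expChar]

theorem expChar_zero_right (m : Fin n → ℤ) : expChar m 0 = 1 := by simp [expChar]

theorem expChar_add_left (m k : Fin n → ℤ) (s : Fin n → ℝ) :
    expChar (m + k) s = expChar m s * expChar k s := by
  simp only [expChar, ← Complex.exp_add, ← mul_add, ← Finset.sum_add_distrib]
  congr 2
  exact Finset.sum_congr rfl fun j _ => by push_cast [Pi.add_apply]; ring

theorem expChar_add_right (m : Fin n → ℤ) (s t : Fin n → ℝ) :
    expChar m (s + t) = expChar m s * expChar m t := by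
  simp only [expChar, ← Complex.exp_add, ← mul_add, ← Finset.sum_add_distrib]
  congr 2
  exact Finset.sum_congr rfl fun j _ => by push_cast [Pi.add_apply]; ring

theorem norm_expChar (m : Fin n → ℤ) (s : Fin n → ℝ) : ‖expChar m s‖ = 1 := by
  rw [expChar, show 2 * Real.pi * Complex.I * ∑ j, (m j : ℂ) * (s j : ℂ) =
    ((2 * Real.pi * ∑ j, (m j : ℝ) * s j : ℝ) : ℂ) * Complex.I by push_cast; ring]
  exact Complex.norm_exp_ofReal_mul_I _

theorem expChar_mul_neg (m : Fin n → ℤ) (s : Fin n → ℝ) : expChar m s * expChar (-m) s = 1 := by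
  rw [← expChar_add_left, add_neg_cancel, expChar_zero_left]

theorem isPeriodic_expChar (m : Fin n → ℤ) : IsPeriodic (expChar m) := by
  intro k s
  rw [expChar_add_right]
  have : expChar m (fun j => (k j : ℝ)) = 1 := by
    rw [expChar, Complex.exp_eq_one_iff]
    refine ⟨∑ j, m j * k j, ?_⟩
    push_cast
    ring
  rw [this, mul_one]

theorem contDiff_expChar (m : Fin n → ℤ) : ContDiff ℝ ∞ (expChar m) := by
  unfold expChar
  have h : ∀ j, ContDiff ℝ ∞ fun s : Fin n → ℝ => ((s j : ℝ) : ℂ) := fun j =>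
    Complex.ofRealCLM.contDiff.comp (contDiff_apply ℝ ℝ j)
  fun_prop

theorem conj_expChar (m : Fin n → ℤ) (s : Fin n → ℝ) :
    (starRingEnd ℂ) (expChar m s) = expChar (-m) s := by
  rw [expChar, ← Complex.exp_conj]
  simp only [expChar, map_mul, map_sum, Complex.conj_I, Complex.conj_ofReal, map_ofNat, map_intCast,
    Pi.neg_apply, Int.cast_neg, neg_mul, Finset.sum_neg_distrib, mul_neg]

theorem IsPeriodic.exists_mem_Icc {Y : Type*} {f : (Fin n → ℝ) → Y} (hf : IsPeriodic f)
    (s : Fin n → ℝ) : ∃ t ∈ Set.Icc (0 : Fin n → ℝ) 1, f t = f s := by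
  refine ⟨fun j => Int.fract (s j), ⟨fun j => Int.fract_nonneg _,
    fun j => (Int.fract_lt_one _).le⟩, ?_⟩
  rw [← hf (fun j => ⌊s j⌋)]
  congr 1
  funext j
  simp

/-- Passing to the quotient torus gives access to the invariance of Haar measure and to Fourier
inversion. -/
theorem IsPeriodic.torus_lift {Y : Type*} [TopologicalSpace Y] {f : (Fin n → ℝ) → Y}
    (hf : IsPeriodic f) (hc : Continuous f) :
    ∃ g : C(UnitAddTorus (Fin n), Y), ∀ s : Fin n → ℝ, g (fun i => (s i : UnitAddCircle)) = f s := by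
  let π : C(Fin n → ℝ, UnitAddTorus (Fin n)) :=
    ⟨Pi.map fun (_ : Fin n) (x : ℝ) => (x : UnitAddCircle),
      (IsOpenQuotientMap.piMap fun _ => QuotientAddGroup.isOpenQuotientMap_mk).continuous⟩
  have hq : Topology.IsQuotientMap π :=
    (IsOpenQuotientMap.piMap fun _ => QuotientAddGroup.isOpenQuotientMap_mk).isQuotientMap
  have hfac : Function.FactorsThrough f π := by
    intro a b hab
    have h1 : ∀ j, ∃ k : ℤ, b j + k = a j := fun j => by
      have h2 : (a j : UnitAddCircle) = (b j : UnitAddCircle) := congrFun hab j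
      rw [← sub_eq_zero, ← AddCircle.coe_sub, AddCircle.coe_eq_zero_iff] at h2
      obtain ⟨k, hk⟩ := h2
      refine ⟨k, ?_⟩
      rw [zsmul_one] at hk
      linarith
    choose k hk using h1
    rw [← hf k b]
    congr 1
    funext j
    exact (hk j).symm
  exact ⟨hq.lift ⟨f, hc⟩ hfac, fun s => DFunLike.congr_fun (hq.lift_comp ⟨f, hc⟩ hfac) s⟩

/-- The normalized Haar measure of the torus. -/
abbrev torusMeasure (n : ℕ) : Measure (UnitAddTorus (Fin n)) :=
  Measure.pi fun _ => AddCircle.haarAddCircle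

omit [NormedSpace ℂ V] in
theorem integral_Icc_eq_torus (g : UnitAddTorus (Fin n) → V) :
    ∫ s in Set.Icc (0 : Fin n → ℝ) 1, g (fun i => (s i : UnitAddCircle)) = ∫ x, g x ∂(torusMeasure n) := by
  refine Eq.trans ?_ (UnitAddTorus.integral_preimage g 0).symm
  have : {x : Fin n → ℝ | ∀ i, x i ∈ Set.Ioc ((0 : Fin n → ℝ) i) ((0 : Fin n → ℝ) i + 1)} =
      Set.univ.pi fun i => Set.Ioc ((0 : Fin n → ℝ) i) ((1 : Fin n → ℝ) i) := by
    ext x; simp [Set.mem_pi]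
  rw [this]
  exact (setIntegral_congr_set Measure.univ_pi_Ioc_ae_eq_Icc).symm

omit [NormedSpace ℂ V] in
theorem IsPeriodic.integral_shift {f : (Fin n → ℝ) → V} (hf : IsPeriodic f) (hc : Continuous f)
    (t : Fin n → ℝ) :
    ∫ s in Set.Icc (0 : Fin n → ℝ) 1, f (s + t) = ∫ s in Set.Icc (0 : Fin n → ℝ) 1, f s := by
  obtain ⟨g, hg⟩ := hf.torus_lift hc
  simp only [← hg]
  rw [integral_Icc_eq_torus g, ← integral_add_right_eq_self _ (fun i => (t i : UnitAddCircle)),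
    ← integral_Icc_eq_torus]
  rfl

theorem fcoef_shift {f : (Fin n → ℝ) → V} (hf : IsPeriodic f) (hc : Continuous f)
    (t : Fin n → ℝ) (m : Fin n → ℤ) :
    fcoef (fun s => f (s + t)) m = expChar m t • fcoef f m := by
  rw [fcoef_eq, fcoef_eq, ← IsPeriodic.integral_shift (f := fun s => expChar (-m) s • f s) _ _ t,
    ← integral_smul]
  · congr 1
    funext s
    rw [expChar_add_right, smul_smul, mul_left_comm, expChar_mul_neg, mul_one]
  · intro k s
    simp only [isPeriodic_expChar _ k s, hf k s]
  · exact (contDiff_expChar _).continuous.smul hc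

theorem hasSum_fcoef_complex {f : (Fin n → ℝ) → ℂ} (hf : IsPeriodic f) (hc : Continuous f)
    (hs : Summable (fcoef f)) (s : Fin n → ℝ) : HasSum (fun m => expChar m s • fcoef f m) (f s) := by
  obtain ⟨g, hg⟩ := hf.torus_lift hc
  have h1 : ∀ (m : Fin n → ℤ) (s : Fin n → ℝ),
      UnitAddTorus.mFourier m (fun i => (s i : UnitAddCircle)) = expChar m s := by
    intro m s
    simp only [UnitAddTorus.mFourier, ContinuousMap.coe_mk, fourier_coe_apply, expChar,
      ← Complex.exp_sum, Finset.mul_sum]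
    congr 1
    exact Finset.sum_congr rfl fun j _ => by push_cast; ring
  have h2 : ∀ m, UnitAddTorus.mFourierCoeff g m = fcoef f m := by
    intro m
    refine (integral_Icc_eq_torus fun t => UnitAddTorus.mFourier (-m) t • g t).symm.trans ?_
    rw [fcoef_eq]
    simp only [h1, hg]
  have h3 := UnitAddTorus.hasSum_mFourier_series_apply_of_summable (f := g)
    (by rwa [funext h2]) (fun i => (s i : UnitAddCircle))
  simp only [h2, h1, hg] at h3
  simpa [mul_comm] using h3

omit [NormedSpace ℝ V] in
theorem integrableOn_expChar_smul {f : (Fin n → ℝ) → V} (hc : Continuous f) (m : Fin n → ℤ) :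
    IntegrableOn (fun s => expChar m s • f s) (Set.Icc (0 : Fin n → ℝ) 1) :=
  ((contDiff_expChar m).continuous.smul hc).continuousOn.integrableOn_compact isCompact_Icc

theorem map_fcoef {W : Type*} [NormedAddCommGroup W] [NormedSpace ℝ W] [NormedSpace ℂ W]
    [CompleteSpace V] [CompleteSpace W] {f : (Fin n → ℝ) → V} (hc : Continuous f)
    (m : Fin n → ℤ) (l : V →L[ℝ] W) (hl : ∀ (c : ℂ) (v : V), l (c • v) = c • l v) :
    l (fcoef f m) = fcoef (fun s => l (f s)) m := by
  rw [fcoef_eq, fcoef_eq, ← ContinuousLinearMap.integral_comp_comm l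
    (integrableOn_expChar_smul hc _)]
  simp only [hl]

/-- Continuous functionals separate points and commute with Fourier coefficients, so the
vector-valued inversion formula follows from the scalar one. -/
theorem hasSum_fcoef [CompleteSpace V] [IsScalarTower ℝ ℂ V] {f : (Fin n → ℝ) → V}
    (hf : IsPeriodic f) (hc : Continuous f) (hs : Summable (fun m => ‖fcoef f m‖))
    (s : Fin n → ℝ) : HasSum (fun m => expChar m s • fcoef f m) (f s) := by
  have hsum : Summable fun m => expChar m s • fcoef f m := by
    refine Summable.of_norm ?_
    simpa [norm_smul, norm_expChar] using hs
  convert! hsum.hasSum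
  refine (SeparatingDual.eq_iff_forall_dual_eq (R := ℂ)).2 fun l => ?_
  have e : ∀ m, l (fcoef f m) = fcoef (fun s => l (f s)) m := fun m =>
    map_fcoef hc m (l.restrictScalars ℝ) fun c v => l.map_smul c v
  have h1 : HasSum (fun m => expChar m s • fcoef (fun s => l (f s)) m) (l (f s)) := by
    refine hasSum_fcoef_complex (f := fun s => l (f s)) (fun k s => by simp only [hf k s])
      (l.continuous.comp hc) ?_ s
    refine Summable.of_norm_bounded (hs.mul_left ‖l‖) fun m => ?_
    rw [← e]
    exact l.le_opNorm _
  have h2 := hsum.hasSum.mapL l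
  simp only [map_smul, e] at h2
  exact h1.unique h2

omit [NormedSpace ℂ V] in
-- Divergence theorem on the unit cube: by periodicity the fluxes through opposite faces cancel. It
-- removes the boundary term when integrating by parts.
theorem integral_fderiv_single_eq_zero [CompleteSpace V] {f : (Fin n → ℝ) → V}
    (hf : IsPeriodic f) (hd : ContDiff ℝ 1 f) (j : Fin n) :
    ∫ s in Set.Icc (0 : Fin n → ℝ) 1, fderiv ℝ f s (Pi.single j 1) = 0 := by
  obtain ⟨m, rfl⟩ : ∃ m, n = m + 1 := ⟨n - 1, by have := j.2; omega⟩
  have hcont : Continuous fun s => fderiv ℝ f s (Pi.single j 1) :=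
    (hd.continuous_fderiv (by simp)).clm_apply continuous_const
  have h := integral_divergence_of_hasFDerivAt_off_countable' (E := V) (a := (0 : Fin (m + 1) → ℝ))
    (b := 1) zero_le_one (fun i => if i = j then f else 0)
    (fun i s => if i = j then fderiv ℝ f s else 0) ∅ Set.countable_empty
    (fun i => by
      split_ifs
      · exact hd.continuous.continuousOn
      · exact continuousOn_const)
    (fun s _ i => by
      split_ifs
      · exact (hd.differentiable one_ne_zero s).hasFDerivAt
      · exact hasFDerivAt_const _ _)
    (by
      have : (fun x => ∑ i : Fin (m + 1), (if i = j then fderiv ℝ f x else 0) (Pi.single i 1)) =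
          fun s => fderiv ℝ f s (Pi.single j 1) := by
        funext s
        rw [Finset.sum_eq_single j] <;> simp +contextual
      rw [this]
      exact hcont.continuousOn.integrableOn_compact isCompact_Icc)
  have hface : ∀ x : Fin m → ℝ, f (j.insertNth ((1 : Fin (m + 1) → ℝ) j) x) =
      f (j.insertNth ((0 : Fin (m + 1) → ℝ) j) x) := by
    intro x
    rw [← hf (Pi.single j 1) (j.insertNth ((0 : Fin (m + 1) → ℝ) j) x)]
    congr 1
    funext i
    rcases Fin.eq_self_or_eq_succAbove j i with rfl | ⟨l, rfl⟩ <;> simp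
  rw [Finset.sum_eq_single j (fun i _ hi => by simp [hi]) (by simp)] at h
  simp only [if_true, hface, sub_self] at h
  rw [← h]
  congr 1
  funext s
  rw [Finset.sum_eq_single j] <;> simp +contextual

/-- A finite set of indices lies in a box, and over a box the sum of products factors into
one-dimensional sums, each bounded by a convergent series. -/
theorem summable_weight (n : ℕ) :
    Summable fun m : Fin n → ℤ => ∏ j, (1 + (m j : ℝ) ^ 2)⁻¹ := by
  have h1 : Summable fun k : ℤ => (1 + (k : ℝ) ^ 2)⁻¹ := by
    have h2 := (Real.summable_one_div_int_pow (p := 2)).2 (by norm_num)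
    refine Summable.of_norm_bounded_eventually (h2) ?_
    rw [Filter.eventually_cofinite]
    refine (Set.finite_singleton (0 : ℤ)).subset fun k hk => ?_
    by_contra h0
    apply hk
    have h3 : (0 : ℝ) < (k : ℝ) ^ 2 := by
      have : (k : ℝ) ≠ 0 := by exact_mod_cast h0
      positivity
    rw [Real.norm_of_nonneg (by positivity), one_div]
    exact inv_anti₀ h3 (by linarith)
  refine summable_of_sum_le (c := ∏ _j : Fin n, ∑' k : ℤ, (1 + (k : ℝ) ^ 2)⁻¹)
    (fun m => by positivity) fun u => ?_
  have h2 : u ⊆ Fintype.piFinset fun j => u.image fun m => m j := fun m hm => by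
    rw [Fintype.mem_piFinset]
    exact fun j => Finset.mem_image_of_mem _ hm
  refine (Finset.sum_le_sum_of_subset_of_nonneg h2 fun m _ _ => by positivity).trans ?_
  rw [← Finset.prod_univ_sum (fun j => u.image fun m => m j)
    (fun _ (k : ℤ) => (1 + (k : ℝ) ^ 2)⁻¹)]
  refine Finset.prod_le_prod (fun j _ => by positivity) fun j _ => ?_
  exact h1.sum_le_tsum _ fun k _ => by positivity

/-- A function of `(s, y) ∈ ℝⁿ × U`, smooth, and periodic in `s`. -/
structure IsSmoothPeriodic {E : Type*} [NormedAddCommGroup E] [NormedSpace ℝ E] (U : Set E)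
    (A : (Fin n → ℝ) × E → V) : Prop where
  smooth : ContDiffOn ℝ ∞ A (Set.univ ×ˢ U)
  periodic : ∀ y, IsPeriodic fun s => A (s, y)

/-! ### Smooth families of periodic functions and uniform decay of their Fourier coefficients -/

section Param

variable {E : Type*} [NormedAddCommGroup E] [NormedSpace ℝ E] {U : Set E}
variable {A : (Fin n → ℝ) × E → V}

/-- The derivative in the `j`-th coordinate of `s`. -/
def dSlot (j : Fin n) (A : (Fin n → ℝ) × E → V) : (Fin n → ℝ) × E → V := fun p =>
  fderiv ℝ A p (Pi.single j 1, 0)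

/-- The derivative in `y`. -/
def dParam (A : (Fin n → ℝ) × E → V) : (Fin n → ℝ) × E → E →L[ℝ] V := fun p =>
  (fderiv ℝ A p).comp (ContinuousLinearMap.inr ℝ (Fin n → ℝ) E)

omit [NormedSpace ℂ V] in
theorem fderiv_periodic (h : ∀ y, IsPeriodic fun s => A (s, y)) (k : Fin n → ℤ) (s : Fin n → ℝ)
    (y : E) : fderiv ℝ A (s + fun j => (k j : ℝ), y) = fderiv ℝ A (s, y) := by
  have e : (fun p : (Fin n → ℝ) × E => A (p + (fun j => (k j : ℝ), (0 : E)))) = A := by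
    funext p
    obtain ⟨t, z⟩ := p
    have := h z k t
    simp only at this
    simp only [Prod.mk_add_mk, add_zero]
    exact this
  have h2 := fderiv_comp_add_right (𝕜 := ℝ) (f := A) (x := (s, y)) (fun j => (k j : ℝ), (0 : E))
  rw [e] at h2
  rw [h2]
  simp

omit [NormedSpace ℂ V] in
theorem IsSmoothPeriodic.fderiv (hA : IsSmoothPeriodic U A) (hU : IsOpen U) :
    IsSmoothPeriodic U (fderiv ℝ A) :=
  ⟨hA.smooth.fderiv_of_isOpen (isOpen_univ.prod hU) (by simp),
    fun y k s => fderiv_periodic hA.periodic k s y⟩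

omit [NormedSpace ℂ V] in
theorem IsSmoothPeriodic.clm {W : Type*} [NormedAddCommGroup W] [NormedSpace ℝ W]
    (hA : IsSmoothPeriodic U A) (l : V →L[ℝ] W) : IsSmoothPeriodic U fun p => l (A p) :=
  ⟨l.contDiff.comp_contDiffOn hA.smooth, fun y k s => congrArg l (hA.periodic y k s)⟩

omit [NormedSpace ℂ V] in
theorem IsSmoothPeriodic.dSlot (hA : IsSmoothPeriodic U A) (hU : IsOpen U) (j : Fin n) :
    IsSmoothPeriodic U (dSlot j A) :=
  (hA.fderiv hU).clm (ContinuousLinearMap.apply ℝ V (Pi.single j (1 : ℝ), (0 : E)))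

omit [NormedSpace ℂ V] in
theorem IsSmoothPeriodic.dParam (hA : IsSmoothPeriodic U A) (hU : IsOpen U) :
    IsSmoothPeriodic U (dParam A) :=
  (hA.fderiv hU).clm ((ContinuousLinearMap.compL ℝ E ((Fin n → ℝ) × E) V).flip
    (ContinuousLinearMap.inr ℝ (Fin n → ℝ) E))

omit [NormedSpace ℂ V] in
theorem IsSmoothPeriodic.differentiableAt (hA : IsSmoothPeriodic U A) (hU : IsOpen U)
    (s : Fin n → ℝ) {y : E} (hy : y ∈ U) : DifferentiableAt ℝ A (s, y) :=
  (hA.smooth.contDiffAt ((isOpen_univ.prod hU).mem_nhds ⟨trivial, hy⟩)).differentiableAt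
    (by simp)

omit [NormedSpace ℂ V] in
theorem IsSmoothPeriodic.contDiff_slice (hA : IsSmoothPeriodic U A) {y : E} (hy : y ∈ U) :
    ContDiff ℝ ∞ fun s => A (s, y) := by
  rw [← contDiffOn_univ]
  exact hA.smooth.comp ((contDiff_id.prodMk contDiff_const).contDiffOn) fun s _ => ⟨trivial, hy⟩

theorem fderiv_expChar_single (m : Fin n → ℤ) (s : Fin n → ℝ) (j : Fin n) :
    fderiv ℝ (expChar m) s (Pi.single j 1) = 2 * Real.pi * Complex.I * m j * expChar m s := by
  have h1 : HasDerivAt (fun t : ℝ => s + t • (Pi.single j 1 : Fin n → ℝ)) (Pi.single j 1) 0 := by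
    simpa using ((hasDerivAt_id (0 : ℝ)).smul_const (Pi.single j (1 : ℝ) : Fin n → ℝ)).const_add s
  have h2 := (((contDiff_expChar m).differentiable (by simp)
    (s + (0 : ℝ) • (Pi.single j 1 : Fin n → ℝ))).hasFDerivAt).comp_hasDerivAt _ h1
  have h3 : (expChar m ∘ fun t : ℝ => s + t • (Pi.single j 1 : Fin n → ℝ)) =
      fun t : ℝ => expChar m s * Complex.exp (2 * Real.pi * Complex.I * m j * t) := by
    funext t
    rw [Function.comp_apply, expChar_add_right]
    congr 1
    rw [expChar, Finset.sum_eq_single j]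
    · simp [mul_assoc]
    · intro i _ hi; simp [hi]
    · simp
  have h4 : HasDerivAt (fun t : ℝ => expChar m s * Complex.exp (2 * Real.pi * Complex.I * m j * t))
      (expChar m s * (Complex.exp (2 * Real.pi * Complex.I * m j * (0 : ℝ)) *
        (2 * Real.pi * Complex.I * m j * 1))) 0 :=
    ((((hasDerivAt_id (0 : ℝ)).ofReal_comp).const_mul _).cexp).const_mul _
  rw [h3] at h2
  have h5 := h2.unique h4
  rw [zero_smul, add_zero] at h5
  rw [h5]
  simp
  ring

/-- Integration by parts: the derivative of the periodic function `expChar (-m) • A` has integral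
zero over the cube. -/
theorem fcoef_dSlot [CompleteSpace V] [IsScalarTower ℝ ℂ V] (hA : IsSmoothPeriodic U A)
    (hU : IsOpen U) {y : E} (hy : y ∈ U) (j : Fin n) (m : Fin n → ℤ) :
    fcoef (fun s => dSlot j A (s, y)) m =
      (2 * Real.pi * Complex.I * m j : ℂ) • fcoef (fun s => A (s, y)) m := by
  have hg : ContDiff ℝ 1 fun s => expChar (-m) s • A (s, y) :=
    ((contDiff_expChar (-m)).smul (hA.contDiff_slice hy)).of_le (by simp)
  have hp : IsPeriodic fun s => expChar (-m) s • A (s, y) := fun k s => by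
    have h1 := isPeriodic_expChar (-m) k s
    have h2 := hA.periodic y k s
    simp only at h1 h2 ⊢
    rw [h1, h2]
  have h := integral_fderiv_single_eq_zero hp hg j
  have hd : ∀ s, _root_.fderiv ℝ (fun s => expChar (-m) s • A (s, y)) s (Pi.single j 1) =
      expChar (-m) s • dSlot j A (s, y) -
        (2 * Real.pi * Complex.I * m j : ℂ) • (expChar (-m) s • A (s, y)) := by
    intro s
    have e1 : HasFDerivAt (fun s => A (s, y)) ((_root_.fderiv ℝ A (s, y)).comp
        (ContinuousLinearMap.inl ℝ (Fin n → ℝ) E)) s :=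
      (hA.differentiableAt hU s hy).hasFDerivAt.comp s
        ((hasFDerivAt_id s).prodMk (hasFDerivAt_const y s))
    have e2 := (((contDiff_expChar (-m)).differentiable (by simp)) s).hasFDerivAt.smul e1
    refine (congrArg (fun l => l (Pi.single j 1)) e2.fderiv).trans ?_
    simp only [_root_.add_apply, _root_.smul_apply, ContinuousLinearMap.comp_apply,
      ContinuousLinearMap.inl_apply, ContinuousLinearMap.smulRight_apply, fderiv_expChar_single,
      dSlot, Pi.neg_apply, Int.cast_neg, smul_smul]
    rw [sub_eq_add_neg, ← neg_smul]
    congr 2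
    ring
  simp only [hd] at h
  rw [integral_sub, integral_smul, sub_eq_zero] at h
  · rw [fcoef_eq, fcoef_eq, h]
  · exact integrableOn_expChar_smul (hA.dSlot hU j |>.contDiff_slice hy).continuous _
  · exact Integrable.smul _ (integrableOn_expChar_smul (hA.contDiff_slice hy).continuous _)

omit [NormedSpace ℂ V] in
theorem IsSmoothPeriodic.exists_bound (hA : IsSmoothPeriodic U A) {K : Set E} (hK : IsCompact K)
    (hKU : K ⊆ U) : ∃ C, ∀ s, ∀ y ∈ K, ‖A (s, y)‖ ≤ C := by
  obtain ⟨C, hC⟩ := ((isCompact_Icc (a := (0 : Fin n → ℝ)) (b := 1)).prod hK).exists_bound_of_continuousOn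
    (hA.smooth.continuousOn.mono (Set.prod_mono (Set.subset_univ _) hKU))
  refine ⟨C, fun s y hy => ?_⟩
  obtain ⟨t, ht, hts⟩ := (hA.periodic y).exists_mem_Icc s
  exact (congrArg norm hts).symm.trans_le (hC (t, y) ⟨ht, hy⟩)

theorem norm_fcoef_le {f : (Fin n → ℝ) → V} {C : ℝ} (hC : ∀ s, ‖f s‖ ≤ C) (m : Fin n → ℤ) :
    ‖fcoef f m‖ ≤ C := by
  rw [fcoef_eq]
  refine (norm_setIntegral_le_of_norm_le_const (C := C) isCompact_Icc.measure_lt_top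
    fun s _ => ?_).trans ?_
  · rw [norm_smul, norm_expChar, one_mul]; exact hC s
  · simp [Measure.real, Real.volume_Icc_pi]

/-- The operator 1 - (4π²)⁻¹ ∂_j² multiplies the m-th coefficient by 1 + m_j²; it is applied once
for each j in `T`. -/
theorem IsSmoothPeriodic.exists_weighted [CompleteSpace V] [IsScalarTower ℝ ℂ V]
    (hA : IsSmoothPeriodic U A) (hU : IsOpen U) (T : Finset (Fin n)) :
    ∃ A' : (Fin n → ℝ) × E → V, IsSmoothPeriodic U A' ∧ ∀ y ∈ U, ∀ m,
      fcoef (fun s => A' (s, y)) m =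
        (∏ j ∈ T, (1 + (m j : ℝ) ^ 2)) • fcoef (fun s => A (s, y)) m := by
  induction T using Finset.induction_on with
  | empty => exact ⟨A, hA, fun y _ m => by simp⟩
  | insert j T hj ih =>
    obtain ⟨A', hA', h⟩ := ih
    have h2 := (hA'.dSlot hU j).dSlot hU j
    refine ⟨fun p => A' p - ((4 * Real.pi ^ 2)⁻¹ : ℝ) • NCYM.dSlot j (NCYM.dSlot j A') p,
      ⟨hA'.smooth.sub (h2.smooth.const_smul _), fun y k s => ?_⟩, fun y hy m => ?_⟩
    · have e1 := hA'.periodic y k s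
      have e2 := h2.periodic y k s
      simp only at e1 e2 ⊢
      rw [e1, e2]
    · have e := fcoef_dSlot (hA'.dSlot hU j) hU hy j m
      rw [fcoef_dSlot hA' hU hy j m] at e
      have e3 : fcoef (fun s => A' (s, y) -
          ((4 * Real.pi ^ 2)⁻¹ : ℝ) • NCYM.dSlot j (NCYM.dSlot j A') (s, y)) m =
          fcoef (fun s => A' (s, y)) m -
            ((4 * Real.pi ^ 2)⁻¹ : ℝ) • fcoef (fun s => NCYM.dSlot j (NCYM.dSlot j A') (s, y)) m := by
        simp only [fcoef_eq, smul_sub]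
        rw [integral_sub, ← integral_smul]
        · congr 2
          funext s
          rw [smul_comm]
        · exact integrableOn_expChar_smul (hA'.contDiff_slice hy).continuous _
        · exact integrableOn_expChar_smul ((h2.contDiff_slice hy).continuous.const_smul _) _
      rw [e3, e, Finset.prod_insert hj, mul_smul (1 + (m j : ℝ) ^ 2), ← h y hy m]
      have hpi : (Real.pi : ℂ) ≠ 0 := by exact_mod_cast Real.pi_ne_zero
      have hs : ∀ (c : ℝ) (v : V), c • v = (c : ℂ) • v := fun c v => (algebraMap_smul ℂ c v).symm
      rw [hs, hs, smul_smul, smul_smul]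
      nth_rewrite 1 [← one_smul ℂ (fcoef (fun s => A' (s, y)) m)]
      rw [← sub_smul]
      congr 1
      push_cast
      field_simp
      ring_nf
      rw [Complex.I_sq]
      ring

/-- The weighted coefficients are coefficients of another smooth family, hence bounded on `K` by its
supremum. The uniformity in y is what permits termwise differentiation. -/
theorem IsSmoothPeriodic.exists_decay [CompleteSpace V] [IsScalarTower ℝ ℂ V]
    (hA : IsSmoothPeriodic U A) (hU : IsOpen U) {K : Set E} (hK : IsCompact K) (hKU : K ⊆ U) :
    ∃ C, ∀ m, ∀ y ∈ K, ‖fcoef (fun s => A (s, y)) m‖ ≤ C * ∏ j, (1 + (m j : ℝ) ^ 2)⁻¹ := by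
  obtain ⟨A', hA', h⟩ := hA.exists_weighted hU Finset.univ
  obtain ⟨C, hC⟩ := hA'.exists_bound hK hKU
  refine ⟨C, fun m y hy => ?_⟩
  have h1 := norm_fcoef_le (fun s => hC s y hy) m
  have hp : 0 < ∏ j, (1 + (m j : ℝ) ^ 2) := Finset.prod_pos fun j _ => by positivity
  rw [h y (hKU hy) m, norm_smul, Real.norm_of_nonneg hp.le, mul_comm] at h1
  rw [Finset.prod_inv_distrib, ← div_eq_mul_inv, le_div_iff₀ hp]
  exact h1

end Param

theorem summable_norm_fcoef [CompleteSpace V] [IsScalarTower ℝ ℂ V] {f : (Fin n → ℝ) → V}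
    (hf : IsPeriodic f) (hd : ContDiff ℝ ∞ f) : Summable fun m => ‖fcoef f m‖ := by
  have hA : IsSmoothPeriodic (Set.univ : Set ℝ) fun p : (Fin n → ℝ) × ℝ => f p.1 :=
    ⟨(hd.comp contDiff_fst).contDiffOn, fun _ => hf⟩
  obtain ⟨C, hC⟩ := hA.exists_decay isOpen_univ (isCompact_singleton (x := (0 : ℝ)))
    (Set.subset_univ _)
  exact Summable.of_nonneg_of_le (fun m => norm_nonneg _) (fun m => hC m 0 rfl)
    ((summable_weight n).mul_left C)

/-! ### Differentiability of twisted Fourier sums in the parameter -/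

section TwistedSum

variable {E : Type*} [NormedAddCommGroup E] [NormedSpace ℝ E] [ProperSpace E] {U : Set E}
variable [CompleteSpace V] [IsScalarTower ℝ ℂ V]

omit [CompleteSpace V] in
theorem hasFDerivAt_fcoef {A : (Fin n → ℝ) × E → V} (hA : IsSmoothPeriodic U A) (hU : IsOpen U)
    {y : E} (hy : y ∈ U) (m : Fin n → ℤ) :
    HasFDerivAt (fun y => fcoef (fun s => A (s, y)) m) (fcoef (fun s => dParam A (s, y)) m) y := by
  obtain ⟨r, hr, hrU⟩ := Metric.nhds_basis_closedBall.mem_iff.1 (hU.mem_nhds hy)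
  obtain ⟨C, hC⟩ := (hA.dParam hU).exists_bound (isCompact_closedBall y r) hrU
  simp only [fcoef_eq]
  refine hasFDerivAt_integral_of_dominated_of_fderiv_le (𝕜 := ℝ) (bound := fun _ => C)
    (F := fun y s => expChar (-m) s • A (s, y))
    (F' := fun y s => expChar (-m) s • dParam A (s, y))
    (Metric.closedBall_mem_nhds y hr) ?_ ?_ ?_ ?_ ?_ ?_
  · filter_upwards [hU.mem_nhds hy] with z hz
    exact (integrableOn_expChar_smul (hA.contDiff_slice hz).continuous _).aestronglyMeasurable
  · exact integrableOn_expChar_smul (hA.contDiff_slice hy).continuous _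
  · exact (integrableOn_expChar_smul
      ((hA.dParam hU).contDiff_slice hy).continuous _).aestronglyMeasurable
  · refine Filter.Eventually.of_forall fun s z hz => ?_
    rw [norm_smul, norm_expChar, one_mul]
    exact hC s z hz
  · exact integrableOn_const isCompact_Icc.measure_lt_top.ne
  · refine Filter.Eventually.of_forall fun s z hz => ?_
    exact ((hA.differentiableAt hU s (hrU hz)).hasFDerivAt.comp z
      ((hasFDerivAt_const s z).prodMk (hasFDerivAt_id z))).const_smul (expChar (-m) s)

variable {W Z : Type*} [NormedAddCommGroup W] [NormedSpace ℝ W] [NormedAddCommGroup Z]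
  [NormedSpace ℝ Z]

/-- The sum `∑_m B(A_m(y), R(L(m), y))`, where `A_m` are the Fourier coefficients of `A`. -/
def twSum (B : V →L[ℝ] W →L[ℝ] Z) (L : (Fin n → ℤ) → Fin n → ℝ) (A : (Fin n → ℝ) × E → V)
    (R : (Fin n → ℝ) × E → W) (y : E) : Z :=
  ∑' m, B (fcoef (fun s => A (s, y)) m) (R (L m, y))

variable {A : (Fin n → ℝ) × E → V} {R : (Fin n → ℝ) × E → W}

omit [ProperSpace E] in
-- Only the first factor has to decay. The second is bounded uniformly in the torus variable by
-- periodicity, so the translations `L m` may be arbitrary.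
theorem exists_twSum_bound (B : V →L[ℝ] W →L[ℝ] Z) (L : (Fin n → ℤ) → Fin n → ℝ)
    (hA : IsSmoothPeriodic U A) (hR : IsSmoothPeriodic U R) (hU : IsOpen U) {K : Set E}
    (hK : IsCompact K) (hKU : K ⊆ U) : ∃ u : (Fin n → ℤ) → ℝ, Summable u ∧
      ∀ m, ∀ y ∈ K, ‖B (fcoef (fun s => A (s, y)) m) (R (L m, y))‖ ≤ u m := by
  obtain ⟨C, hC⟩ := hA.exists_decay hU hK hKU
  obtain ⟨C', hC'⟩ := hR.exists_bound hK hKU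
  refine ⟨fun m => (C * ∏ j, (1 + (m j : ℝ) ^ 2)⁻¹) * (‖B‖ * C'),
    ((summable_weight n).mul_left C).mul_right _, fun m y hy => ?_⟩
  refine (B.le_opNorm₂ _ _).trans ?_
  have h0 : 0 ≤ C' := (norm_nonneg _).trans (hC' 0 y hy)
  have h1 := mul_le_mul (hC m y hy) (hC' (L m) y hy) (norm_nonneg _)
    ((norm_nonneg _).trans (hC m y hy))
  calc _ = ‖B‖ * (‖fcoef (fun s => A (s, y)) m‖ * ‖R (L m, y)‖) := by ring
    _ ≤ _ := mul_le_mul_of_nonneg_left h1 (norm_nonneg B)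
    _ = _ := by ring

omit [ProperSpace E] in
theorem summable_twSum [CompleteSpace Z] (B : V →L[ℝ] W →L[ℝ] Z) (L : (Fin n → ℤ) → Fin n → ℝ)
    (hA : IsSmoothPeriodic U A) (hR : IsSmoothPeriodic U R) (hU : IsOpen U) {y : E} (hy : y ∈ U) :
    Summable fun m => B (fcoef (fun s => A (s, y)) m) (R (L m, y)) := by
  obtain ⟨u, hu, h⟩ := exists_twSum_bound B L hA hR hU (isCompact_singleton (x := y))
    (Set.singleton_subset_iff.2 hy)
  exact Summable.of_norm_bounded hu fun m => h m y rfl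

omit [CompleteSpace V] in
theorem hasFDerivAt_twSum_term (B : V →L[ℝ] W →L[ℝ] Z) (hA : IsSmoothPeriodic U A)
    (hR : IsSmoothPeriodic U R) (hU : IsOpen U) (m : Fin n → ℤ) (t : Fin n → ℝ) {z : E}
    (hz : z ∈ U) :
    HasFDerivAt (fun z => B (fcoef (fun s => A (s, z)) m) (R (t, z)))
      (B.precompR E (fcoef (fun s => A (s, z)) m) (dParam R (t, z)) +
        B.precompL E (fcoef (fun s => dParam A (s, z)) m) (R (t, z))) z := by
  have e : HasFDerivAt (fun z => R (t, z)) (dParam R (t, z)) z :=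
    (hR.differentiableAt hU t hz).hasFDerivAt.comp z
      ((hasFDerivAt_const t z).prodMk (hasFDerivAt_id z))
  exact B.hasFDerivAt_of_bilinear (hasFDerivAt_fcoef hA hU hz m) e

/-- The derivative of a twisted sum is again a sum of two twisted sums, for the bilinear maps
`precompR` and `precompL`. This closure property drives the induction on the order of smoothness. -/
theorem hasFDerivAt_twSum [CompleteSpace Z] (B : V →L[ℝ] W →L[ℝ] Z)
    (L : (Fin n → ℤ) → Fin n → ℝ) (hA : IsSmoothPeriodic U A) (hR : IsSmoothPeriodic U R)
    (hU : IsOpen U) {y : E} (hy : y ∈ U) :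
    HasFDerivAt (twSum B L A R)
      (twSum (B.precompR E) L A (dParam R) y + twSum (B.precompL E) L (dParam A) R y) y := by
  obtain ⟨r, hr, hrU⟩ := Metric.nhds_basis_closedBall.mem_iff.1 (hU.mem_nhds hy)
  obtain ⟨u, hu, h1⟩ := exists_twSum_bound (B.precompR E) L hA (hR.dParam hU) hU
    (isCompact_closedBall y r) hrU
  obtain ⟨u', hu', h2⟩ := exists_twSum_bound (B.precompL E) L (hA.dParam hU) hR hU
    (isCompact_closedBall y r) hrU
  have hsum := summable_twSum (B.precompR E) L hA (hR.dParam hU) hU hy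
  have hsum' := summable_twSum (B.precompL E) L (hA.dParam hU) hR hU hy
  have hball : ∀ z ∈ Metric.ball y r, z ∈ Metric.closedBall y r := fun z hz =>
    Metric.ball_subset_closedBall hz
  have hmain := hasFDerivAt_tsum_of_isPreconnected (𝕜 := ℝ) (hu.add hu')
    Metric.isOpen_ball (convex_ball y r).isPreconnected
    (fun m z hz => hasFDerivAt_twSum_term B hA hR hU m (L m) (hrU (hball z hz)))
    (fun m z hz => (norm_add_le _ _).trans (add_le_add (h1 m z (hball z hz)) (h2 m z (hball z hz))))
    (Metric.mem_ball_self hr) (summable_twSum B L hA hR hU hy) (Metric.mem_ball_self hr)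
  rw [hsum.tsum_add hsum'] at hmain
  exact hmain

end TwistedSum

section TwistedSumSmooth

/-- The spaces, the bilinear map and the families are generalized in the induction on `k`, because
the derivative involves families with values in spaces of linear maps out of `E`. All spaces lie in
one universe so that the induction hypothesis applies to them. -/
theorem contDiffOn_twSum {E : Type} [NormedAddCommGroup E] [NormedSpace ℝ E] [ProperSpace E]
    {U : Set E} (hU : IsOpen U) (L : (Fin n → ℤ) → Fin n → ℝ) (k : ℕ) :
    ∀ {V W Z : Type} [NormedAddCommGroup V] [NormedSpace ℝ V] [NormedSpace ℂ V] [CompleteSpace V]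
    [IsScalarTower ℝ ℂ V] [NormedAddCommGroup W] [NormedSpace ℝ W] [NormedAddCommGroup Z]
    [NormedSpace ℝ Z] [CompleteSpace Z] (B : V →L[ℝ] W →L[ℝ] Z)
    {A : (Fin n → ℝ) × E → V} {R : (Fin n → ℝ) × E → W}
    (_ : IsSmoothPeriodic U A) (_ : IsSmoothPeriodic U R), ContDiffOn ℝ k (twSum B L A R) U := by
  induction k with
  | zero =>
    intro V W Z _ _ _ _ _ _ _ _ _ _ B A R hA hR
    exact contDiffOn_zero.2 fun y hy =>
      (hasFDerivAt_twSum B L hA hR hU hy).continuousAt.continuousWithinAt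
  | succ k ih =>
    intro V W Z _ _ _ _ _ _ _ _ _ _ B A R hA hR
    have hcast : ((k + 1 : ℕ) : WithTop ℕ∞) = (k : WithTop ℕ∞) + 1 := by push_cast; rfl
    rw [hcast, contDiffOn_succ_iff_fderiv_of_isOpen hU]
    refine ⟨fun y hy => (hasFDerivAt_twSum B L hA hR hU hy).differentiableAt.differentiableWithinAt,
      fun h => by simp at h, ?_⟩
    refine ContDiffOn.congr ?_ fun y hy => (hasFDerivAt_twSum B L hA hR hU hy).fderiv
    exact (ih (B.precompR E) hA (hR.dParam hU)).add (ih (B.precompL E) (hA.dParam hU) hR)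

end TwistedSumSmooth

end Fourier

/-! ## Smooth forms in charts -/

section CovSmooth

theorem E4_expand (x : E4) : x = ∑ j, x j • stdVec j := by
  have := (EuclideanSpace.basisFun (Fin 4) ℝ).sum_repr x
  simpa [stdVec] using this.symm

theorem cov_expand {k : ℕ} (α : Cov k) (v : Fin k → E4) :
    α v = ∑ j : Fin k → Fin 4, ((∏ l, v l (j l) : ℝ) : ℂ) * α (stdVec ∘ j) := by
  conv_lhs => rw [show v = fun l => ∑ j, v l j • stdVec j from funext fun l => E4_expand (v l)]
  have h := α.toMultilinearMap.map_sum (fun (l : Fin k) (j : Fin 4) => v l j • stdVec j)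
  refine h.trans (Finset.sum_congr rfl fun j _ => ?_)
  have h2 := α.toMultilinearMap.map_smul_univ (fun l => v l (j l)) (fun l => stdVec (j l))
  refine h2.trans ?_
  rw [Complex.real_smul]
  rfl

variable {D : Type*} [NormedAddCommGroup D] [NormedSpace ℝ D] {S : Set D} {k : ℕ}

/-- The values of a covector on tuples of standard basis vectors. -/
def covCoords (k : ℕ) : Cov k →ₗ[ℝ] ((Fin k → Fin 4) → ℂ) where
  toFun α j := α (stdVec ∘ j)
  map_add' _ _ := rfl
  map_smul' _ _ := rfl

theorem covCoords_injective (k : ℕ) : Function.Injective (covCoords k) := by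
  intro α β h
  ext v
  rw [cov_expand α, cov_expand β]
  exact Finset.sum_congr rfl fun j _ => by
    rw [show α (stdVec ∘ j) = β (stdVec ∘ j) from congrFun h j]

instance finiteDimensional_real_cov (k : ℕ) : FiniteDimensional ℝ (Cov k) :=
  Module.Finite.of_injective _ (covCoords_injective k)

/-- A covector is a linear function of its values on tuples of basis vectors, via a left inverse of
`covCoords`. -/
theorem contDiffOn_cov {F : D → Cov k} {N : WithTop ℕ∞}
    (h : ∀ j : Fin k → Fin 4, ContDiffOn ℝ N (fun y => F y (stdVec ∘ j)) S) :
    ContDiffOn ℝ N F S := by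
  obtain ⟨g, hg⟩ := (covCoords k).exists_leftInverse_of_injective
    (LinearMap.ker_eq_bot.2 (covCoords_injective k))
  have e : F = fun y => LinearMap.toContinuousLinearMap g (fun j => F y (stdVec ∘ j)) := by
    funext y
    exact (LinearMap.congr_fun hg (F y)).symm
  rw [e]
  exact (LinearMap.toContinuousLinearMap g).contDiff.comp_contDiffOn (contDiffOn_pi.2 h)

theorem contDiffOn_cov_apply {F : D → Cov k} {v : Fin k → D → E4} {N : WithTop ℕ∞}
    (hF : ContDiffOn ℝ N F S) (hv : ∀ l, ContDiffOn ℝ N (v l) S) :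
    ContDiffOn ℝ N (fun y => F y fun l => v l y) S := by
  have e : (fun y => F y fun l => v l y) =
      fun y => ∑ j : Fin k → Fin 4, ((∏ l, v l y (j l) : ℝ) : ℂ) * F y (stdVec ∘ j) :=
    funext fun y => cov_expand _ _
  rw [e]
  refine ContDiffOn.sum fun j _ => ContDiffOn.mul ?_ ?_
  · refine Complex.ofRealCLM.contDiff.comp_contDiffOn
      (f := fun y => ∏ l, v l y (j l)) (contDiffOn_prod fun l _ => ?_)
    exact (EuclideanSpace.proj (𝕜 := ℝ) (j l)).contDiff.comp_contDiffOn (hv l)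
  · let ev : Cov k →L[ℝ] ℂ := LinearMap.toContinuousLinearMap
      { toFun := fun α => α (stdVec ∘ j), map_add' := fun _ _ => rfl, map_smul' := fun _ _ => rfl }
    exact ev.contDiff.comp_contDiffOn hF

theorem contDiffOn_compContinuousLinearMap {F : D → Cov k} {L : D → E4 →L[ℝ] E4}
    {N : WithTop ℕ∞} (hF : ContDiffOn ℝ N F S) (hL : ContDiffOn ℝ N L S) :
    ContDiffOn ℝ N (fun y => (F y).compContinuousLinearMap (L y)) S :=
  contDiffOn_cov fun j => contDiffOn_cov_apply (v := fun l y => L y (stdVec (j l))) hF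
    fun _ => hL.clm_apply contDiffOn_const

end CovSmooth

/-! ### Change of charts, pull-back and exterior derivative -/

section Charts

variable {M : Type*} [TopologicalSpace M] [ChartedSpace E4 M] [IsManifold (𝓡 4) ∞ M]

theorem chart_mdifferentiable (c : M) : (chartAt E4 c).MDifferentiable (𝓡 4) (𝓡 4) :=
  mdifferentiable_chart c

/-- The derivative of the chart at `c`. -/
def chartDeriv (c x : M) : E4 →L[ℝ] E4 := mfderiv (𝓡 4) (𝓡 4) (chartAt E4 c) x

theorem chartSymmDeriv_comp_chartDeriv (c : M) {x : M} (hx : x ∈ (chartAt E4 c).source) :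
    (chartSymmDeriv c (chartAt E4 c x)).comp (chartDeriv c x) = ContinuousLinearMap.id ℝ E4 :=
  (chart_mdifferentiable c).symm_comp_deriv hx

theorem chartDeriv_comp_chartSymmDeriv (c : M) {y : E4} (hy : y ∈ (chartAt E4 c).target) :
    (chartDeriv c ((chartAt E4 c).symm y)).comp (chartSymmDeriv c y) =
      ContinuousLinearMap.id ℝ E4 :=
  (chart_mdifferentiable c).comp_symm_deriv hy

theorem form_eq_inChart {k : ℕ} (α : Form M k) (c : M) {x : M} (hx : x ∈ (chartAt E4 c).source) :
    α x = (inChart c α (chartAt E4 c x)).compContinuousLinearMap (chartDeriv c x) := by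
  ext v
  have h := chartSymmDeriv_comp_chartDeriv c hx
  simp only [inChart, ContinuousAlternatingMap.compContinuousLinearMap_apply,
    (chartAt E4 c).left_inv hx]
  congr 1
  funext l
  exact (DFunLike.congr_fun h (v l)).symm

theorem form_ext {k : ℕ} {α β : Form M k}
    (h : ∀ c : M, ∀ y ∈ (chartAt E4 c).target, inChart c α y = inChart c β y) : α = β := by
  funext x
  have hx := mem_chart_source E4 x
  rw [form_eq_inChart α x hx, form_eq_inChart β x hx, h x _ ((chartAt E4 x).map_source hx)]

/-- The tangent map of a self-map of `M`. -/
def tderiv (f : M → M) (x : M) : E4 →L[ℝ] E4 := mfderiv (𝓡 4) (𝓡 4) f x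

omit [IsManifold (𝓡 4) ∞ M] in
theorem pullback_apply {k : ℕ} (f : M → M) (α : Form M k) (x : M) (v : Fin k → E4) :
    pullback f α x v = α (f x) fun l => tderiv f x (v l) := rfl

theorem fderiv_chart_comp {f : M → M} {c c' : M} {y : E4} (hy : y ∈ (chartAt E4 c).target)
    (hf : MDifferentiableAt (𝓡 4) (𝓡 4) f ((chartAt E4 c).symm y))
    (hc' : f ((chartAt E4 c).symm y) ∈ (chartAt E4 c').source) :
    fderiv ℝ (fun z => chartAt E4 c' (f ((chartAt E4 c).symm z))) y =
      (chartDeriv c' (f ((chartAt E4 c).symm y))).comp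
        ((tderiv f ((chartAt E4 c).symm y)).comp (chartSymmDeriv c y)) := by
  have h1 := (chart_mdifferentiable c).mdifferentiableAt_symm hy
  have h2 := (chart_mdifferentiable c').mdifferentiableAt hc'
  have h3 := (h2.hasMFDerivAt.comp y (hf.hasMFDerivAt.comp _ h1.hasMFDerivAt))
  rw [← mfderiv_eq_fderiv]
  exact h3.mfderiv

theorem inChart_pullback {k : ℕ} {f : M → M} (α : Form M k) {c c' : M} {y : E4}
    (hy : y ∈ (chartAt E4 c).target)
    (hf : MDifferentiableAt (𝓡 4) (𝓡 4) f ((chartAt E4 c).symm y))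
    (hc' : f ((chartAt E4 c).symm y) ∈ (chartAt E4 c').source) :
    inChart c (pullback f α) y =
      (inChart c' α (chartAt E4 c' (f ((chartAt E4 c).symm y)))).compContinuousLinearMap
        (fderiv ℝ (fun z => chartAt E4 c' (f ((chartAt E4 c).symm z))) y) := by
  rw [fderiv_chart_comp hy hf hc']
  ext v
  have h := chartSymmDeriv_comp_chartDeriv c' hc'
  simp only [inChart, ContinuousAlternatingMap.compContinuousLinearMap_apply,
    (chartAt E4 c').left_inv hc', pullback_apply]
  congr 1
  funext l
  exact (DFunLike.congr_fun h _).symm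

omit [IsManifold (𝓡 4) ∞ M] in
theorem pullback_id {k : ℕ} (α : Form M k) : pullback (fun x : M => x) α = α := by
  funext x
  ext v
  rw [pullback_apply]
  congr 1
  funext l
  exact DFunLike.congr_fun (mfderiv_id (I := 𝓡 4) (x := x)) (v l)

/-- The transition rule is the pull-back rule for the identity map. -/
theorem inChart_change {k : ℕ} (α : Form M k) {c c' : M} {y : E4}
    (hy : y ∈ (chartAt E4 c).target) (hc' : (chartAt E4 c).symm y ∈ (chartAt E4 c').source) :
    inChart c α y =
      (inChart c' α (chartAt E4 c' ((chartAt E4 c).symm y))).compContinuousLinearMap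
        (fderiv ℝ (fun z => chartAt E4 c' ((chartAt E4 c).symm z)) y) := by
  have := inChart_pullback (f := fun x => x) α hy mdifferentiableAt_id hc'
  rwa [pullback_id] at this

theorem contDiffAt_chart_comp {f : M → M} (hf : ContMDiff (𝓡 4) (𝓡 4) ∞ f) {c c' : M} {y : E4}
    (hy : y ∈ (chartAt E4 c).target) (hc' : f ((chartAt E4 c).symm y) ∈ (chartAt E4 c').source) :
    ContDiffAt ℝ ∞ (fun z => chartAt E4 c' (f ((chartAt E4 c).symm z))) y := by
  rw [← contMDiffAt_iff_contDiffAt]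
  have h1 : ContMDiffAt (𝓡 4) (𝓡 4) ∞ (chartAt E4 c).symm y :=
    (contMDiffOn_chart_symm (x := c)).contMDiffAt ((chartAt E4 c).open_target.mem_nhds hy)
  have h2 : ContMDiffAt (𝓡 4) (𝓡 4) ∞ (chartAt E4 c') (f ((chartAt E4 c).symm y)) :=
    (contMDiffOn_chart (x := c')).contMDiffAt ((chartAt E4 c').open_source.mem_nhds hc')
  exact h2.comp y ((hf _).comp y h1)

omit [IsManifold (𝓡 4) ∞ M] in
theorem eventually_mem_target {f : M → M} (hf : Continuous f) {c c' : M} {y : E4}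
    (hy : y ∈ (chartAt E4 c).target) (hc' : f ((chartAt E4 c).symm y) ∈ (chartAt E4 c').source) :
    ∀ᶠ z in nhds y, z ∈ (chartAt E4 c).target ∧
      f ((chartAt E4 c).symm z) ∈ (chartAt E4 c').source := by
  refine Filter.Eventually.and ((chartAt E4 c).open_target.mem_nhds hy) ?_
  have h1 : ContinuousAt (fun z => f ((chartAt E4 c).symm z)) y :=
    hf.continuousAt.comp ((chartAt E4 c).continuousAt_symm hy)
  exact h1 ((chartAt E4 c').open_source.mem_nhds hc')

theorem minSmoothness_two_le : minSmoothness ℝ 2 ≤ (∞ : WithTop ℕ∞) := by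
  rw [minSmoothness_of_isRCLikeNormedField]
  exact WithTop.coe_le_coe.2 (le_top : (2 : ℕ∞) ≤ ⊤)

omit [IsManifold (𝓡 4) ∞ M] in
theorem IsSmooth.contDiffAt {k : ℕ} {α : Form M k} (hα : IsSmooth α) {c : M} {y : E4}
    (hy : y ∈ (chartAt E4 c).target) : ContDiffAt ℝ ∞ (inChart c α) y :=
  (hα c).contDiffAt ((chartAt E4 c).open_target.mem_nhds hy)

omit [IsManifold (𝓡 4) ∞ M] in
theorem extd_apply {k : ℕ} (α : Form M k) (x : M) (v : Fin (k + 1) → E4) :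
    extd α x v = extDeriv (inChart x α) (chartAt E4 x x) fun l => chartDeriv x x (v l) := rfl

/-- The definition of `extd` uses a chart that varies with the point. Naturality of the exterior
derivative under the transition map shows that one fixed chart computes it on its whole domain. -/
theorem inChart_extd {k : ℕ} {α : Form M k} (hα : IsSmooth α) {c : M} {y : E4}
    (hy : y ∈ (chartAt E4 c).target) :
    inChart c (extd α) y = extDeriv (inChart c α) y := by
  set x := (chartAt E4 c).symm y with hx
  have hxs := mem_chart_source E4 x
  have hev : inChart c α =ᶠ[nhds y] fun z =>
      (inChart x α (chartAt E4 x ((chartAt E4 c).symm z))).compContinuousLinearMap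
        (fderiv ℝ (fun z => chartAt E4 x ((chartAt E4 c).symm z)) z) := by
    filter_upwards [eventually_mem_target (f := fun x : M => x) continuous_id hy hxs] with z hz
    exact inChart_change α hz.1 hz.2
  rw [hev.extDeriv_eq]
  have hsm := contDiffAt_chart_comp (f := fun x : M => x) contMDiff_id hy hxs
  have h2 := extDeriv_pullback
    (f := fun z => chartAt E4 x ((chartAt E4 c).symm z)) (x := y)
    ((hα.contDiffAt ((chartAt E4 x).map_source hxs)).differentiableAt (by simp)) hsm minSmoothness_two_le
  rw [h2, fderiv_chart_comp (f := fun x : M => x) hy mdifferentiableAt_id hxs]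
  ext v
  rw [inChart, ContinuousAlternatingMap.compContinuousLinearMap_apply, extd_apply]
  simp only [ContinuousAlternatingMap.compContinuousLinearMap_apply]
  congr 1
  funext l
  have h3 := DFunLike.congr_fun (mfderiv_id (I := 𝓡 4) (x := x)) (chartSymmDeriv c y (v l))
  exact congrArg (chartDeriv x x) h3.symm

theorem IsSmooth.extd {k : ℕ} {α : Form M k} (hα : IsSmooth α) : IsSmooth (extd α) := by
  intro c
  refine ContDiffOn.congr ?_ fun y hy => inChart_extd hα hy
  have h : ContDiffOn ℝ ∞ (fderiv ℝ (inChart c α)) (chartAt E4 c).target :=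
    (hα c).fderiv_of_isOpen (chartAt E4 c).open_target (by simp)
  exact (ContinuousAlternatingMap.alternatizeUncurryFinCLM ℝ E4 ℂ).contDiff.comp_contDiffOn h

theorem extd_extd {k : ℕ} {α : Form M k} (hα : IsSmooth α) : NCYM.extd (NCYM.extd α) = 0 := by
  refine form_ext fun c y hy => ?_
  rw [inChart_extd hα.extd hy]
  have hev : inChart c (NCYM.extd α) =ᶠ[nhds y] extDeriv (inChart c α) := by
    filter_upwards [(chartAt E4 c).open_target.mem_nhds hy] with z hz
    exact inChart_extd hα hz
  rw [hev.extDeriv_eq, extDeriv_extDeriv_apply (hα.contDiffAt hy) minSmoothness_two_le]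
  rfl

/-- In charts around a point and its image, this is the naturality of `extDeriv` under the
coordinate expression of `f`. -/
theorem extd_pullback {k : ℕ} {α : Form M k} (hα : IsSmooth α) {f : M → M}
    (hf : ContMDiff (𝓡 4) (𝓡 4) ∞ f) (hα' : IsSmooth (pullback f α)) :
    NCYM.extd (pullback f α) = pullback f (NCYM.extd α) := by
  refine form_ext fun c y hy => ?_
  set c' := f ((chartAt E4 c).symm y)
  have hc' : f ((chartAt E4 c).symm y) ∈ (chartAt E4 c').source := mem_chart_source E4 c'
  have hfd : MDifferentiable (𝓡 4) (𝓡 4) f := hf.mdifferentiable (by simp)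
  rw [inChart_extd hα' hy, inChart_pullback _ hy (hfd _) hc',
    inChart_extd hα ((chartAt E4 c').map_source hc')]
  have hev : inChart c (pullback f α) =ᶠ[nhds y] fun z =>
      (inChart c' α (chartAt E4 c' (f ((chartAt E4 c).symm z)))).compContinuousLinearMap
        (fderiv ℝ (fun z => chartAt E4 c' (f ((chartAt E4 c).symm z))) z) := by
    filter_upwards [eventually_mem_target hf.continuous hy hc'] with z hz
    exact inChart_pullback α hz.1 (hfd _) hz.2
  rw [hev.extDeriv_eq]
  exact extDeriv_pullback
    ((hα.contDiffAt ((chartAt E4 c').map_source hc')).differentiableAt (by simp))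
    (contDiffAt_chart_comp hf hy hc') minSmoothness_two_le

end Charts

/-! ## The deformed product -/

section Star

variable {M : Type*} [TopologicalSpace M] [ChartedSpace E4 M] [IsManifold (𝓡 4) ∞ M] {n : ℕ}
variable (X : ToricData M n)

/-- `(s, y) ↦ σ_s(α)` at `y`, in the chart at `c`. -/
def orbit {k : ℕ} (c : M) (α : Form M k) : (Fin n → ℝ) × E4 → Cov k := fun p =>
  inChart c (sigma X p.1 α) p.2

theorem act_contMDiff (s : Fin n → ℝ) : ContMDiff (𝓡 4) (𝓡 4) ∞ (X.act s) :=
  X.act_smooth.comp (contMDiff_const.prodMk contMDiff_id)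

theorem act_mdifferentiable (s : Fin n → ℝ) : MDifferentiable (𝓡 4) (𝓡 4) (X.act s) :=
  (act_contMDiff X s).mdifferentiable (by simp)

theorem act_add_int (k : Fin n → ℤ) (s : Fin n → ℝ) :
    X.act (s + fun j => (k j : ℝ)) = X.act s := by
  funext x
  rw [X.act_add, X.act_periodic]

theorem isPeriodic_sigma {k : ℕ} (α : Form M k) : IsPeriodic fun s => sigma X s α := by
  intro m s
  simp only [sigma, act_add_int]

theorem tderiv_act_add (s t : Fin n → ℝ) (x : M) (v : E4) :
    tderiv (X.act (s + t)) x v = tderiv (X.act s) (X.act t x) (tderiv (X.act t) x v) := by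
  have e : X.act (s + t) = X.act s ∘ X.act t := funext fun x => X.act_add s t x
  have h := mfderiv_comp x (act_mdifferentiable X s (X.act t x)) (act_mdifferentiable X t x)
  rw [tderiv, e]
  exact DFunLike.congr_fun h v

theorem sigma_apply {k : ℕ} (s : Fin n → ℝ) (α : Form M k) (x : M) (v : Fin k → E4) :
    sigma X s α x v = α (X.act s x) fun l => tderiv (X.act s) x (v l) := rfl

theorem sigma_eq {k : ℕ} (s : Fin n → ℝ) (α : Form M k) (x : M) :
    sigma X s α x = (α (X.act s x)).compContinuousLinearMap (tderiv (X.act s) x) := rfl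

theorem sigma_sigma {k : ℕ} (s t : Fin n → ℝ) (α : Form M k) :
    sigma X s (sigma X t α) = sigma X (s + t) α := by
  funext x
  ext v
  simp only [sigma_apply]
  rw [add_comm, X.act_add]
  congr 1
  funext l
  exact (tderiv_act_add X t s x (v l)).symm

theorem sigma_zero {k : ℕ} (α : Form M k) : sigma X 0 α = α := by
  have : X.act 0 = fun x => x := funext X.act_zero
  rw [sigma, this, pullback_id]

/-- Near a given pair, the orbit is the coordinate expression of `α` around the image point, pulled
back by the y-derivative of the jointly smooth coordinate expression `Ψ` of the action. -/
theorem isSmoothPeriodic_orbit {k : ℕ} {α : Form M k} (hα : IsSmooth α) (c : M) :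
    IsSmoothPeriodic (chartAt E4 c).target (orbit X c α) := by
  refine ⟨?_, fun y k s => ?_⟩
  · rintro ⟨s, y⟩ ⟨-, hy⟩
    set c' := X.act s ((chartAt E4 c).symm y)
    have hc' : X.act s ((chartAt E4 c).symm y) ∈ (chartAt E4 c').source := mem_chart_source E4 c'
    let Ψ : (Fin n → ℝ) × E4 → E4 := fun p => chartAt E4 c' (X.act p.1 ((chartAt E4 c).symm p.2))
    have hcont : ContinuousAt
        (fun p : (Fin n → ℝ) × E4 => X.act p.1 ((chartAt E4 c).symm p.2)) (s, y) :=
      ContinuousAt.comp (f := fun p : (Fin n → ℝ) × E4 => (p.1, (chartAt E4 c).symm p.2))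
        X.act_smooth.continuous.continuousAt
        (continuousAt_fst.prodMk (((chartAt E4 c).continuousAt_symm hy).comp continuousAt_snd))
    let O : Set ((Fin n → ℝ) × E4) := {p | p.2 ∈ (chartAt E4 c).target ∧
      X.act p.1 ((chartAt E4 c).symm p.2) ∈ (chartAt E4 c').source}
    have hO : O ∈ nhds (s, y) :=
      Filter.Eventually.and (continuousAt_snd ((chartAt E4 c).open_target.mem_nhds hy))
        (hcont ((chartAt E4 c').open_source.mem_nhds hc'))
    have hΨ : ∀ p ∈ O, ContDiffAt ℝ ∞ Ψ p := by
      rintro ⟨t, z⟩ ⟨hz, hz'⟩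
      rw [← contMDiffAt_iff_contDiffAt]
      have h1 : ContMDiffAt 𝓘(ℝ, (Fin n → ℝ) × E4) (𝓘(ℝ, Fin n → ℝ).prod (𝓡 4)) ∞
          (fun p : (Fin n → ℝ) × E4 => (p.1, (chartAt E4 c).symm p.2)) (t, z) :=
        contDiff_fst.contMDiff.contMDiffAt.prodMk (ContMDiffAt.comp (t, z)
          ((contMDiffOn_chart_symm (x := c)).contMDiffAt ((chartAt E4 c).open_target.mem_nhds hz))
          contDiff_snd.contMDiff.contMDiffAt)
      have h2 : ContMDiffAt (𝓡 4) (𝓡 4) ∞ (chartAt E4 c') (X.act t ((chartAt E4 c).symm z)) :=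
        (contMDiffOn_chart (x := c')).contMDiffAt ((chartAt E4 c').open_source.mem_nhds hz')
      exact h2.comp (t, z) ((X.act_smooth _).comp (t, z) h1)
    obtain ⟨O', hO'O, hO'open, hO'mem⟩ := mem_nhds_iff.1 hO
    have hΨ' : ContDiffOn ℝ ∞ Ψ O' := fun p hp => (hΨ p (hO'O hp)).contDiffWithinAt
    have hfd : ContDiffOn ℝ ∞ (fun p => (fderiv ℝ Ψ p).comp
        (ContinuousLinearMap.inr ℝ (Fin n → ℝ) E4)) O' := by
      have h : ContDiffOn ℝ ∞ (fderiv ℝ Ψ) O' := hΨ'.fderiv_of_isOpen hO'open (by simp)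
      exact h.clm_comp contDiffOn_const
    have hcomp : ContDiffOn ℝ ∞ (fun p => inChart c' α (Ψ p)) O' :=
      (hα c').comp hΨ' fun p hp => (chartAt E4 c').map_source (hO'O hp).2
    have hfin := contDiffOn_compContinuousLinearMap hcomp hfd
    refine ContDiffAt.contDiffWithinAt ?_
    refine (hfin.contDiffAt (hO'open.mem_nhds hO'mem)).congr_of_eventuallyEq ?_
    filter_upwards [hO'open.mem_nhds hO'mem] with p hp
    obtain ⟨t, z⟩ := p
    have hz := hO'O hp
    rw [orbit, sigma, inChart_pullback α hz.1 (act_mdifferentiable X t _) hz.2]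
    congr 1
    -- The derivative of the slice at fixed `t` is the joint derivative restricted to the second
    -- factor.
    exact (((hΨ _ hz).differentiableAt (by simp)).hasFDerivAt.comp z
      ((hasFDerivAt_const t z).prodMk (hasFDerivAt_id z))).fderiv
  · exact congrArg (fun β => inChart c β y) (isPeriodic_sigma X α k s)

theorem IsSmooth.sigma {k : ℕ} {α : Form M k} (hα : IsSmooth α) (s : Fin n → ℝ) :
    IsSmooth (sigma X s α) := fun c =>
  (isSmoothPeriodic_orbit X hα c).smooth.comp
    ((contDiff_const (c := s)).prodMk contDiff_id).contDiffOn fun _ hy => ⟨trivial, hy⟩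

theorem extd_sigma {k : ℕ} {α : Form M k} (hα : IsSmooth α) (s : Fin n → ℝ) :
    extd (sigma X s α) = sigma X s (extd α) :=
  extd_pullback hα (act_contMDiff X s) (hα.sigma X s)

theorem contDiff_sigma {k : ℕ} {α : Form M k} (hα : IsSmooth α) (x : M) :
    ContDiff ℝ ∞ fun s => sigma X s α x := by
  have hx := mem_chart_source E4 x
  have h := (isSmoothPeriodic_orbit X hα x).contDiff_slice ((chartAt E4 x).map_source hx)
  have e : (fun s => sigma X s α x) = fun s =>
      (orbit X x α (s, chartAt E4 x x)).compContinuousLinearMap (chartDeriv x x) :=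
    funext fun s => form_eq_inChart _ x hx
  rw [e, ← contDiffOn_univ]
  exact contDiffOn_compContinuousLinearMap h.contDiffOn contDiffOn_const

theorem isPeriodic_sigma_apply {k : ℕ} (α : Form M k) (x : M) :
    IsPeriodic fun s => sigma X s α x := fun k s => congrFun (isPeriodic_sigma X α k s) x

theorem component_eq {k : ℕ} (r : Fin n → ℤ) (α : Form M k) (x : M) :
    component X r α x = fcoef (fun s => sigma X s α x) r := rfl

theorem summable_norm_component {k : ℕ} {α : Form M k} (hα : IsSmooth α) (x : M) :
    Summable fun r => ‖component X r α x‖ :=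
  summable_norm_fcoef (isPeriodic_sigma_apply X α x) (contDiff_sigma X hα x)

theorem exists_bound_sigma {k : ℕ} {α : Form M k} (hα : IsSmooth α) (x : M) :
    ∃ C, ∀ s, ‖sigma X s α x‖ ≤ C := by
  obtain ⟨C, hC⟩ := (isCompact_Icc (a := (0 : Fin n → ℝ)) (b := 1)).exists_bound_of_continuousOn
    (contDiff_sigma X hα x).continuous.continuousOn
  refine ⟨C, fun s => ?_⟩
  obtain ⟨t, ht, hts⟩ := (isPeriodic_sigma_apply X α x).exists_mem_Icc s
  exact (congrArg norm hts).symm.trans_le (hC t ht)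

/-- The translation vector `½ m·θ`. -/
def twist (m : Fin n → ℤ) : Fin n → ℝ :=
  (1 / 2 : ℝ) • Matrix.vecMul (fun j => (m j : ℝ)) X.theta

theorem starMul_apply {p q r : ℕ} (h : p + q = r) (α : Form M p) (ρ : Form M q) (x : M) :
    starMul X h α ρ x =
      ∑' m : Fin n → ℤ, wedge h (component X m α x) (sigma X (twist X m) ρ x) := rfl

/-- The wedge product as a real bilinear map. -/
def wedgeR {p q r : ℕ} (h : p + q = r) : Cov p →L[ℝ] Cov q →L[ℝ] Cov r :=
  (wedgeL h).bilinearRestrictScalars ℝ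

theorem wedgeR_apply {p q r : ℕ} (h : p + q = r) (α : Cov p) (β : Cov q) :
    wedgeR h α β = wedge h α β := rfl

theorem exists_bilinear_bound {V W Z : Type*} [NormedAddCommGroup V] [NormedSpace ℝ V]
    [NormedAddCommGroup W] [NormedSpace ℝ W] [NormedAddCommGroup Z] [NormedSpace ℝ Z]
    (B : V →L[ℝ] W →L[ℝ] Z) : ∃ K : ℝ, 0 ≤ K ∧ ∀ v w, ‖B v w‖ ≤ K * ‖v‖ * ‖w‖ :=
  ⟨‖B‖, norm_nonneg B, B.le_opNorm₂⟩

theorem exists_starMul_bound {p q r : ℕ} (h : p + q = r) {α : Form M p} {ρ : Form M q}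
    (hα : IsSmooth α) (hρ : IsSmooth ρ) (x : M) : ∃ u : (Fin n → ℤ) → ℝ, Summable u ∧
      ∀ m t, ‖wedge h (component X m α x) (sigma X t ρ x)‖ ≤ u m := by
  obtain ⟨C, hC⟩ := exists_bound_sigma X hρ x
  obtain ⟨K, hK, hb⟩ := exists_bilinear_bound (wedgeR h)
  refine ⟨fun m => ‖component X m α x‖ * (K * C),
    (summable_norm_component X hα x).mul_right _, fun m t => ?_⟩
  refine (hb (component X m α x) (sigma X t ρ x)).trans ?_
  calc _ ≤ K * ‖component X m α x‖ * C :=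
        mul_le_mul_of_nonneg_left (hC t) (by positivity)
    _ = _ := by ring

theorem summable_starMul {p q r : ℕ} (h : p + q = r) {α : Form M p} {ρ : Form M q}
    (hα : IsSmooth α) (hρ : IsSmooth ρ) (x : M) :
    Summable fun m => wedge h (component X m α x) (sigma X (twist X m) ρ x) := by
  obtain ⟨u, hu, hb⟩ := exists_starMul_bound X h hα hρ x
  exact Summable.of_norm_bounded hu fun m => hb m _

/-- Composition with a linear map, as a real linear map on covectors. -/
def compL (k : ℕ) (L : E4 →L[ℝ] E4) : Cov k →L[ℝ] Cov k :=
  LinearMap.toContinuousLinearMap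
    { toFun := fun α => α.compContinuousLinearMap L, map_add' := fun _ _ => rfl,
      map_smul' := fun _ _ => rfl }

theorem compL_apply {k : ℕ} (L : E4 →L[ℝ] E4) (α : Cov k) :
    compL k L α = α.compContinuousLinearMap L := rfl

theorem inChart_component {k : ℕ} {α : Form M k} (hα : IsSmooth α) (c : M) (y : E4)
    (m : Fin n → ℤ) :
    inChart c (component X m α) y = fcoef (fun s => orbit X c α (s, y)) m :=
  map_fcoef (contDiff_sigma X hα _).continuous m (compL k (chartSymmDeriv c y)) fun _ _ => rfl

/-- Linear pull-back commutes with wedge products and with Fourier coefficients, so in a chart the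
deformed product is a twisted sum. Its smoothness and its derivative are then instances of the
general results on such sums. -/
theorem inChart_starMul {p q r : ℕ} (h : p + q = r) {α : Form M p} {ρ : Form M q}
    (hα : IsSmooth α) (hρ : IsSmooth ρ) (c : M) (y : E4) :
    inChart c (starMul X h α ρ) y =
      twSum (wedgeR h) (twist X) (orbit X c α) (orbit X c ρ) y := by
  have h1 : inChart c (starMul X h α ρ) y = compL r (chartSymmDeriv c y)
    (∑' m : Fin n → ℤ, wedge h (component X m α ((chartAt E4 c).symm y))
      (sigma X (twist X m) ρ ((chartAt E4 c).symm y))) := rfl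
  rw [h1, (compL r (chartSymmDeriv c y)).map_tsum (summable_starMul X h hα hρ _), twSum]
  congr 1
  funext m
  rw [compL_apply, wedge_compContinuousLinearMap, ← inChart_component X hα]
  rfl

theorem IsSmooth.starMul {p q r : ℕ} (h : p + q = r) {α : Form M p} {ρ : Form M q}
    (hα : IsSmooth α) (hρ : IsSmooth ρ) : IsSmooth (starMul X h α ρ) := by
  intro c
  refine ContDiffOn.congr ?_ fun y _ => inChart_starMul X h hα hρ c y
  rw [contDiffOn_infty]
  exact fun k => contDiffOn_twSum (chartAt E4 c).open_target (twist X) k (wedgeR h)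
    (isSmoothPeriodic_orbit X hα c) (isSmoothPeriodic_orbit X hρ c)

/-- This is the commutation of `d` with every `σ_s`, read in a chart. -/
theorem alternatizeUncurryFin_dParam_orbit {k : ℕ} {α : Form M k} (hα : IsSmooth α) (c : M)
    {y : E4} (hy : y ∈ (chartAt E4 c).target) (s : Fin n → ℝ) :
    ContinuousAlternatingMap.alternatizeUncurryFin (dParam (orbit X c α) (s, y)) =
      orbit X c (extd α) (s, y) := by
  rw [orbit, ← extd_sigma X hα, inChart_extd (hα.sigma X s) hy, extDeriv]
  congr 1
  have := ((isSmoothPeriodic_orbit X hα c).differentiableAt (chartAt E4 c).open_target s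
    hy).hasFDerivAt.comp y ((hasFDerivAt_const s y).prodMk (hasFDerivAt_id y))
  exact this.fderiv.symm

theorem map_twSum {V V' W W' Z Z' : Type*} [NormedAddCommGroup V] [NormedSpace ℝ V]
    [NormedSpace ℂ V] [CompleteSpace V] [IsScalarTower ℝ ℂ V] [NormedAddCommGroup V']
    [NormedSpace ℝ V'] [NormedSpace ℂ V'] [NormedAddCommGroup W] [NormedSpace ℝ W]
    [NormedAddCommGroup W'] [NormedSpace ℝ W'] [NormedAddCommGroup Z] [NormedSpace ℝ Z]
    [CompleteSpace Z] [NormedAddCommGroup Z'] [NormedSpace ℝ Z'] [NormedSpace ℂ Z']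
    (T : Z →L[ℝ] Z') (B : V →L[ℝ] W →L[ℝ] Z) (B' : V' →L[ℝ] W' →L[ℝ] Z')
    (L : (Fin n → ℤ) → Fin n → ℝ) {U : Set E4} {A : (Fin n → ℝ) × E4 → V}
    {R : (Fin n → ℝ) × E4 → W} {A' : (Fin n → ℝ) × E4 → V'} {R' : (Fin n → ℝ) × E4 → W'}
    (hA : IsSmoothPeriodic U A) (hR : IsSmoothPeriodic U R) (hU : IsOpen U) {y : E4} (hy : y ∈ U)
    (c : ℂ) (h : ∀ m, T (B (fcoef (fun s => A (s, y)) m) (R (L m, y))) =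
      c • B' (fcoef (fun s => A' (s, y)) m) (R' (L m, y))) :
    T (twSum B L A R y) = c • twSum B' L A' R' y := by
  rw [twSum, T.map_tsum (summable_twSum B L hA hR hU hy), twSum, ← tsum_const_smul'']
  exact tsum_congr h

/-- The Leibniz rule for the series, given the termwise rules `h₁` and `h₂`; it is used with `T` the
antisymmetrization that defines the exterior derivative. -/
theorem map_fderiv_twSum {V V₁ W W₁ Z Z' : Type*} [NormedAddCommGroup V] [NormedSpace ℝ V]
    [NormedSpace ℂ V] [CompleteSpace V] [IsScalarTower ℝ ℂ V] [NormedAddCommGroup V₁]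
    [NormedSpace ℝ V₁] [NormedSpace ℂ V₁] [NormedAddCommGroup W] [NormedSpace ℝ W]
    [NormedAddCommGroup W₁] [NormedSpace ℝ W₁] [NormedAddCommGroup Z] [NormedSpace ℝ Z]
    [CompleteSpace Z] [NormedAddCommGroup Z'] [NormedSpace ℝ Z'] [NormedSpace ℂ Z']
    (T : (E4 →L[ℝ] Z) →L[ℝ] Z') (B : V →L[ℝ] W →L[ℝ] Z) (B₁ : V₁ →L[ℝ] W →L[ℝ] Z')
    (B₂ : V →L[ℝ] W₁ →L[ℝ] Z') (L : (Fin n → ℤ) → Fin n → ℝ) {U : Set E4}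
    {A : (Fin n → ℝ) × E4 → V} {R : (Fin n → ℝ) × E4 → W} {A₁ : (Fin n → ℝ) × E4 → V₁}
    {R₁ : (Fin n → ℝ) × E4 → W₁} (hA : IsSmoothPeriodic U A) (hR : IsSmoothPeriodic U R)
    (hU : IsOpen U) {y : E4} (hy : y ∈ U) (c₁ c₂ : ℂ)
    (h₁ : ∀ m, T ((B.flip (R (L m, y))).comp (fcoef (fun s => dParam A (s, y)) m)) =
      c₁ • B₁ (fcoef (fun s => A₁ (s, y)) m) (R (L m, y)))
    (h₂ : ∀ m, T ((B (fcoef (fun s => A (s, y)) m)).comp (dParam R (L m, y))) =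
      c₂ • B₂ (fcoef (fun s => A (s, y)) m) (R₁ (L m, y))) :
    T (fderiv ℝ (twSum B L A R) y) = c₁ • twSum B₁ L A₁ R y + c₂ • twSum B₂ L A R₁ y := by
  rw [(hasFDerivAt_twSum B L hA hR hU hy).fderiv, map_add, add_comm,
    map_twSum T (B.precompL E4) B₁ L (hA.dParam hU) hR hU hy c₁ h₁,
    map_twSum T (B.precompR E4) B₂ L hA (hR.dParam hU) hU hy c₂ h₂]

/-- Taking components and translating both commute with `d`, so each term of the series obeys the
classical graded Leibniz rule. -/
theorem extd_starMul {p q r : ℕ} (h : p + q = r) (h1 : p + 1 + q = r + 1)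
    (h2 : p + (q + 1) = r + 1) {α : Form M p} {ρ : Form M q} (hα : IsSmooth α)
    (hρ : IsSmooth ρ) :
    extd (starMul X h α ρ) =
      starMul X h1 (extd α) ρ + (-1 : ℂ) ^ p • starMul X h2 α (extd ρ) := by
  refine form_ext fun c y hy => ?_
  have hU := (chartAt E4 c).open_target
  have hA := isSmoothPeriodic_orbit X hα c
  have hR := isSmoothPeriodic_orbit X hρ c
  have hev : inChart c (starMul X h α ρ) = twSum (wedgeR h) (twist X) (orbit X c α)
    (orbit X c ρ) := funext fun z => inChart_starMul X h hα hρ c z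
  have hR' : inChart c (starMul X h1 (extd α) ρ + (-1 : ℂ) ^ p • starMul X h2 α (extd ρ)) y =
      inChart c (starMul X h1 (extd α) ρ) y +
        (-1 : ℂ) ^ p • inChart c (starMul X h2 α (extd ρ)) y := rfl
  rw [inChart_extd (hα.starMul X h hρ) hy, hR', extDeriv, hev, inChart_starMul X h1 hα.extd hρ,
    inChart_starMul X h2 hα hρ.extd,
    ← one_smul ℂ (twSum (wedgeR h1) (twist X) (orbit X c (extd α)) (orbit X c ρ) y)]
  refine map_fderiv_twSum (ContinuousAlternatingMap.alternatizeUncurryFinCLM ℝ E4 ℂ (n := r))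
    (wedgeR h) (wedgeR h1) (wedgeR h2) (twist X) hA hR hU hy 1 ((-1) ^ p) (fun m => ?_) fun m => ?_
  · have e := map_fcoef ((hA.dParam hU).contDiff_slice hy).continuous m
      (ContinuousAlternatingMap.alternatizeUncurryFinCLM ℝ E4 ℂ (n := p)) fun a v =>
        ContinuousAlternatingMap.alternatizeUncurryFin_smul a v
    simp only [ContinuousAlternatingMap.alternatizeUncurryFinCLM_apply,
      alternatizeUncurryFin_dParam_orbit X hα c hy] at e
    rw [one_smul, ← e]
    exact alternatizeUncurryFin_wedge_left h h1 _ _ (orbit X c ρ (twist X m, y)) fun x => rfl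
  · rw [← alternatizeUncurryFin_dParam_orbit X hρ c hy]
    exact alternatizeUncurryFin_wedge_right h h2 _ _
      (fcoef (fun s => orbit X c α (s, y)) m) fun x => rfl

end Star

/-! ### Associativity of the deformed product and its compatibility with conjugation -/

section StarAlgebra

variable {M : Type*} [TopologicalSpace M] [ChartedSpace E4 M] [IsManifold (𝓡 4) ∞ M] {n : ℕ}
variable (X : ToricData M n)

/-- Pulling back by `t` translates the torus variable, and a Fourier coefficient responds by the
character. -/
theorem component_act {k : ℕ} {α : Form M k} (hα : IsSmooth α) (m : Fin n → ℤ)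
    (t : Fin n → ℝ) (x : M) :
    (component X m α (X.act t x)).compContinuousLinearMap (tderiv (X.act t) x) =
      expChar m t • component X m α x := by
  rw [component_eq, component_eq, ← fcoef_shift (isPeriodic_sigma_apply X α x)
    (contDiff_sigma X hα x).continuous]
  have h := map_fcoef (contDiff_sigma X hα (X.act t x)).continuous m
    (compL k (tderiv (X.act t) x)) fun _ _ => rfl
  refine h.trans ?_
  congr 1
  funext s
  rw [compL_apply, ← sigma_eq, sigma_sigma, add_comm]

theorem sigma_starMul_apply {p q r : ℕ} (h : p + q = r) {α : Form M p} {ρ : Form M q}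
    (hα : IsSmooth α) (hρ : IsSmooth ρ) (t : Fin n → ℝ) (x : M) :
    sigma X t (starMul X h α ρ) x = ∑' m : Fin n → ℤ,
      expChar m t • wedge h (component X m α x) (sigma X (t + twist X m) ρ x) := by
  rw [sigma_eq, starMul_apply, ← compL_apply, (compL r _).map_tsum (summable_starMul X h hα hρ _)]
  refine tsum_congr fun m => ?_
  rw [compL_apply, wedge_compContinuousLinearMap, component_act X hα, wedge_smul_left,
    ← sigma_eq, sigma_sigma]

/-- The Fourier coefficients of `∑_m e^{2πi m·s} B(a_m, g(s + τ(m)))`. -/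
theorem hasSum_fcoef_twisted {V W Z : Type*} [NormedAddCommGroup V] [NormedSpace ℝ V]
    [NormedSpace ℂ V] [NormedAddCommGroup W] [NormedSpace ℝ W] [NormedSpace ℂ W] [CompleteSpace W]
    [NormedAddCommGroup Z] [NormedSpace ℝ Z] [NormedSpace ℂ Z] [CompleteSpace Z]
    (B : V →L[ℝ] W →L[ℝ] Z) (hB : ∀ (c : ℂ) v w, B v (c • w) = c • B v w)
    {a : (Fin n → ℤ) → V} (ha : Summable fun m => ‖a m‖) {g : (Fin n → ℝ) → W}
    (hg : IsPeriodic g) (hc : Continuous g) (τ : (Fin n → ℤ) → Fin n → ℝ) (r : Fin n → ℤ) :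
    HasSum (fun m => expChar (r - m) (τ m) • B (a m) (fcoef g (r - m)))
      (fcoef (fun s => ∑' m, expChar m s • B (a m) (g (s + τ m))) r) := by
  obtain ⟨K, hK, hb⟩ := exists_bilinear_bound B
  obtain ⟨C, hC⟩ := (isCompact_Icc (a := (0 : Fin n → ℝ)) (b := 1)).exists_bound_of_continuousOn
    hc.continuousOn
  have hC' : ∀ s, ‖g s‖ ≤ C := fun s => by
    obtain ⟨t, ht, hts⟩ := hg.exists_mem_Icc s
    exact (congrArg norm hts).symm.trans_le (hC t ht)
  have hbound : ∀ m s, ‖expChar m s • B (a m) (g (s + τ m))‖ ≤ ‖a m‖ * (K * C) := fun m s => by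
    rw [norm_smul, norm_expChar, one_mul]
    calc _ ≤ K * ‖a m‖ * ‖g (s + τ m)‖ := hb _ _
      _ ≤ K * ‖a m‖ * C := mul_le_mul_of_nonneg_left (hC' _) (by positivity)
      _ = _ := by ring
  have hcm : ∀ m, Continuous fun s => expChar m s • B (a m) (g (s + τ m)) := fun m =>
    (contDiff_expChar m).continuous.smul
      ((B (a m)).continuous.comp (hc.comp (continuous_id.add continuous_const)))
  have hsum : Summable fun m => ‖a m‖ * (K * C) := ha.mul_right _
  -- Sum and integral are exchanged by absolute convergence; the bound on each term is its own
  -- integral because the cube has volume one.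
  have hmain := hasSum_integral_of_summable_integral_norm
    (μ := volume.restrict (Set.Icc (0 : Fin n → ℝ) 1))
    (F := fun m s => expChar (-r) s • expChar m s • B (a m) (g (s + τ m)))
    (fun m => integrableOn_expChar_smul (hcm m) _) (by
      refine Summable.of_nonneg_of_le (fun m => integral_nonneg fun s => norm_nonneg _)
        (fun m => ?_) hsum
      refine (integral_mono_of_nonneg (Filter.Eventually.of_forall fun s => norm_nonneg _)
        (integrableOn_const (C := ‖a m‖ * (K * C)) isCompact_Icc.measure_lt_top.ne)
        (Filter.Eventually.of_forall fun s => ?_)).trans_eq ?_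
      · simp only
        rw [norm_smul, norm_expChar, one_mul]
        exact hbound m s
      · simp [Measure.real, Real.volume_Icc_pi])
  have e1 : (∫ s in Set.Icc (0 : Fin n → ℝ) 1, ∑' m,
      expChar (-r) s • expChar m s • B (a m) (g (s + τ m))) =
      fcoef (fun s => ∑' m, expChar m s • B (a m) (g (s + τ m))) r := by
    rw [fcoef_eq]
    congr 1
    funext s
    exact tsum_const_smul'' _
  have e2 : ∀ m, (∫ s in Set.Icc (0 : Fin n → ℝ) 1,
      expChar (-r) s • expChar m s • B (a m) (g (s + τ m))) =
      expChar (r - m) (τ m) • B (a m) (fcoef g (r - m)) := fun m => by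
    have e3 := map_fcoef (f := fun s => g (s + τ m)) (hc.comp (continuous_id.add continuous_const))
      (r - m) (B (a m)) fun c w => hB c _ w
    rw [fcoef_shift hg hc, hB] at e3
    rw [e3, fcoef_eq]
    congr 1
    funext s
    rw [smul_smul, ← expChar_add_left, show -r + m = -(r - m) by abel]
  simp only [e2] at hmain
  rwa [e1] at hmain

/-- The deformed product is a convolution of components with a phase. Associativity and the trace
property are both read off from this formula. -/
theorem hasSum_component_starMul {p q r : ℕ} (h : p + q = r) {α : Form M p} {ρ : Form M q}
    (hα : IsSmooth α) (hρ : IsSmooth ρ) (x : M) (k : Fin n → ℤ) :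
    HasSum (fun m => expChar (k - m) (twist X m) •
      wedge h (component X m α x) (component X (k - m) ρ x))
      (component X k (starMul X h α ρ) x) := by
  have := hasSum_fcoef_twisted (wedgeR h) (fun c v w => wedge_smul_right h c v w)
    (summable_norm_component X hα x) (isPeriodic_sigma_apply X ρ x)
    (contDiff_sigma X hρ x).continuous (twist X) k
  rw [component_eq]
  simp only [sigma_starMul_apply X h hα hρ]
  exact this

theorem hasSum_component {k : ℕ} {α : Form M k} (hα : IsSmooth α) (x : M) (t : Fin n → ℝ) :
    HasSum (fun m => expChar m t • component X m α x) (sigma X t α x) :=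
  hasSum_fcoef (isPeriodic_sigma_apply X α x) (contDiff_sigma X hα x).continuous
    (summable_norm_component X hα x) t

/-- Antisymmetry of θ gives m·(½ kθ) = -k·(½ mθ). -/
theorem expChar_twist_antisymm (m k : Fin n → ℤ) :
    expChar m (twist X k) = expChar (-k) (twist X m) := by
  have h : ∑ j, (m j : ℂ) * (twist X k j : ℂ) = ∑ j, ((-k) j : ℂ) * (twist X m j : ℂ) := by
    simp only [twist, Matrix.vecMul, dotProduct, Pi.smul_apply, smul_eq_mul, Pi.neg_apply]
    push_cast
    simp only [Finset.mul_sum]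
    rw [Finset.sum_comm]
    refine Finset.sum_congr rfl fun i _ => Finset.sum_congr rfl fun j _ => ?_
    have ht : X.theta i j = -X.theta j i := by
      have := congrFun (congrFun X.theta_antisymm j) i
      simpa using this
    rw [ht]
    push_cast
    ring
  rw [expChar, expChar]
  congr 2

/-- The exponent m·θ·m vanishes by antisymmetry. This is why the integral does not see θ. -/
theorem expChar_neg_twist_self (m : Fin n → ℤ) : expChar (-m) (twist X m) = 1 := by
  have h1 := expChar_twist_antisymm X m m
  have h2 : ∑ j, (m j : ℂ) * (twist X m j : ℂ) = 0 := by
    have h : ∑ j, (m j : ℂ) * (twist X m j : ℂ) = -∑ j, (m j : ℂ) * (twist X m j : ℂ) := by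
      simp only [twist, Matrix.vecMul, dotProduct, Pi.smul_apply, smul_eq_mul]
      push_cast
      simp only [Finset.mul_sum]
      conv_lhs => rw [Finset.sum_comm]
      rw [← Finset.sum_neg_distrib]
      refine Finset.sum_congr rfl fun i _ => ?_
      rw [← Finset.sum_neg_distrib]
      refine Finset.sum_congr rfl fun j _ => ?_
      have ht : X.theta i j = -X.theta j i := by
        have := congrFun (congrFun X.theta_antisymm j) i
        simpa using this
      rw [ht]
      push_cast
      ring
    exact self_eq_neg.1 h
  rw [← h1, expChar, h2, mul_zero, Complex.exp_zero]

theorem summable_mul_components {V W Z : Type*} [NormedAddCommGroup V] [NormedAddCommGroup W]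
    [NormedAddCommGroup Z] [CompleteSpace Z] {a : (Fin n → ℤ) → V}
    {b : (Fin n → ℤ) → W} (ha : Summable fun m => ‖a m‖) (hb : Summable fun m => ‖b m‖)
    {f : (Fin n → ℤ) × (Fin n → ℤ) → Z} {K : ℝ} (hf : ∀ m k, ‖f (m, k)‖ ≤ K * (‖a m‖ * ‖b k‖)) :
    Summable f :=
  Summable.of_norm_bounded ((ha.mul_of_nonneg hb (fun _ => norm_nonneg _)
    fun _ => norm_nonneg _).mul_left K) fun ⟨m, k⟩ => hf m k

theorem summable_starMul_double {p q r : ℕ} (h : p + q = r) {α : Form M p} {ρ : Form M q}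
    (hα : IsSmooth α) (hρ : IsSmooth ρ) (x : M) :
    Summable fun mk : (Fin n → ℤ) × (Fin n → ℤ) => expChar mk.2 (twist X mk.1) •
      wedge h (component X mk.1 α x) (component X mk.2 ρ x) := by
  obtain ⟨K, hK, hb⟩ := exists_bilinear_bound (wedgeR h)
  refine summable_mul_components (K := K) (summable_norm_component X hα x)
    (summable_norm_component X hρ x) fun m k => ?_
  rw [norm_smul, norm_expChar, one_mul, ← mul_assoc]
  exact hb _ _

/-- Expanding the translated second factor into components treats both factors alike, which is the
form needed to reverse their order. -/
theorem starMul_double {p q r : ℕ} (h : p + q = r) {α : Form M p} {ρ : Form M q}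
    (hα : IsSmooth α) (hρ : IsSmooth ρ) (x : M) :
    starMul X h α ρ x = ∑' mk : (Fin n → ℤ) × (Fin n → ℤ), expChar mk.2 (twist X mk.1) •
      wedge h (component X mk.1 α x) (component X mk.2 ρ x) := by
  rw [(summable_starMul_double X h hα hρ x).tsum_prod, starMul_apply]
  refine tsum_congr fun m => ?_
  have := ((wedgeR h (component X m α x)).hasSum (hasSum_component X hρ x (twist X m))).tsum_eq
  refine this.symm.trans (tsum_congr fun k => ?_)
  exact wedge_smul_right h _ _ _

/-- Both sides sum one absolutely summable family `f` over pairs of degrees of the first two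
factors. On the left the pair appears as (m, r - m), with r the degree of their product; the phases
and translations agree because `twist` is additive. -/
theorem starMul_assoc {p q s a b r : ℕ} (h1 : p + q = a) (h2 : a + s = r) (h3 : q + s = b)
    (h4 : p + b = r) {α : Form M p} {β : Form M q} {γ : Form M s} (hα : IsSmooth α)
    (hβ : IsSmooth β) (hγ : IsSmooth γ) :
    starMul X h2 (starMul X h1 α β) γ = starMul X h4 α (starMul X h3 β γ) := by
  funext x
  let f : (Fin n → ℤ) × (Fin n → ℤ) → Cov r := fun mk => expChar mk.2 (twist X mk.1) •
    wedge h4 (component X mk.1 α x) (wedge h3 (component X mk.2 β x)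
      (sigma X (twist X mk.1 + twist X mk.2) γ x))
  have hf : Summable f := by
    obtain ⟨K, hK, hb⟩ := exists_bilinear_bound (wedgeR h4)
    obtain ⟨K', hK', hb'⟩ := exists_bilinear_bound (wedgeR h3)
    obtain ⟨C, hC⟩ := exists_bound_sigma X hγ x
    refine summable_mul_components (K := K * (K' * C)) (summable_norm_component X hα x)
      (summable_norm_component X hβ x) fun m k => ?_
    rw [norm_smul, norm_expChar, one_mul]
    refine (hb (component X m α x) _).trans ?_
    refine (mul_le_mul_of_nonneg_left ((hb' (component X k β x) _).trans
      (mul_le_mul_of_nonneg_left (hC _) (by positivity))) (by positivity)).trans_eq ?_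
    ring
  have twist_add : ∀ m k, twist X (m + k) = twist X m + twist X k := fun m k => by
    simp only [twist, ← smul_add, ← Matrix.add_vecMul]
    congr 2
    funext j
    simp
  have hR : starMul X h4 α (starMul X h3 β γ) x = ∑' mk, f mk := by
    rw [hf.tsum_prod, starMul_apply]
    refine tsum_congr fun m => ?_
    rw [sigma_starMul_apply X h3 hβ hγ]
    have hs : Summable fun k => expChar k (twist X m) •
        wedge h3 (component X k β x) (sigma X (twist X m + twist X k) γ x) := by
      obtain ⟨u, hu, hb⟩ := exists_starMul_bound X h3 hβ hγ x
      refine Summable.of_norm_bounded hu fun k => ?_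
      rw [norm_smul, norm_expChar, one_mul]
      exact hb _ _
    refine ((wedgeR h4 (component X m α x)).map_tsum hs).trans (tsum_congr fun k => ?_)
    exact wedge_smul_right h4 _ _ _
  have hL : starMul X h2 (starMul X h1 α β) γ x = ∑' rm : (Fin n → ℤ) × (Fin n → ℤ),
      f (rm.2, rm.1 - rm.2) := by
    let e : (Fin n → ℤ) × (Fin n → ℤ) ≃ (Fin n → ℤ) × (Fin n → ℤ) :=
      { toFun := fun rm => (rm.2, rm.1 - rm.2)
        invFun := fun mk => (mk.1 + mk.2, mk.1)
        left_inv := fun rm => by simp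
        right_inv := fun mk => by simp }
    have hf' : Summable fun rm : (Fin n → ℤ) × (Fin n → ℤ) => f (rm.2, rm.1 - rm.2) :=
      e.summable_iff.2 hf
    rw [hf'.tsum_prod, starMul_apply]
    refine tsum_congr fun k => ?_
    have h5 := hasSum_component_starMul X h1 hα hβ x k
    rw [← h5.tsum_eq]
    refine (((wedgeR h2).flip (sigma X (twist X k) γ x)).map_tsum h5.summable).trans
      (tsum_congr fun m => ?_)
    rw [ContinuousLinearMap.flip_apply, wedgeR_apply, wedge_smul_left, wedge_assoc h1 h2 h3 h4]
    simp only [f]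
    rw [← twist_add, add_sub_cancel]
  rw [hL, hR]
  exact Equiv.tsum_eq
    { toFun := fun rm : (Fin n → ℤ) × (Fin n → ℤ) => (rm.2, rm.1 - rm.2)
      invFun := fun mk => (mk.1 + mk.2, mk.1)
      left_inv := fun rm => by simp
      right_inv := fun mk => by simp } f

/-! ### Conjugation -/

omit [TopologicalSpace M] [ChartedSpace E4 M] [IsManifold (𝓡 4) ∞ M] in
theorem conjForm_apply {k : ℕ} (α : Form M k) (x : M) : conjForm α x = conjCov (α x) := rfl

/-- Conjugation of covectors as a continuous real linear map. -/
def conjL (k : ℕ) : Cov k →L[ℝ] Cov k :=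
  LinearMap.toContinuousLinearMap
    { toFun := conjCov
      map_add' := fun α β => by ext v; simp [conjCov_apply]
      map_smul' := fun c α => by ext v; simp [conjCov_apply] }

theorem conjL_apply {k : ℕ} (α : Cov k) : conjL k α = conjCov α := rfl

theorem conjCov_smul {k : ℕ} (c : ℂ) (α : Cov k) :
    conjCov (c • α) = (starRingEnd ℂ) c • conjCov α := by
  ext v; simp [conjCov_apply]

theorem conjCov_conjCov {k : ℕ} (α : Cov k) : conjCov (conjCov α) = α := by
  ext v; simp [conjCov_apply]

omit [IsManifold (𝓡 4) ∞ M] in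
theorem inChart_conjForm {k : ℕ} (α : Form M k) (c : M) (y : E4) :
    inChart c (conjForm α) y = conjL k (inChart c α y) := rfl

omit [IsManifold (𝓡 4) ∞ M] in
theorem IsSmooth.conjForm {k : ℕ} {α : Form M k} (hα : IsSmooth α) : IsSmooth (conjForm α) :=
  fun c => (conjL k).contDiff.comp_contDiffOn (hα c)

theorem extd_conjForm {k : ℕ} {α : Form M k} (hα : IsSmooth α) :
    extd (conjForm α) = conjForm (extd α) := by
  refine form_ext fun c y hy => ?_
  rw [inChart_extd hα.conjForm hy, inChart_conjForm, inChart_extd hα hy]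
  have h1 : HasFDerivAt (inChart c (NCYM.conjForm α))
      ((conjL k).comp (fderiv ℝ (inChart c α) y)) y :=
    (conjL k).hasFDerivAt.comp y ((hα.contDiffAt hy).differentiableAt (by simp)).hasFDerivAt
  rw [extDeriv, h1.fderiv, extDeriv]
  ext v
  simp [ContinuousAlternatingMap.alternatizeUncurryFin_apply, conjL_apply, conjCov_apply]

theorem sigma_conjForm {k : ℕ} (α : Form M k) (s : Fin n → ℝ) :
    sigma X s (conjForm α) = conjForm (sigma X s α) := rfl

theorem component_conjForm {k : ℕ} {α : Form M k} (hα : IsSmooth α) (m : Fin n → ℤ) (x : M) :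
    component X m (conjForm α) x = conjCov (component X (-m) α x) := by
  rw [component_eq, component_eq, fcoef_eq, fcoef_eq, ← conjL_apply,
    ← ContinuousLinearMap.integral_comp_comm (conjL k)
      (integrableOn_expChar_smul (contDiff_sigma X hα x).continuous _)]
  congr 1
  funext s
  rw [sigma_conjForm, conjForm_apply, conjL_apply, conjCov_smul, conj_expChar, neg_neg]

/-- Conjugation negates degrees, so the double series is reindexed by (m, k) ↦ (-k, -m).
Antisymmetry of θ matches the phases, and the sign is that of `wedge_comm`. -/
theorem conjForm_starMul {p q r : ℕ} (h : p + q = r) (h' : q + p = r) {α : Form M p}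
    {ρ : Form M q} (hα : IsSmooth α) (hρ : IsSmooth ρ) :
    conjForm (starMul X h α ρ) =
      (-1 : ℂ) ^ (p * q) • starMul X h' (conjForm ρ) (conjForm α) := by
  funext x
  rw [conjForm_apply, Pi.smul_apply, starMul_double X h hα hρ,
    starMul_double X h' hρ.conjForm hα.conjForm, ← conjL_apply,
    (conjL r).map_tsum (summable_starMul_double X h hα hρ x), ← tsum_const_smul'']
  let e : (Fin n → ℤ) × (Fin n → ℤ) ≃ (Fin n → ℤ) × (Fin n → ℤ) :=
    (Equiv.prodComm _ _).trans (Equiv.neg _)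
  rw [← e.tsum_eq]
  refine tsum_congr fun mk => ?_
  obtain ⟨m, k⟩ := mk
  have he : e (m, k) = (-k, -m) := rfl
  rw [he]
  simp only
  rw [component_conjForm X hα, component_conjForm X hρ, conjL_apply, conjCov_smul, conjCov_wedge,
    conj_expChar, neg_neg, expChar_twist_antisymm, neg_neg, wedge_comm h h', smul_comm]

end StarAlgebra

/-! ### Smooth forms as a unital graded differential algebra with involution -/

section Linear

variable {M : Type*} [TopologicalSpace M] [ChartedSpace E4 M]

theorem inChart_add {k : ℕ} (α β : Form M k) (c : M) (y : E4) :
    inChart c (α + β) y = inChart c α y + inChart c β y := rfl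

theorem inChart_smul {k : ℕ} (a : ℂ) (α : Form M k) (c : M) (y : E4) :
    inChart c (a • α) y = a • inChart c α y := rfl

/-- The space of smooth forms. -/
def SForm (M : Type*) [TopologicalSpace M] [ChartedSpace E4 M] (k : ℕ) :
    Submodule ℂ (Form M k) where
  carrier := {α | IsSmooth α}
  zero_mem' := fun _ => contDiffOn_const (c := (0 : Cov k))
  add_mem' := fun ha hb c => (ha c).add (hb c)
  smul_mem' := fun a _ hα c => (hα c).const_smul a

variable [IsManifold (𝓡 4) ∞ M]

theorem extd_add {k : ℕ} {α β : Form M k} (hα : IsSmooth α) (hβ : IsSmooth β) :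
    extd (α + β) = extd α + extd β := by
  refine form_ext fun c y hy => ?_
  have hs : IsSmooth (α + β) := (SForm M k).add_mem hα hβ
  rw [inChart_extd hs hy, inChart_add, inChart_extd hα hy, inChart_extd hβ hy]
  exact extDeriv_add ((hα.contDiffAt hy).differentiableAt (by simp))
    ((hβ.contDiffAt hy).differentiableAt (by simp))

theorem extd_smul {k : ℕ} (a : ℂ) {α : Form M k} (hα : IsSmooth α) :
    extd (a • α) = a • extd α := by
  refine form_ext fun c y hy => ?_
  have hs : IsSmooth (a • α) := (SForm M k).smul_mem a hα
  rw [inChart_extd hs hy, inChart_smul, inChart_extd hα hy]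
  have h1 : fderiv ℝ (inChart c (a • α)) y = a • fderiv ℝ (inChart c α) y :=
    fderiv_const_smul ((hα.contDiffAt hy).differentiableAt (by simp)) a
  rw [extDeriv, h1, extDeriv]
  ext v
  simp only [ContinuousAlternatingMap.alternatizeUncurryFin_apply,
    ContinuousAlternatingMap.smul_apply, Finset.smul_sum]
  refine Finset.sum_congr rfl fun i _ => ?_
  exact smul_comm _ a _

/-- The exterior derivative on smooth forms. -/
def dForm (k : ℕ) : SForm M k →ₗ[ℂ] SForm M (k + 1) where
  toFun α := ⟨extd α, α.2.extd⟩
  map_add' α β := Subtype.ext (extd_add α.2 β.2)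
  map_smul' a α := Subtype.ext (extd_smul a α.2)

theorem coe_dForm {k : ℕ} (α : SForm M k) : (dForm k α : Form M (k + 1)) = extd (α : Form M k) :=
  rfl

variable {n : ℕ} (X : ToricData M n)

theorem component_add {k : ℕ} {α β : Form M k} (hα : IsSmooth α) (hβ : IsSmooth β)
    (m : Fin n → ℤ) (x : M) :
    component X m (α + β) x = component X m α x + component X m β x := by
  simp only [component_eq, fcoef_eq]
  rw [← integral_add (integrableOn_expChar_smul (contDiff_sigma X hα x).continuous _)
    (integrableOn_expChar_smul (contDiff_sigma X hβ x).continuous _)]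
  simp only [← smul_add]
  rfl

theorem component_smul {k : ℕ} (a : ℂ) (α : Form M k) (m : Fin n → ℤ) (x : M) :
    component X m (a • α) x = a • component X m α x := by
  simp only [component_eq, fcoef_eq]
  refine Eq.trans ?_ (integral_smul a _)
  refine integral_congr_ae (Filter.Eventually.of_forall fun s => ?_)
  exact smul_comm (expChar (-m) s) a (sigma X s α x)

theorem starMul_add_left {p q r : ℕ} (h : p + q = r) {α α' : Form M p} {ρ : Form M q}
    (hα : IsSmooth α) (hα' : IsSmooth α') (hρ : IsSmooth ρ) :
    starMul X h (α + α') ρ = starMul X h α ρ + starMul X h α' ρ := by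
  funext x
  rw [Pi.add_apply, starMul_apply, starMul_apply, starMul_apply,
    ← (summable_starMul X h hα hρ x).tsum_add (summable_starMul X h hα' hρ x)]
  refine tsum_congr fun m => ?_
  rw [component_add X hα hα', wedge_add_left]

theorem starMul_add_right {p q r : ℕ} (h : p + q = r) {α : Form M p} {ρ ρ' : Form M q}
    (hα : IsSmooth α) (hρ : IsSmooth ρ) (hρ' : IsSmooth ρ') :
    starMul X h α (ρ + ρ') = starMul X h α ρ + starMul X h α ρ' := by
  funext x
  rw [Pi.add_apply, starMul_apply, starMul_apply, starMul_apply,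
    ← (summable_starMul X h hα hρ x).tsum_add (summable_starMul X h hα hρ' x)]
  refine tsum_congr fun m => ?_
  rw [← wedge_add_right]
  rfl

theorem starMul_smul_left {p q r : ℕ} (h : p + q = r) (a : ℂ) (α : Form M p) (ρ : Form M q) :
    starMul X h (a • α) ρ = a • starMul X h α ρ := by
  funext x
  rw [Pi.smul_apply, starMul_apply, starMul_apply, ← tsum_const_smul'']
  refine tsum_congr fun m => ?_
  rw [component_smul, wedge_smul_left]

theorem starMul_smul_right {p q r : ℕ} (h : p + q = r) (a : ℂ) (α : Form M p) (ρ : Form M q) :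
    starMul X h α (a • ρ) = a • starMul X h α ρ := by
  funext x
  rw [Pi.smul_apply, starMul_apply, starMul_apply, ← tsum_const_smul'']
  refine tsum_congr fun m => ?_
  rw [← wedge_smul_right]
  rfl

/-- The deformed product of smooth forms. -/
def mulForm {p q r : ℕ} (h : p + q = r) : SForm M p →ₗ[ℂ] SForm M q →ₗ[ℂ] SForm M r :=
  LinearMap.mk₂ ℂ (fun α β => ⟨starMul X h α β, α.2.starMul X h β.2⟩)
    (fun α α' β => Subtype.ext (starMul_add_left X h α.2 α'.2 β.2))
    (fun a α β => Subtype.ext (starMul_smul_left X h a α β))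
    (fun α β β' => Subtype.ext (starMul_add_right X h α.2 β.2 β'.2))
    (fun a α β => Subtype.ext (starMul_smul_right X h a α β))

theorem coe_mulForm {p q r : ℕ} (h : p + q = r) (α : SForm M p) (β : SForm M q) :
    (mulForm X h α β : Form M r) = starMul X h α β := rfl

theorem mulForm_assoc {p q s a b r : ℕ} (h1 : p + q = a) (h2 : a + s = r) (h3 : q + s = b)
    (h4 : p + b = r) (α : SForm M p) (β : SForm M q) (γ : SForm M s) :
    mulForm X h2 (mulForm X h1 α β) γ = mulForm X h4 α (mulForm X h3 β γ) :=
  Subtype.ext (starMul_assoc X h1 h2 h3 h4 α.2 β.2 γ.2)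

theorem dForm_mulForm {p q r : ℕ} (h : p + q = r) (h1 : p + 1 + q = r + 1)
    (h2 : p + (q + 1) = r + 1) (α : SForm M p) (β : SForm M q) :
    dForm r (mulForm X h α β) =
      mulForm X h1 (dForm p α) β + (-1 : ℂ) ^ p • mulForm X h2 α (dForm q β) :=
  Subtype.ext (extd_starMul X h h1 h2 α.2 β.2)

theorem dForm_dForm {k : ℕ} (α : SForm M k) : dForm (k + 1) (dForm k α) = 0 :=
  Subtype.ext (extd_extd α.2)

/-- The involution on smooth forms. -/
def conjSForm {k : ℕ} (α : SForm M k) : SForm M k := ⟨conjForm (α : Form M k), α.2.conjForm⟩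

omit [IsManifold (𝓡 4) ∞ M] in
theorem conjSForm_add {k : ℕ} (α β : SForm M k) :
    conjSForm (α + β) = conjSForm α + conjSForm β :=
  Subtype.ext (funext fun x => (conjL k).map_add (α.1 x) (β.1 x))

omit [IsManifold (𝓡 4) ∞ M] in
theorem conjSForm_zero {k : ℕ} : conjSForm (0 : SForm M k) = 0 :=
  Subtype.ext (funext fun _ => (conjL k).map_zero)

omit [IsManifold (𝓡 4) ∞ M] in
theorem conjSForm_sum {k : ℕ} {ι : Type*} (s : Finset ι) (α : ι → SForm M k) :
    conjSForm (∑ i ∈ s, α i) = ∑ i ∈ s, conjSForm (α i) :=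
  map_sum (⟨⟨conjSForm, conjSForm_zero⟩, conjSForm_add⟩ : SForm M k →+ SForm M k) α s

omit [IsManifold (𝓡 4) ∞ M] in
theorem conjSForm_smul {k : ℕ} (a : ℂ) (α : SForm M k) :
    conjSForm (a • α) = (starRingEnd ℂ) a • conjSForm α :=
  Subtype.ext (funext fun x => conjCov_smul a (α.1 x))

omit [IsManifold (𝓡 4) ∞ M] in
theorem conjSForm_conjSForm {k : ℕ} (α : SForm M k) : conjSForm (conjSForm α) = α :=
  Subtype.ext (funext fun x => conjCov_conjCov (α.1 x))

theorem conjSForm_mulForm {p q r : ℕ} (h : p + q = r) (h' : q + p = r) (α : SForm M p)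
    (β : SForm M q) :
    conjSForm (mulForm X h α β) =
      (-1 : ℂ) ^ (p * q) • mulForm X h' (conjSForm β) (conjSForm α) :=
  Subtype.ext (conjForm_starMul X h h' α.2 β.2)

theorem conjSForm_dForm {k : ℕ} (α : SForm M k) :
    conjSForm (dForm k α) = dForm k (conjSForm α) :=
  Subtype.ext (extd_conjForm α.2).symm

/-- The constant function `1`. -/
def oneForm : SForm M 0 :=
  ⟨fun _ => ContinuousAlternatingMap.constOfIsEmpty ℝ E4 (Fin 0) (1 : ℂ), fun c =>
    (contDiffOn_const (c := ContinuousAlternatingMap.constOfIsEmpty ℝ E4 (Fin 0) (1 : ℂ))).congr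
      fun y _ => by ext v; rfl⟩

theorem wedge_zero_left {q : ℕ} (h : 0 + q = q) (f : Cov 0) (β : Cov q) :
    wedge h f β = f ![] • β := by
  ext v
  have h1 : jux h f β = fun w => f ![] * β w := by
    funext w
    have e1 : w ∘ leftPos h = ![] := Subsingleton.elim _ _
    have e2 : w ∘ rightPos h = w := by
      funext j
      simp [rightPos]
    rw [jux, e1, e2]
  rw [wedge_apply, h1, alt_const_mul, alt_alternating]
  have h2 : (q.factorial : ℂ) ≠ 0 := Nat.cast_ne_zero.2 q.factorial_ne_zero
  simp
  field_simp

theorem wedge_zero_right {p : ℕ} (h : p + 0 = p) (α : Cov p) (f : Cov 0) :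
    wedge h α f = f ![] • α := by
  rw [wedge_comm h (Nat.zero_add p), wedge_zero_left, mul_zero, pow_zero, one_smul]

theorem mulForm_one {p : ℕ} (h : p + 0 = p) (α : SForm M p) : mulForm X h α oneForm = α := by
  refine Subtype.ext (funext fun x => ?_)
  rw [coe_mulForm, starMul_apply]
  have h1 := (hasSum_component X α.2 x 0).tsum_eq
  rw [sigma_zero] at h1
  refine (tsum_congr fun m => ?_).trans h1
  rw [wedge_zero_right, expChar_zero_right]
  rfl

/-- The left unit law is the right one transported by the involution. -/
theorem one_mulForm {p : ℕ} (h : 0 + p = p) (α : SForm M p) : mulForm X h oneForm α = α := by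
  have h1 := conjSForm_mulForm X (Nat.add_zero p) h (conjSForm α) oneForm
  rw [mulForm_one, conjSForm_conjSForm, mul_zero, pow_zero, one_smul] at h1
  have h2 : conjSForm (oneForm : SForm M 0) = oneForm :=
    Subtype.ext (funext fun x => by ext v; exact (starRingEnd ℂ).map_one)
  rw [h2] at h1
  exact h1.symm

end Linear

/-! ### The graded differential algebra of matrices of forms -/

section MatrixAlgebra

variable {M : Type*} [TopologicalSpace M] [ChartedSpace E4 M] [IsManifold (𝓡 4) ∞ M] {n : ℕ}

/-- Matrices of smooth `k`-forms, as the degree `k` part of the graded algebra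
`M_N(Ω(M_θ))`. -/
def SMat (_X : ToricData M n) (N k : ℕ) : Type _ := Fin N → Fin N → SForm M k

variable (X : ToricData M n) {N : ℕ}

instance (k : ℕ) : AddCommGroup (SMat X N k) :=
  inferInstanceAs (AddCommGroup (Fin N → Fin N → SForm M k))

instance (k : ℕ) : Module ℂ (SMat X N k) :=
  inferInstanceAs (Module ℂ (Fin N → Fin N → SForm M k))

namespace SMat

variable {X}

theorem add_apply {k : ℕ} (A B : SMat X N k) (i j : Fin N) : (A + B) i j = A i j + B i j := rfl

theorem smul_apply {k : ℕ} (c : ℂ) (A : SMat X N k) (i j : Fin N) : (c • A) i j = c • A i j := rfl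

theorem zero_apply {k : ℕ} (i j : Fin N) : (0 : SMat X N k) i j = 0 := rfl

@[ext] theorem ext {k : ℕ} {A B : SMat X N k} (h : ∀ i j, A i j = B i j) : A = B :=
  funext fun i => funext fun j => h i j

/-- The product of matrices of forms. -/
def mul {p q r : ℕ} (h : p + q = r) (A : SMat X N p) (B : SMat X N q) : SMat X N r :=
  fun i j => ∑ l, mulForm X h (A i l) (B l j)

theorem mul_apply {p q r : ℕ} (h : p + q = r) (A : SMat X N p) (B : SMat X N q) (i j : Fin N) :
    mul h A B i j = ∑ l, mulForm X h (A i l) (B l j) := rfl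

theorem mul_zero {p q r : ℕ} (h : p + q = r) (A : SMat X N p) : mul h A (0 : SMat X N q) = 0 := by
  ext i j : 1
  simp [mul_apply, zero_apply]

theorem zero_mul {p q r : ℕ} (h : p + q = r) (B : SMat X N q) : mul h (0 : SMat X N p) B = 0 := by
  ext i j : 1
  simp [mul_apply, zero_apply]

theorem mul_add {p q r : ℕ} (h : p + q = r) (A : SMat X N p) (B C : SMat X N q) :
    mul h A (B + C) = mul h A B + mul h A C := by
  ext i j : 1
  simp [mul_apply, add_apply, Finset.sum_add_distrib]

theorem add_mul {p q r : ℕ} (h : p + q = r) (A B : SMat X N p) (C : SMat X N q) :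
    mul h (A + B) C = mul h A C + mul h B C := by
  ext i j : 1
  simp [mul_apply, add_apply, Finset.sum_add_distrib]

/-- The identity matrix. -/
def one : SMat X N 0 := fun i j => if i = j then oneForm else 0

theorem mul_one {p : ℕ} (h : p + 0 = p) (A : SMat X N p) : mul h A one = A := by
  ext i j : 1
  rw [mul_apply, Finset.sum_eq_single j]
  · simp [one, mulForm_one]
  · intro l _ hl
    simp [one, hl]
  · simp

theorem one_mul {p : ℕ} (h : 0 + p = p) (A : SMat X N p) : mul h one A = A := by
  ext i j : 1
  rw [mul_apply, Finset.sum_eq_single i]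
  · simp [one, one_mulForm]
  · intro l _ hl
    simp [one, hl.symm]
  · simp

theorem mul_assoc {p q s a b r : ℕ} (h1 : p + q = a) (h2 : a + s = r) (h3 : q + s = b)
    (h4 : p + b = r) (A : SMat X N p) (B : SMat X N q) (C : SMat X N s) :
    mul h2 (mul h1 A B) C = mul h4 A (mul h3 B C) := by
  ext i j : 1
  simp only [mul_apply, map_sum, LinearMap.sum_apply]
  rw [Finset.sum_comm]
  exact Finset.sum_congr rfl fun l _ => Finset.sum_congr rfl fun m _ =>
    mulForm_assoc X h1 h2 h3 h4 _ _ _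

theorem mk_mul_assoc {p q s a b r r' : ℕ} (h1 : p + q = a) (h2 : a + s = r) (h3 : q + s = b)
    (h4 : p + b = r') (A : SMat X N p) (B : SMat X N q) (C : SMat X N s) :
    (⟨r, mul h2 (mul h1 A B) C⟩ : GradedMonoid (SMat X N)) = ⟨r', mul h4 A (mul h3 B C)⟩ := by
  obtain rfl : r = r' := by omega
  rw [mul_assoc h1 h2 h3 h4]

theorem mk_one_mul {p r : ℕ} (h : 0 + p = r) (A : SMat X N p) :
    (⟨r, mul h one A⟩ : GradedMonoid (SMat X N)) = ⟨p, A⟩ := by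
  obtain rfl : r = p := by omega
  rw [one_mul]

theorem mk_mul_one {p r : ℕ} (h : p + 0 = r) (A : SMat X N p) :
    (⟨r, mul h A one⟩ : GradedMonoid (SMat X N)) = ⟨p, A⟩ := by
  obtain rfl : r = p := by omega
  rw [mul_one]

instance : GradedMonoid.GMul (SMat X N) := ⟨fun A B => mul rfl A B⟩

instance : GradedMonoid.GOne (SMat X N) := ⟨one⟩

/-- Collecting all degrees into one ring allows `noncomm_ring` to handle the curvature identities,
with no transport between equal degrees. -/
instance : DirectSum.GRing (SMat X N) where
  mul_zero A := mul_zero rfl A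
  zero_mul B := zero_mul rfl B
  mul_add A B C := mul_add rfl A B C
  add_mul A B C := add_mul rfl A B C
  one_mul a := mk_one_mul _ a.2
  mul_one a := mk_mul_one _ a.2
  mul_assoc a b c := mk_mul_assoc rfl _ rfl _ a.2 b.2 c.2
  natCast m := m • one
  natCast_zero := zero_smul _ _
  natCast_succ m := succ_nsmul _ m
  intCast z := z • one
  intCast_ofNat m := natCast_zsmul _ m
  intCast_negSucc_ofNat m := negSucc_zsmul _ m

/-- The exterior derivative of a matrix of forms. -/
def d {k : ℕ} : SMat X N k →ₗ[ℂ] SMat X N (k + 1) where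
  toFun A i j := dForm k (A i j)
  map_add' A B := by ext i j : 1; exact map_add (dForm k) (A i j) (B i j)
  map_smul' c A := by ext i j : 1; exact map_smul (dForm k) c (A i j)

theorem d_apply {k : ℕ} (A : SMat X N k) (i j : Fin N) : d A i j = dForm k (A i j) := rfl

theorem d_d {k : ℕ} (A : SMat X N k) : d (d A) = 0 := by
  ext i j : 1
  exact dForm_dForm _

theorem d_mul {p q r : ℕ} (h : p + q = r) (h1 : p + 1 + q = r + 1) (h2 : p + (q + 1) = r + 1)
    (A : SMat X N p) (B : SMat X N q) :
    d (mul h A B) = mul h1 (d A) B + (-1 : ℂ) ^ p • mul h2 A (d B) := by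
  ext i j : 1
  rw [add_apply, smul_apply, d_apply]
  simp only [mul_apply, map_sum, dForm_mulForm X h h1 h2, Finset.sum_add_distrib, Finset.smul_sum]
  rfl

/-- The adjoint of a matrix of forms. -/
def star {k : ℕ} (A : SMat X N k) : SMat X N k := fun i j => conjSForm (A j i)

theorem star_star {k : ℕ} (A : SMat X N k) : star (star A) = A := by
  ext i j : 1
  exact conjSForm_conjSForm _

theorem star_mul {p q r : ℕ} (h : p + q = r) (h' : q + p = r) (A : SMat X N p) (B : SMat X N q) :
    star (mul h A B) = (-1 : ℂ) ^ (p * q) • mul h' (star B) (star A) := by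
  ext i j : 1
  rw [smul_apply]
  simp only [star, mul_apply, conjSForm_sum, conjSForm_mulForm X h h', Finset.smul_sum]

theorem star_d {k : ℕ} (A : SMat X N k) : star (d A) = d (star A) := by
  ext i j : 1
  exact conjSForm_dForm _

theorem star_add {k : ℕ} (A B : SMat X N k) : star (A + B) = star A + star B := by
  ext i j : 1
  exact conjSForm_add _ _

end SMat

open DirectSum

variable (N) in
/-- The graded algebra `M_N(Ω(M_θ))`. -/
abbrev TotalAlg : Type _ := ⨁ k, SMat X N k

variable {X}

/-- Homogeneous elements of degree `k`. -/
def IsHom (k : ℕ) (x : TotalAlg X N) : Prop := ∃ A : SMat X N k, x = of (SMat X N) k A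

theorem of_mul {p q r : ℕ} (h : p + q = r) (A : SMat X N p) (B : SMat X N q) :
    of (SMat X N) p A * of (SMat X N) q B = of (SMat X N) r (SMat.mul h A B) := by
  subst h
  rw [of_mul_of]
  rfl

theorem IsHom.mul {p q : ℕ} {x y : TotalAlg X N} (hx : IsHom p x) (hy : IsHom q y) :
    IsHom (p + q) (x * y) := by
  obtain ⟨A, rfl⟩ := hx
  obtain ⟨B, rfl⟩ := hy
  exact ⟨_, of_mul rfl A B⟩

variable (X N) in
/-- The exterior derivative on the total algebra. -/
def dTotal : TotalAlg X N →+ TotalAlg X N :=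
  toAddMonoid fun k => (of (SMat X N) (k + 1)).comp (SMat.d (X := X)).toAddMonoidHom

theorem dTotal_of {k : ℕ} (A : SMat X N k) :
    dTotal X N (of (SMat X N) k A) = of (SMat X N) (k + 1) (SMat.d A) :=
  toAddMonoid_of _ _ _

theorem IsHom.dTotal {k : ℕ} {x : TotalAlg X N} (hx : IsHom k x) :
    IsHom (k + 1) (dTotal X N x) := by
  obtain ⟨A, rfl⟩ := hx
  exact ⟨_, dTotal_of A⟩

theorem dTotal_dTotal (x : TotalAlg X N) : dTotal X N (dTotal X N x) = 0 := by
  induction x using DirectSum.induction_on with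
  | zero => simp
  | of k A => rw [dTotal_of, dTotal_of, SMat.d_d, map_zero]
  | add x y hx hy => rw [map_add, map_add, hx, hy, add_zero]

theorem neg_one_pow_smul {k : ℕ} (p : ℕ) (A : SMat X N k) :
    (-1 : ℂ) ^ p • A = (-1 : ℤ) ^ p • A := by
  rcases Nat.even_or_odd p with h | h
  · rw [h.neg_one_pow, h.neg_one_pow, one_smul, one_smul]
  · rw [h.neg_one_pow, h.neg_one_pow, neg_smul, neg_smul, one_smul, one_smul]

theorem dTotal_mul {p : ℕ} {x : TotalAlg X N} (hx : IsHom p x) (y : TotalAlg X N) :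
    dTotal X N (x * y) = dTotal X N x * y + (-1 : ℤ) ^ p • (x * dTotal X N y) := by
  obtain ⟨A, rfl⟩ := hx
  induction y using DirectSum.induction_on with
  | zero => simp
  | of q B =>
    rw [of_mul rfl, dTotal_of, dTotal_of, dTotal_of, of_mul (show p + 1 + q = p + q + 1 by omega),
      of_mul (show p + (q + 1) = p + q + 1 by omega), SMat.d_mul rfl (by omega) (by omega),
      neg_one_pow_smul, map_add, map_zsmul]
  | add x y hx hy =>
    simp only [mul_add, map_add, hx, hy, smul_add]
    abel

end MatrixAlgebra

/-! ### Closed graded traces and the Chern–Weil argument -/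

section ClosedTrace

open DirectSum

variable {M : Type*} [TopologicalSpace M] [ChartedSpace E4 M] [IsManifold (𝓡 4) ∞ M] {n : ℕ}

/-- A graded trace on the top degree forms of `M_θ` that vanishes on exact forms. -/
structure ClosedTrace (X : ToricData M n) where
  toFun : SForm M 4 →ₗ[ℂ] ℂ
  cyclic : ∀ {p q : ℕ} (h : p + q = 4) (h' : q + p = 4) (α : SForm M p) (β : SForm M q),
    toFun (mulForm X h α β) = (-1 : ℂ) ^ (p * q) * toFun (mulForm X h' β α)
  closed : ∀ η : SForm M 3, toFun (dForm 3 η) = 0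

variable {X : ToricData M n} {N : ℕ} (τ : ClosedTrace X)

/-- The trace of a matrix of forms. -/
def ClosedTrace.mat : SMat X N 4 →+ ℂ where
  toFun A := ∑ i, τ.toFun (A i i)
  map_zero' := by simp [SMat.zero_apply]
  map_add' A B := by simp [SMat.add_apply, Finset.sum_add_distrib]

theorem ClosedTrace.mat_apply (A : SMat X N 4) : τ.mat A = ∑ i, τ.toFun (A i i) := rfl

theorem ClosedTrace.mat_mul {p q : ℕ} (h : p + q = 4) (h' : q + p = 4) (A : SMat X N p)
    (B : SMat X N q) :
    τ.mat (SMat.mul h A B) = (-1 : ℂ) ^ (p * q) * τ.mat (SMat.mul h' B A) := by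
  simp only [mat_apply, SMat.mul_apply, map_sum, Finset.mul_sum]
  rw [Finset.sum_comm]
  exact Finset.sum_congr rfl fun i _ => Finset.sum_congr rfl fun j _ => τ.cyclic h h' _ _

/-- The trace on the total algebra. -/
def ClosedTrace.total : TotalAlg X N →+ ℂ :=
  τ.mat.comp (DFinsupp.evalAddMonoidHom 4)

theorem ClosedTrace.total_of (A : SMat X N 4) : τ.total (of (SMat X N) 4 A) = τ.mat A :=
  congrArg τ.mat (of_eq_same (β := SMat X N) 4 A)

theorem ClosedTrace.total_of_ne {k : ℕ} (hk : k ≠ 4) (A : SMat X N k) :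
    τ.total (of (SMat X N) k A) = 0 :=
  (congrArg τ.mat (of_eq_of_ne (β := SMat X N) k 4 A hk.symm)).trans (map_zero _)

theorem ClosedTrace.total_mul {p q : ℕ} {x y : TotalAlg X N} (hx : IsHom p x) (hy : IsHom q y) :
    τ.total (x * y) = (-1 : ℂ) ^ (p * q) * τ.total (y * x) := by
  obtain ⟨A, rfl⟩ := hx
  obtain ⟨B, rfl⟩ := hy
  by_cases h : p + q = 4
  · have h' : q + p = 4 := by omega
    rw [of_mul h, of_mul h', total_of, total_of, τ.mat_mul h h']
  · rw [of_mul rfl, of_mul rfl, τ.total_of_ne h, τ.total_of_ne (by omega), mul_zero]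

theorem ClosedTrace.total_dTotal (x : TotalAlg X N) : τ.total (dTotal X N x) = 0 := by
  induction x using DirectSum.induction_on with
  | zero => simp
  | of k A =>
    rw [dTotal_of]
    by_cases h : k = 3
    · subst h
      rw [total_of, mat_apply]
      exact Finset.sum_eq_zero fun i _ => τ.closed _
    · exact τ.total_of_ne (by omega) _
  | add x y hx hy => rw [map_add, map_add, hx, hy, add_zero]

section Curvature

variable {P A : TotalAlg X N}

theorem dTotal_idem (hP : IsHom 0 P) (hPP : P * P = P) :
    dTotal X N P = dTotal X N P * P + P * dTotal X N P := by
  conv_lhs => rw [← hPP]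
  rw [dTotal_mul hP, pow_zero, one_smul]

/-- Multiplying dp = dp p + p dp by p on the left gives p dp = p dp p + p dp. -/
theorem idem_dTotal_idem (hP : IsHom 0 P) (hPP : P * P = P) : P * dTotal X N P * P = 0 := by
  have h := dTotal_idem hP hPP
  have h1 : P * dTotal X N P = P * dTotal X N P * P + P * dTotal X N P := by
    conv_lhs => rw [h]
    rw [mul_add, ← mul_assoc, ← mul_assoc, hPP]
  exact left_eq_add.1 (h1.trans (add_comm _ _))

/-- The trace of the square of the curvature of `p d + A` does not depend on `A`. -/
theorem ClosedTrace.total_curvature_sq (hP : IsHom 0 P) (hPP : P * P = P) (hA : IsHom 1 A)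
    (hPA : P * A = A) (hAP : A * P = A) {F : TotalAlg X N}
    (hF : F = A * A + A * dTotal X N P + P * dTotal X N A + P * dTotal X N P * dTotal X N P) :
    τ.total (F * F) = τ.total
      (P * dTotal X N P * dTotal X N P * (P * dTotal X N P * dTotal X N P)) := by
  have hD := hP.dTotal
  have hB := hA.dTotal
  have h1 := dTotal_idem hP hPP
  have h2 := idem_dTotal_idem hP hPP
  have hB1 : dTotal X N A = dTotal X N A * P - A * dTotal X N P := by
    conv_lhs => rw [← hAP]
    rw [dTotal_mul hA, pow_one, neg_smul, one_smul, sub_eq_add_neg]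
  have hB2 : dTotal X N A = dTotal X N P * A + P * dTotal X N A := by
    conv_lhs => rw [← hPA]
    rw [dTotal_mul hP, pow_zero, one_smul]
  have hDD := dTotal_dTotal (X := X) (N := N) P
  have hBB := dTotal_dTotal (X := X) (N := N) A
  have hdAA := dTotal_mul hA A
  have hdAB := dTotal_mul hA (dTotal X N A)
  have hdDD := dTotal_mul hD (dTotal X N P)
  have hdAAA := dTotal_mul hA (A * A)
  have hdPDD := dTotal_mul hP (dTotal X N P * dTotal X N P)
  have hGhom : IsHom 2 (P * dTotal X N P * dTotal X N P) := (hP.mul hD).mul hD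
  have hdGA := dTotal_mul hGhom A
  generalize dTotal X N A = B at *
  generalize dTotal X N P = D at *
  have hADA : A * D * A = 0 := by
    calc A * D * A = A * P * D * (P * A) := by rw [hAP, hPA]
      _ = A * (P * D * P) * A := by noncomm_ring
      _ = 0 := by rw [h2, mul_zero, zero_mul]
  -- `P * D * D` is the curvature of the Grassmann connection p d, and it is fixed by `P` on both
  -- sides.
  have hG1 : P * D * D = P * D * D * P := by
    calc P * D * D = P * D * (D * P + P * D) := by rw [← h1]
      _ = P * D * D * P + P * D * P * D := by noncomm_ring
      _ = _ := by rw [h2, zero_mul, add_zero]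
  have hG2 : D * D * P = P * D * D * P := by
    calc D * D * P = (D * P + P * D) * D * P := by rw [← h1]
      _ = D * (P * D * P) + P * D * D * P := by noncomm_ring
      _ = _ := by rw [h2, mul_zero, zero_add]
  have hPDA : P * D * A = 0 := by
    calc P * D * A = P * D * P * A := by rw [mul_assoc (P * D) P A, hPA]
      _ = 0 := by rw [h2, zero_mul]
  -- A splitting of `F` into three terms, each fixed by `P` on both sides: the A dp term is absorbed
  -- when p dA is replaced by p dA p.
  have hFQ : F = A * A + P * B * P + P * D * D := by
    have e : P * B = P * B * P - A * D := by
      conv_lhs => rw [hB1]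
      rw [mul_sub, ← mul_assoc, ← mul_assoc, hPA]
    rw [hF, sub_eq_iff_eq_add.1 e.symm]
    noncomm_ring
  -- Moving one odd factor past three others shows that this trace equals its negative.
  have tSS : τ.total (A * A * (A * A)) = 0 := by
    have h := τ.total_mul hA (hA.mul (hA.mul hA))
    have e : A * (A * A) * A = A * (A * (A * A)) := by noncomm_ring
    rw [e] at h
    rw [mul_assoc]
    norm_num at h
    exact self_eq_neg.1 h
  -- The trace of d(A³) vanishes, and by cyclicity it is three times the trace of A² dA.
  have tAAB : τ.total (A * A * B) = 0 := by
    have e1 := τ.total_mul hB (hA.mul hA)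
    have e2 := τ.total_mul hA (hB.mul hA)
    have e3 := τ.total_dTotal (A * (A * A))
    rw [hdAAA, hdAA] at e3
    norm_num [mul_add, ← mul_assoc] at e1 e2 e3
    linear_combination (e3 + e2 - 2 * e1) / 3
  have tSQ : τ.total (A * A * (P * B * P)) = 0 := by
    have e1 := τ.total_mul ((hA.mul hA).mul hB) hP
    have e2 : A * A * (P * B * P) = A * A * B * P := by
      rw [← mul_assoc, ← mul_assoc, mul_assoc A A P, hAP]
    rw [e2, e1, ← mul_assoc, ← mul_assoc, hPA, tAAB, mul_zero]
  have tQS : τ.total (P * B * P * (A * A)) = 0 := by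
    rw [τ.total_mul ((hP.mul hB).mul hP) (hA.mul hA), tSQ, mul_zero]
  have tSG : τ.total (A * A * (P * D * D)) = τ.total (P * D * D * (A * A)) := by
    rw [τ.total_mul (hA.mul hA) hGhom]
    norm_num
  -- Closedness is applied to p dp dp A. The other term of its differential, (dp)³ A, has trace
  -- zero: it equals (dp)³ A p, and p (dp)³ A = (dp)² p dp A = 0.
  have tGB : τ.total (P * D * D * B) = 0 := by
    have e1 := τ.total_dTotal (P * D * D * A)
    have e2 := τ.total_mul (((hD.mul hD).mul hD).mul hA) hP
    have e3 : P * (D * D * D * A) = 0 := by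
      calc P * (D * D * D * A) = P * D * D * (D * A) := by noncomm_ring
        _ = D * D * (P * D * A) := by rw [hG1.trans hG2.symm]; noncomm_ring
        _ = 0 := by rw [hPDA, mul_zero]
    rw [e3, map_zero, mul_zero, mul_assoc _ A P, hAP] at e2
    rw [hdGA, mul_assoc P D D, hdPDD, hdDD, hDD] at e1
    norm_num at e1
    rw [← mul_assoc D D D] at e1
    rw [mul_assoc P D D]
    linear_combination e1 - e2
  have tGQ : τ.total (P * D * D * (P * B * P)) = 0 := by
    have e1 := τ.total_mul (hGhom.mul hB) hP
    have e2 : P * D * D * (P * B * P) = P * D * D * B * P := by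
      rw [← mul_assoc, ← mul_assoc, ← hG1]
    have e3 : P * (P * D * D * B) = P * D * D * B := by
      simp only [← mul_assoc, hPP]
    rw [e2, e1, e3, tGB, mul_zero]
  have tQG : τ.total (P * B * P * (P * D * D)) = 0 := by
    rw [τ.total_mul ((hP.mul hB).mul hP) hGhom, tGQ, mul_zero]
  have tBDA : τ.total (B * (D * A)) = τ.total (P * D * D * (A * A)) := by
    have e1 : B * (D * A) = -(A * (D * D * A)) := by
      calc B * (D * A) = (B * P - A * D) * (D * A) := by rw [← hB1]
        _ = B * (P * D * A) - A * (D * D * A) := by noncomm_ring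
        _ = _ := by rw [hPDA, mul_zero, zero_sub]
    have e2 : D * D * A * A = P * D * D * (A * A) := by
      calc D * D * A * A = D * D * (P * A) * A := by rw [hPA]
        _ = D * D * P * (A * A) := by noncomm_ring
        _ = _ := by rw [hG2, ← hG1]
    have e3 := τ.total_mul hA ((hD.mul hD).mul hA)
    rw [e1, map_neg, e3, e2]
    norm_num
  -- By p dA = dA - dp A the square expands into dA dA = d(A dA), which has trace zero, two mixed
  -- terms of trace τ(p dp dp A²) each, and a term containing A dp A = 0.
  have tQQ : τ.total (P * B * P * (P * B * P)) = -2 * τ.total (P * D * D * (A * A)) := by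
    have hPB : P * B = B - D * A := eq_sub_of_add_eq' hB2.symm
    have e1 := τ.total_mul ((hP.mul hB).mul (hP.mul hB)) hP
    have e2 : P * B * P * (P * B * P) = P * B * (P * B) * P := by
      calc _ = P * B * (P * P) * B * P := by noncomm_ring
        _ = _ := by rw [hPP, ← mul_assoc]
    have e3 : P * (P * B * (P * B)) = P * B * (P * B) := by
      simp only [← mul_assoc, hPP]
    have e4 : P * B * (P * B) = B * B - B * (D * A) - D * A * B + D * (A * D * A) := by
      rw [hPB]
      noncomm_ring
    have e5 := τ.total_dTotal (A * B)
    have e6 := τ.total_mul (hD.mul hA) hB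
    rw [hdAB, hBB] at e5
    norm_num at e1 e5 e6
    rw [e2, e1, e3, e4, hADA, mul_zero, add_zero, map_sub, map_sub, e5, e6, tBDA]
    ring
  have hexp : F * F = A * A * (A * A) + A * A * (P * B * P) + A * A * (P * D * D) +
      P * B * P * (A * A) + P * B * P * (P * B * P) + P * B * P * (P * D * D) +
      P * D * D * (A * A) + P * D * D * (P * B * P) + P * D * D * (P * D * D) := by
    rw [hFQ]
    noncomm_ring
  -- The two cross terms between A² and p dp dp cancel against the trace of (p dA p)²; only the
  -- square of p dp dp remains.
  rw [hexp]
  simp only [map_add]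
  rw [tSS, tSQ, tSG, tQS, tQQ, tQG, tGQ]
  ring

end Curvature

end ClosedTrace

/-! ### Columns of smooth forms and the action of gauge transformations on connections -/

section Gauge

open DirectSum

variable {M : Type*} [TopologicalSpace M] [ChartedSpace E4 M] [IsManifold (𝓡 4) ∞ M] {n : ℕ}
variable {X : ToricData M n} {N : ℕ}

/-- Forgetting smoothness of the entries of a column. -/
def colForm {k : ℕ} (ξ : Fin N → SForm M k) : Fin N → Form M k := fun i => ξ i

/-- Forgetting smoothness of the entries of a matrix. -/
def SMat.form {k : ℕ} (A : SMat X N k) : MForm M N k := fun i j => (A i j : Form M k)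

theorem SMat.form_injective {k : ℕ} : Function.Injective (SMat.form (X := X) (N := N) (k := k)) :=
  fun A B h => by
    ext i j : 1
    exact Subtype.ext (congrFun (congrFun h i) j)

/-- A column of a matrix. -/
def SMat.col {k : ℕ} (A : SMat X N k) (j : Fin N) : Fin N → SForm M k := fun i => A i j

omit [IsManifold (𝓡 4) ∞ M] in
theorem exists_colForm {k : ℕ} {ξ : Fin N → Form M k} (h : ∀ i, IsSmooth (ξ i)) :
    ∃ ξ' : Fin N → SForm M k, colForm ξ' = ξ := ⟨fun i => ⟨ξ i, h i⟩, rfl⟩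

theorem exists_form {k : ℕ} {A : MForm M N k} (h : ∀ i j, IsSmooth (A i j)) :
    ∃ A' : SMat X N k, A'.form = A := ⟨fun i j => ⟨A i j, h i j⟩, rfl⟩

/-- A matrix applied to a column. -/
def SMat.app {a k l : ℕ} (h : a + k = l) (A : SMat X N a) (ξ : Fin N → SForm M k) :
    Fin N → SForm M l :=
  fun i => ∑ j, mulForm X h (A i j) (ξ j)

theorem SMat.app_col {a k l : ℕ} (h : a + k = l) (A : SMat X N a) (B : SMat X N k) (j : Fin N) :
    A.app h (B.col j) = (SMat.mul h A B).col j := rfl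

theorem SMat.app_app {a b c k l m : ℕ} (h1 : a + b = c) (h2 : c + k = m) (h3 : b + k = l)
    (h4 : a + l = m) (A : SMat X N a) (B : SMat X N b) (ξ : Fin N → SForm M k) :
    A.app h4 (B.app h3 ξ) = (SMat.mul h1 A B).app h2 ξ := by
  funext i
  simp only [app, SMat.mul_apply, map_sum, LinearMap.sum_apply]
  rw [Finset.sum_comm]
  exact Finset.sum_congr rfl fun l _ => Finset.sum_congr rfl fun m _ =>
    (mulForm_assoc X h1 h2 h3 h4 _ _ _).symm

theorem SMat.app_add {a k l : ℕ} (h : a + k = l) (A : SMat X N a) (ξ η : Fin N → SForm M k) :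
    A.app h (ξ + η) = A.app h ξ + A.app h η := by
  funext i
  simp [app, Finset.sum_add_distrib]

theorem SMat.app_smul {a k l : ℕ} (h : a + k = l) (A : SMat X N a) (c : ℂ)
    (ξ : Fin N → SForm M k) : A.app h (c • ξ) = c • A.app h ξ := by
  funext i
  simp [app, Finset.smul_sum]

theorem applyMat_form {a k l : ℕ} (h : a + k = l) (A : SMat X N a) (ξ : Fin N → SForm M k) :
    applyMat X h A.form (colForm ξ) = colForm (A.app h ξ) := by
  funext i
  exact (Submodule.coe_sum (SForm M l) (fun j => mulForm X h (A i j) (ξ j)) Finset.univ).symm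

theorem matMul_form (A B : SMat X N 0) : matMul X A.form B.form = (SMat.mul rfl A B).form := by
  funext i j
  exact (Submodule.coe_sum (SForm M 0)
    (fun l => mulForm X rfl (A i l) (B l j)) Finset.univ).symm

theorem adj_form (A : SMat X N 0) : adj A.form = A.star.form := rfl

/-- The right multiplication of a column by a form. -/
def rmul (X : ToricData M n) {k q r : ℕ} (h : k + q = r) (ξ : Fin N → SForm M k)
    (ρ : SForm M q) : Fin N → SForm M r :=
  fun i => mulForm X h (ξ i) ρ

theorem rightMul_colForm {k q r : ℕ} (h : k + q = r) (ξ : Fin N → SForm M k) (ρ : SForm M q) :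
    rightMul X h (colForm ξ) ρ = colForm (rmul X h ξ ρ) := rfl

theorem SMat.app_rmul {a k q r s t : ℕ} (h1 : a + k = s) (h2 : s + q = t) (h3 : k + q = r)
    (h4 : a + r = t) (A : SMat X N a) (ξ : Fin N → SForm M k) (ρ : SForm M q) :
    A.app h4 (rmul X h3 ξ ρ) = rmul X h2 (A.app h1 ξ) ρ := by
  funext i
  simp only [app, rmul, map_sum, LinearMap.sum_apply]
  exact Finset.sum_congr rfl fun j _ => (mulForm_assoc X h1 h2 h3 h4 _ _ _).symm

/-- The Hermitian structure on columns of smooth forms. -/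
def sherm (X : ToricData M n) {k l r : ℕ} (h : k + l = r) (ξ : Fin N → SForm M k)
    (η : Fin N → SForm M l) : SForm M r :=
  ∑ i, mulForm X h (conjSForm (ξ i)) (η i)

theorem herm_colForm {k l r : ℕ} (h : k + l = r) (ξ : Fin N → SForm M k)
    (η : Fin N → SForm M l) : herm X h (colForm ξ) (colForm η) = sherm X h ξ η :=
  (Submodule.coe_sum (SForm M r)
    (fun i => mulForm X h (conjSForm (ξ i)) (η i)) Finset.univ).symm

theorem sherm_app {k l r : ℕ} (h : k + l = r) (A : SMat X N 0) (ξ : Fin N → SForm M k)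
    (η : Fin N → SForm M l) :
    sherm X h ξ (A.app (Nat.zero_add l) η) =
      sherm X h (A.star.app (Nat.zero_add k) ξ) η := by
  simp only [sherm, SMat.app, map_sum, LinearMap.sum_apply, conjSForm_sum]
  rw [Finset.sum_comm]
  refine Finset.sum_congr rfl fun j _ => Finset.sum_congr rfl fun i _ => ?_
  rw [conjSForm_mulForm X (Nat.zero_add k) (Nat.add_zero k), zero_mul, pow_zero, one_smul,
    mulForm_assoc X (Nat.add_zero k) h (Nat.zero_add l) h, SMat.star, conjSForm_conjSForm]

variable {P : SMat X N 0}

theorem isSection_colForm {k : ℕ} (ξ : Fin N → SForm M k) :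
    IsSection X P.form (colForm ξ) ↔ P.app (Nat.zero_add k) ξ = ξ := by
  rw [IsSection, applyMat_form]
  refine ⟨fun h => funext fun i => Subtype.ext (congrFun h.2 i), fun h => ⟨fun i => (ξ i).2, ?_⟩⟩
  rw [h]

theorem IsSection.exists_colForm {k : ℕ} {ξ : Fin N → Form M k} (h : IsSection X P.form ξ) :
    ∃ ξ' : Fin N → SForm M k, colForm ξ' = ξ ∧ P.app (Nat.zero_add k) ξ' = ξ' := by
  obtain ⟨ξ', rfl⟩ := NCYM.exists_colForm h.1
  exact ⟨ξ', rfl, (isSection_colForm ξ').1 h⟩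

/-- A gauge transformation takes connections to connections. -/
theorem isConnection_gaugeTransform {D : Operator M N} (hD : IsConnection X P.form D)
    {u : SMat X N 0} (hu : IsGauge X P.form u.form) :
    IsConnection X P.form (gaugeTransform X u.form D) := by
  have hPu : SMat.mul (Nat.zero_add 0) P u = u := SMat.form_injective (by rw [← matMul_form, hu.left])
  have huP : SMat.mul (Nat.zero_add 0) u P = u := SMat.form_injective (by rw [← matMul_form, hu.right])
  have huu : SMat.mul (Nat.zero_add 0) u.star u = P :=
    SMat.form_injective (by rw [← matMul_form, ← adj_form, hu.adj_mul])
  -- Self-adjointness of `P` is inherited from P = u* u.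
  have hPs : P.star = P := by
    have := SMat.star_mul (Nat.zero_add 0) (Nat.zero_add 0) u.star u
    rw [huu, SMat.star_star, huu, mul_zero, pow_zero, one_smul] at this
    exact this
  have hPus : SMat.mul (Nat.zero_add 0) P u.star = u.star := by
    have := SMat.star_mul (Nat.zero_add 0) (Nat.zero_add 0) u P
    rw [huP, hPs, mul_zero, pow_zero, one_smul] at this
    exact this.symm
  have hsec : ∀ {k} (ξ : Fin N → SForm M k),
      IsSection X P.form (colForm (u.app (Nat.zero_add k) ξ)) := fun {k} ξ => by
    rw [isSection_colForm, SMat.app_app (Nat.zero_add 0) (Nat.zero_add k), hPu]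
  refine ⟨?_, ?_, ?_, ?_, ?_⟩
  · intro k ξ hξ
    obtain ⟨ξ, rfl, hPξ⟩ := hξ.exists_colForm
    obtain ⟨η, h1, h2⟩ := (hD.maps k _ (hsec ξ)).exists_colForm
    rw [gaugeTransform, applyMat_form, ← h1, adj_form, applyMat_form, isSection_colForm,
      SMat.app_app (Nat.zero_add 0) (Nat.zero_add (k + 1)), hPus]
  · intro k ξ η hξ hη
    obtain ⟨ξ, rfl, hPξ⟩ := hξ.exists_colForm
    obtain ⟨η, rfl, hη⟩ := hη.exists_colForm
    obtain ⟨ζ, h1, -⟩ := (hD.maps k _ (hsec ξ)).exists_colForm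
    obtain ⟨κ, h2, -⟩ := (hD.maps k _ (hsec η)).exists_colForm
    have e : colForm ξ + colForm η = colForm (ξ + η) := rfl
    have e' : ∀ {l} (ξ η : Fin N → SForm M l), colForm (ξ + η) = colForm ξ + colForm η :=
      fun _ _ => rfl
    simp only [gaugeTransform]
    rw [e, applyMat_form, applyMat_form, applyMat_form, SMat.app_add, e',
      hD.map_add k _ _ (hsec ξ) (hsec η), ← h1, ← h2, ← e', adj_form, applyMat_form,
      SMat.app_add, applyMat_form, applyMat_form, e']
  · intro k c ξ hξ
    obtain ⟨ξ, rfl, hPξ⟩ := hξ.exists_colForm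
    obtain ⟨ζ, h1, -⟩ := (hD.maps k _ (hsec ξ)).exists_colForm
    have e : ∀ {l} (ξ : Fin N → SForm M l), colForm (c • ξ) = c • colForm ξ := fun _ => rfl
    simp only [gaugeTransform]
    rw [← e, applyMat_form, applyMat_form, SMat.app_smul, e, hD.map_smul k c _ (hsec ξ), ← h1,
      ← e, adj_form, applyMat_form, SMat.app_smul, applyMat_form, e]
  · intro k q r h ξ ρ hξ hρ
    obtain ⟨ξ, rfl, hPξ⟩ := hξ.exists_colForm
    lift ρ to SForm M q using hρ
    obtain ⟨ζ, h1, -⟩ := (hD.maps k _ (hsec ξ)).exists_colForm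
    have e : ∀ {l} (ξ : Fin N → SForm M l) (c : ℂ), colForm (c • ξ) = c • colForm ξ :=
      fun _ _ => rfl
    have e' : ∀ {l} (ξ η : Fin N → SForm M l), colForm (ξ + η) = colForm ξ + colForm η :=
      fun _ _ => rfl
    simp only [gaugeTransform]
    rw [rightMul_colForm, applyMat_form, applyMat_form,
      SMat.app_rmul (Nat.zero_add k) h h (Nat.zero_add r), ← rightMul_colForm,
      hD.leibniz k q r h _ ρ (hsec ξ) ρ.2, ← h1, rightMul_colForm, ← coe_dForm,
      rightMul_colForm, rightMul_colForm, ← e, ← e', adj_form, applyMat_form, applyMat_form,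
      rightMul_colForm, SMat.app_add, SMat.app_smul,
      SMat.app_rmul (Nat.zero_add (k + 1)) (by omega) (by omega) (by omega),
      SMat.app_rmul (Nat.zero_add k) (by omega) (by omega) (by omega),
      SMat.app_app (Nat.zero_add 0) (Nat.zero_add k), huu, hPξ, e', e]
  · intro ξ η hξ hη
    obtain ⟨ξ, rfl, hPξ⟩ := hξ.exists_colForm
    obtain ⟨η, rfl, hη⟩ := hη.exists_colForm
    obtain ⟨ζ, h1, -⟩ := (hD.maps 0 _ (hsec ξ)).exists_colForm
    obtain ⟨κ, h2, -⟩ := (hD.maps 0 _ (hsec η)).exists_colForm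
    have h3 := hD.compatible _ _ (hsec ξ) (hsec η)
    simp only [gaugeTransform]
    rw [applyMat_form, applyMat_form, ← h1, ← h2, adj_form, applyMat_form, applyMat_form,
      herm_colForm, herm_colForm, herm_colForm]
    rw [← h1, ← h2, herm_colForm, herm_colForm, herm_colForm] at h3
    -- Moving u* across the Hermitian structure reduces compatibility at ξ, η to compatibility of
    -- the original connection at uξ, uη.
    rw [sherm_app _ u.star, SMat.star_star, ← sherm_app, h3, sherm_app,
      SMat.app_app (Nat.zero_add 0) (Nat.zero_add 0), huu, hPξ]

end Gauge

/-! ### Connection form, curvature and their behaviour under gauge transformations -/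

section Connection

open DirectSum

variable {M : Type*} [TopologicalSpace M] [ChartedSpace E4 M] [IsManifold (𝓡 4) ∞ M] {n : ℕ}
variable {X : ToricData M n} {N : ℕ} {P : SMat X N 0} {D : Operator M N}

/-- The columns of smooth forms that lie in `𝓔 ⊗ Ω^k`. -/
def sections (P : SMat X N 0) (k : ℕ) : Submodule ℂ (Fin N → SForm M k) where
  carrier := {ξ | P.app (Nat.zero_add k) ξ = ξ}
  zero_mem' := by
    funext i
    simp [SMat.app]
  add_mem' := fun ha hb => by
    rw [Set.mem_ofPred_eq] at *
    rw [SMat.app_add, ha, hb]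
  smul_mem' := fun c a ha => by
    rw [Set.mem_ofPred_eq] at *
    rw [SMat.app_smul, ha]

theorem sections_isSection {k : ℕ} (ξ : sections P k) : IsSection X P.form (colForm (ξ : Fin N → SForm M k)) :=
  (isSection_colForm _).2 ξ.2

/-- A connection as a linear map on sections. -/
def IsConnection.toLinearMap (hD : IsConnection X P.form D) (k : ℕ) :
    sections P k →ₗ[ℂ] (Fin N → Form M (k + 1)) where
  toFun ξ := D k (colForm (ξ : Fin N → SForm M k))
  map_add' ξ η := hD.map_add k _ _ (sections_isSection ξ) (sections_isSection η)
  map_smul' c ξ := hD.map_smul k c _ (sections_isSection ξ)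

theorem IsProjection.mul_self (hP : IsProjection X P.form) : SMat.mul (Nat.zero_add 0) P P = P :=
  SMat.form_injective (by rw [← matMul_form, hP.idem])

theorem IsProjection.star_self (hP : IsProjection X P.form) : P.star = P :=
  SMat.form_injective (by rw [← adj_form, hP.selfAdj])

theorem IsProjection.col_mem (hP : IsProjection X P.form) (j : Fin N) :
    P.col j ∈ sections P 0 := by
  change P.app _ (P.col j) = P.col j
  rw [SMat.app_col, hP.mul_self]

/-- The connection form: `∇ B = ω B + p dB` for all `B` with `p B = B`. -/
theorem IsConnection.exists_form (hP : IsProjection X P.form) (hD : IsConnection X P.form D) :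
    ∃ W : SMat X N 1, SMat.mul (Nat.zero_add 1) P W = W ∧
      (∀ j, D 0 (colForm (P.col j)) = colForm (W.col j)) ∧
      ∀ (k : ℕ) (B : SMat X N k), SMat.mul (Nat.zero_add k) P B = B → ∀ j,
        D k (colForm (B.col j)) = colForm ((SMat.mul (Nat.add_comm 1 k) W B +
          SMat.mul (Nat.zero_add (k + 1)) P (SMat.d B)).col j) := by
  have h0 := fun j => (hD.maps 0 _ ((isSection_colForm _).2 (hP.col_mem j))).exists_colForm
  -- The j-th column of the connection form is ∇(p e_j).
  choose W hW1 hW2 using h0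
  let W' : SMat X N 1 := fun i j => W j i
  refine ⟨W', ?_, fun j => (hW1 j).symm, fun k B hB j => ?_⟩
  · ext i j : 1
    exact congrFun (hW2 j) i
  -- Since pB = B, the j-th column of B is the sum over l of (p e_l) B_lj. Every summand is a
  -- section, so additivity and the Leibniz rule apply.
  · have hmem : ∀ l, rmul X (Nat.zero_add k) (P.col l) (B l j) ∈ sections P k := fun l => by
      change P.app _ _ = _
      rw [SMat.app_rmul (Nat.zero_add 0) (Nat.zero_add k), SMat.app_col, hP.mul_self]
    let s : Fin N → sections P k := fun l => ⟨_, hmem l⟩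
    have hcol : B.col j = ((∑ l, s l : sections P k) : Fin N → SForm M k) := by
      rw [Submodule.coe_sum]
      funext i
      rw [Finset.sum_apply]
      exact (congrFun (congrFun hB i) j).symm
    have hsum : D k (colForm ((∑ l, s l : sections P k) : Fin N → SForm M k)) =
        ∑ l, D k (colForm (s l : Fin N → SForm M k)) := map_sum (hD.toLinearMap k) s Finset.univ
    have hterm : ∀ l, D k (colForm (s l : Fin N → SForm M k)) =
        colForm (rmul X (Nat.add_comm 1 k) (W l) (B l j) +
          rmul X (Nat.zero_add (k + 1)) (P.col l) (dForm k (B l j))) := fun l => by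
      have h1 := hD.leibniz 0 k k (Nat.zero_add k) (colForm (P.col l)) (B l j)
        ((isSection_colForm _).2 (hP.col_mem l)) (B l j).2
      rw [← hW1, pow_zero, one_smul] at h1
      exact h1
    rw [hcol, hsum, Finset.sum_congr rfl fun l _ => hterm l]
    funext i
    rw [Finset.sum_apply]
    refine (Submodule.coe_sum (SForm M (k + 1)) (fun l =>
      mulForm X (Nat.add_comm 1 k) (W l i) (B l j) +
        mulForm X (Nat.zero_add (k + 1)) (P i l) (dForm k (B l j))) Finset.univ).symm.trans ?_
    refine congrArg Subtype.val ?_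
    exact Finset.sum_add_distrib

/-- The connection form `A = ω p` and the curvature of a compatible connection. -/
theorem IsConnection.exists_potential (hP : IsProjection X P.form)
    (hD : IsConnection X P.form D) :
    ∃ (A : SMat X N 1) (F : SMat X N 2), F.form = curvature P.form D ∧
      of (SMat X N) 0 P * of (SMat X N) 1 A = of (SMat X N) 1 A ∧
      of (SMat X N) 1 A * of (SMat X N) 0 P = of (SMat X N) 1 A ∧ A.star = -A ∧
      of (SMat X N) 2 F = of (SMat X N) 1 A * of (SMat X N) 1 A +
        of (SMat X N) 1 A * dTotal X N (of (SMat X N) 0 P) +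
        of (SMat X N) 0 P * dTotal X N (of (SMat X N) 1 A) +
        of (SMat X N) 0 P * dTotal X N (of (SMat X N) 0 P) *
          dTotal X N (of (SMat X N) 0 P) := by
  obtain ⟨W, hPW, hW0, hW⟩ := hD.exists_form hP
  have hPP := hP.mul_self
  have hPs := hP.star_self
  have e1 : of (SMat X N) 0 P * of (SMat X N) 1 W = of (SMat X N) 1 W := by
    rw [of_mul (Nat.zero_add 1), hPW]
  have epp : of (SMat X N) 0 P * of (SMat X N) 0 P = of (SMat X N) 0 P := by
    rw [of_mul (Nat.zero_add 0), hPP]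
  -- The formula for ∇ evaluated on p itself: ω = ∇p = ωp + p dp.
  have e2 : of (SMat X N) 1 W = of (SMat X N) 1 W * of (SMat X N) 0 P +
      of (SMat X N) 0 P * dTotal X N (of (SMat X N) 0 P) := by
    rw [dTotal_of, of_mul (Nat.add_zero 1), of_mul (Nat.zero_add 1), ← _root_.map_add]
    refine congrArg _ (SMat.form_injective ?_)
    funext i j
    exact congrFun ((hW0 j).symm.trans (hW 0 P hPP j)) i
  -- Compatibility on the columns of p, as a matrix identity: ω* p + p ω = dp.
  have e3 : of (SMat X N) 1 W.star * of (SMat X N) 0 P + of (SMat X N) 0 P * of (SMat X N) 1 W =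
      dTotal X N (of (SMat X N) 0 P) := by
    rw [dTotal_of, of_mul (Nat.add_zero 1), of_mul (Nat.zero_add 1), ← _root_.map_add]
    have h2 : SMat.mul (Nat.add_zero 1) W.star P + SMat.mul (Nat.zero_add 1) P.star W =
        SMat.d (SMat.mul (Nat.zero_add 0) P.star P) := by
      ext i j : 1
      have h1 := hD.compatible _ _ ((isSection_colForm _).2 (hP.col_mem i))
        ((isSection_colForm _).2 (hP.col_mem j))
      rw [hW0, hW0, herm_colForm, herm_colForm, herm_colForm, ← coe_dForm] at h1
      exact Subtype.ext h1
    rw [hPs, hPP] at h2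
    rw [h2]
  have e4 : SMat.star (SMat.mul (Nat.add_zero 1) W P) = SMat.mul (Nat.zero_add 1) P W.star := by
    rw [SMat.star_mul (Nat.add_zero 1) (Nat.zero_add 1), hPs, mul_zero, pow_zero, one_smul]
  have e5 : SMat.mul (Nat.zero_add 1) P (SMat.mul (Nat.add_zero 1) W P) =
      SMat.mul (Nat.add_zero 1) W P := by
    rw [← SMat.mul_assoc (Nat.zero_add 1) (Nat.add_zero 1), hPW]
  have e6 : of (SMat X N) 1 (SMat.star (SMat.mul (Nat.add_zero 1) W P)) =
      of (SMat X N) 0 P * of (SMat X N) 1 W.star * of (SMat X N) 0 P := by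
    rw [← e5, SMat.star_mul (Nat.zero_add 1) (Nat.add_zero 1), zero_mul, pow_zero, one_smul, e4,
      hPs, of_mul (Nat.zero_add 1), of_mul (Nat.add_zero 1)]
  have e7 : of (SMat X N) 1 (SMat.mul (Nat.add_zero 1) W P) =
      of (SMat X N) 1 W * of (SMat X N) 0 P := by
    rw [of_mul (Nat.add_zero 1)]
  refine ⟨SMat.mul (Nat.add_zero 1) W P, SMat.mul rfl W W + SMat.mul (Nat.zero_add 2) P (SMat.d W),
    ?_, ?_, ?_, ?_, ?_⟩
  · funext i j
    have h1 : curvature P.form D i j = D 1 (D 0 (colForm (P.col j))) i := rfl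
    rw [h1, hW0, hW 1 W hPW]
    rfl
  · rw [e7, ← mul_assoc, e1]
  · rw [e7, mul_assoc, epp]
  -- Multiplying ω* p + pω = dp by p gives p ω* p + ω = p dp; with ω = ωp + p dp this says (ωp)* =
  -- -ωp.
  · refine of_injective (β := SMat X N) 1 ?_
    rw [e6, map_neg, e7]
    have h1 : of (SMat X N) 0 P * of (SMat X N) 1 W.star * of (SMat X N) 0 P +
        of (SMat X N) 1 W = of (SMat X N) 0 P * dTotal X N (of (SMat X N) 0 P) := by
      rw [← e3, mul_add, ← mul_assoc, ← mul_assoc, epp, e1]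
    rw [e2, ← add_assoc, add_eq_right] at h1
    exact eq_neg_of_add_eq_zero_left h1
  -- The curvature is ωω + p dω; substitute ω = A + p dp and dω = dA + dp dp.
  · have hp : IsHom 0 (of (SMat X N) 0 P) := ⟨P, rfl⟩
    have h2 := idem_dTotal_idem hp epp
    have h3 := dTotal_mul hp (dTotal X N (of (SMat X N) 0 P))
    rw [dTotal_dTotal, mul_zero, smul_zero, add_zero] at h3
    have h4 := congrArg (dTotal X N) e2
    rw [_root_.map_add, h3, ← e7] at h4
    rw [_root_.map_add, ← of_mul (rfl : 1 + 1 = 2), ← of_mul (Nat.zero_add 2), ← dTotal_of, h4]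
    rw [← e7] at e2
    have h5 : of (SMat X N) 0 P * of (SMat X N) 1 (SMat.mul (Nat.add_zero 1) W P) =
      of (SMat X N) 1 (SMat.mul (Nat.add_zero 1) W P) := by rw [of_mul (Nat.zero_add 1), e5]
    have h6 : of (SMat X N) 1 (SMat.mul (Nat.add_zero 1) W P) * of (SMat X N) 0 P =
      of (SMat X N) 1 (SMat.mul (Nat.add_zero 1) W P) := by rw [e7, mul_assoc, epp]
    rw [e2]
    generalize of (SMat X N) 1 (SMat.mul (Nat.add_zero 1) W P) = a at *
    generalize dTotal X N (of (SMat X N) 0 P) = D at *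
    generalize of (SMat X N) 0 P = p at *
    have h7 : p * D * a = 0 := by
      rw [← h5, ← mul_assoc, h2, zero_mul]
    have h8 : (a + p * D) * (a + p * D) = a * a + a * p * D + p * D * a + p * D * p * D := by
      noncomm_ring
    rw [h8, h6, h7, h2, zero_mul]
    noncomm_ring

/-- The middle factor u u* = p of u*∇u u*∇u disappears, and ∇² is right linear, so the transformed
curvature is u* F u. -/
theorem IsConnection.curvature_gaugeTransform (hP : IsProjection X P.form)
    (hD : IsConnection X P.form D) {u : SMat X N 0} (hu : IsGauge X P.form u.form)
    {F : SMat X N 2} (hF : F.form = curvature P.form D) :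
    (SMat.mul (Nat.zero_add 2) u.star (SMat.mul (Nat.add_zero 2) F u)).form =
      curvature P.form (gaugeTransform X u.form D) := by
  obtain ⟨W, hPW, hW0, hW⟩ := hD.exists_form hP
  have hPP := hP.mul_self
  have hPu : SMat.mul (Nat.zero_add 0) P u = u :=
    SMat.form_injective (by rw [← matMul_form, hu.left])
  have huP : SMat.mul (Nat.zero_add 0) u P = u :=
    SMat.form_injective (by rw [← matMul_form, hu.right])
  have huu : SMat.mul (Nat.zero_add 0) u u.star = P :=
    SMat.form_injective (by rw [← matMul_form, ← adj_form, hu.mul_adj])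
  have hF' : F = SMat.mul rfl W W + SMat.mul (Nat.zero_add 2) P (SMat.d W) := by
    refine SMat.form_injective (hF.trans ?_)
    funext i j
    have h1 : curvature P.form D i j = D 1 (D 0 (colForm (P.col j))) i := rfl
    rw [h1, hW0, hW 1 W hPW]
    rfl
  obtain ⟨E, hE⟩ : ∃ E, E = SMat.mul (Nat.add_zero 1) W u +
    SMat.mul (Nat.zero_add 1) P (SMat.d u) := ⟨_, rfl⟩
  have hPE : SMat.mul (Nat.zero_add 1) P E = E := by
    rw [hE, SMat.mul_add, ← SMat.mul_assoc (Nat.zero_add 1) (Nat.add_zero 1), hPW,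
      ← SMat.mul_assoc (Nat.zero_add 0) (Nat.zero_add 1), hPP]
  have hG : ∀ j, gaugeTransform X u.form D 1 (gaugeTransform X u.form D 0 (colForm (P.col j))) =
      colForm ((SMat.mul (Nat.zero_add 2) u.star (SMat.mul rfl W E +
        SMat.mul (Nat.zero_add 2) P (SMat.d E))).col j) := fun j => by
    simp only [gaugeTransform]
    rw [applyMat_form, SMat.app_col, huP, hW 0 u hPu, ← hE, adj_form, applyMat_form, SMat.app_col,
      applyMat_form, SMat.app_col, ← SMat.mul_assoc (Nat.zero_add 0) (Nat.zero_add 1), huu, hPE,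
      hW 1 E hPE, applyMat_form, SMat.app_col]
  have hmain : SMat.mul (Nat.add_zero 2) F u =
      SMat.mul rfl W E + SMat.mul (Nat.zero_add 2) P (SMat.d E) := by
    have e1 : of (SMat X N) 0 P * of (SMat X N) 1 W = of (SMat X N) 1 W := by
      rw [of_mul (Nat.zero_add 1), hPW]
    have e2 : of (SMat X N) 1 W = of (SMat X N) 1 W * of (SMat X N) 0 P +
        of (SMat X N) 0 P * dTotal X N (of (SMat X N) 0 P) := by
      rw [dTotal_of, of_mul (Nat.add_zero 1), of_mul (Nat.zero_add 1), ← _root_.map_add]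
      refine congrArg _ (SMat.form_injective ?_)
      funext i j
      exact congrFun ((hW0 j).symm.trans (hW 0 P hPP j)) i
    have e3 : of (SMat X N) 1 E = of (SMat X N) 1 W * of (SMat X N) 0 u +
        of (SMat X N) 0 P * dTotal X N (of (SMat X N) 0 u) := by
      rw [hE, dTotal_of, of_mul (Nat.add_zero 1), of_mul (Nat.zero_add 1), ← _root_.map_add]
    have e4 := dTotal_mul (X := X) (N := N) ⟨W, rfl⟩ (of (SMat X N) 0 u)
    have e5 := dTotal_mul (X := X) (N := N) ⟨P, rfl⟩ (dTotal X N (of (SMat X N) 0 u))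
    rw [dTotal_dTotal, mul_zero, smul_zero, add_zero] at e5
    rw [pow_one, neg_smul, one_smul] at e4
    refine of_injective (β := SMat X N) 2 ?_
    rw [_root_.map_add, ← of_mul (rfl : 1 + 1 = 2), ← of_mul (Nat.zero_add 2),
      ← of_mul (Nat.add_zero 2), ← dTotal_of, hF', _root_.map_add, ← of_mul (rfl : 1 + 1 = 2),
      ← of_mul (Nat.zero_add 2), ← dTotal_of, e3, _root_.map_add, e4, e5]
    generalize dTotal X N (of (SMat X N) 1 W) = dw at *
    generalize of (SMat X N) 1 W = w at *
    generalize dTotal X N (of (SMat X N) 0 P) = dp at *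
    generalize of (SMat X N) 0 P = p at *
    generalize dTotal X N (of (SMat X N) 0 u) = du at *
    generalize of (SMat X N) 0 u = v at *
    -- The terms in which u is differentiated cancel, by ω = ωp + p dp.
    have e6 : w * (p * du) + p * (dp * du) = p * w * du := by
      rw [e1]
      conv_rhs => rw [e2]
      noncomm_ring
    have e7 : w * (w * v + p * du) + p * (dw * v + -(w * du) + dp * du) =
        w * w * v + p * dw * v + (w * (p * du) + p * (dp * du)) - p * w * du := by
      noncomm_ring
    rw [e7, e6]
    noncomm_ring
  rw [hmain]
  funext i j
  exact (congrFun (hG j) i).symm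

end Connection

/-! ### The Hodge operator in an arbitrary basis -/

section Hodge

theorem append_update_left {p q r : ℕ} (h : p + q = r) (u : Fin p → E4) (v : Fin q → E4)
    (i : Fin p) (x : E4) :
    (fun k : Fin r => Fin.append (Function.update u i x) v (Fin.cast h.symm k)) =
      Function.update (fun k : Fin r => Fin.append u v (Fin.cast h.symm k)) (leftPos h i) x := by
  funext k
  rcases pos_cases h k with ⟨l, rfl⟩ | ⟨j, rfl⟩
  · by_cases hl : l = i
    · subst hl
      simp [leftPos]
    · rw [Function.update_of_ne (fun e => hl (leftPos_injective h e))]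
      simp [leftPos, hl]
  · rw [Function.update_of_ne (leftPos_ne_rightPos h i j).symm]
    simp [rightPos]

/-- `u ↦ μ(u₁,…,u_p,v₁,…,v_q)`. -/
def insertLast {p q : ℕ} (h : p + q = 4) (μ : Cov 4) (v : Fin q → E4) :
    MultilinearMap ℝ (fun _ : Fin p => E4) ℂ where
  toFun u := insertFirst h μ u v
  map_update_add' := by
    intro inst u k x y
    obtain rfl : inst = instDecidableEqFin p := Subsingleton.elim _ _
    have e := append_update_left h u v k
    exact (congrArg μ (e (x + y))).trans ((μ.map_update_add _ _ _ _).trans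
      (congrArg₂ (· + ·) (congrArg μ (e x)).symm (congrArg μ (e y)).symm))
  map_update_smul' := by
    intro inst u k c x
    obtain rfl : inst = instDecidableEqFin p := Subsingleton.elim _ _
    have e := append_update_left h u v k
    exact (congrArg μ (e (c • x))).trans ((μ.map_update_smul _ _ _ _).trans
      (congrArg (c • ·) (congrArg μ (e x)).symm))

theorem insertFirst_apply {p q : ℕ} (h : p + q = 4) (μ : Cov 4) (u : Fin p → E4)
    (v : Fin q → E4) : insertFirst h μ u v = μ fun k => Fin.append u v (Fin.cast h.symm k) := rfl

theorem multilinear_expand {k : ℕ} (f : MultilinearMap ℝ (fun _ : Fin k => E4) ℂ)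
    (v : Fin k → E4) :
    f v = ∑ j : Fin k → Fin 4, ((∏ l, v l (j l) : ℝ) : ℂ) * f (stdVec ∘ j) := by
  conv_lhs => rw [show v = fun l => ∑ j, v l j • stdVec j from funext fun l => E4_expand (v l)]
  refine (f.map_sum (fun (l : Fin k) (j : Fin 4) => v l j • stdVec j)).trans
    (Finset.sum_congr rfl fun j _ => ?_)
  refine (f.map_smul_univ (fun l => v l (j l)) (fun l => stdVec (j l))).trans ?_
  rw [Complex.real_smul]
  rfl

/-- Here `I` will be a set of multi-indices, `K` a product of inverse Gram entries in the new basis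
and `P` a product of entries of the transition matrix. -/
theorem sum_change_of_basis {I : Type*} [Fintype I] (K P : I → I → ℂ) (a m : I → ℂ) :
    ∑ i, ∑ j, (∑ c, ∑ d, K c d * P i c * P j d) * a i * m j =
      ∑ c, ∑ d, K c d * (∑ i, P i c * a i) * ∑ j, P j d * m j := by
  calc _ = ∑ ij : I × I, ∑ cd : I × I,
        K cd.1 cd.2 * P ij.1 cd.1 * P ij.2 cd.2 * a ij.1 * m ij.2 := by
        simp only [Fintype.sum_prod_type, Finset.sum_mul]
    _ = ∑ cd : I × I, ∑ ij : I × I,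
        K cd.1 cd.2 * P ij.1 cd.1 * P ij.2 cd.2 * a ij.1 * m ij.2 := Finset.sum_comm
    _ = _ := by
        simp only [Fintype.sum_prod_type, Finset.mul_sum, Finset.sum_mul]
        refine Finset.sum_congr rfl fun c _ => Finset.sum_congr rfl fun d _ => ?_
        rw [Finset.sum_comm]
        exact Finset.sum_congr rfl fun j _ => Finset.sum_congr rfl fun i _ => by ring

variable {M : Type*} [TopologicalSpace M] [ChartedSpace E4 M] [IsManifold (𝓡 4) ∞ M]

/-- The metric at a point, as a bilinear map on the model space. -/
def metricAt (g : Metric4 M) (x : M) : E4 →L[ℝ] E4 →L[ℝ] ℝ := g.inner x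

theorem gram_comb (g : Metric4 M) (x : M) (v : Fin 4 → E4) (B : Matrix (Fin 4) (Fin 4) ℝ) :
    gram g x (fun a => ∑ i, B i a • v i) = B.transpose * gram g x v * B := by
  ext a b
  have h : gram g x (fun a => ∑ i, B i a • v i) a b =
      metricAt g x (∑ i, B i a • v i) (∑ i, B i b • v i) := rfl
  rw [h]
  simp only [_root_.map_sum, map_smul, _root_.sum_apply, Matrix.mul_apply,
    Matrix.transpose_apply, Finset.sum_mul, Finset.mul_sum, _root_.smul_apply, smul_eq_mul]
  refine Finset.sum_congr rfl fun i _ => Finset.sum_congr rfl fun j _ => ?_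
  change B i b * (B j a * metricAt g x (v j) (v i)) = B j a * metricAt g x (v j) (v i) * B i b
  ring

theorem gram_eq_coord (g : Metric4 M) (x : M) (b : Fin 4 → E4) :
    gram g x b = (Matrix.of fun i a => b a i).transpose * gram g x stdVec *
      Matrix.of fun i a => b a i := by
  rw [← gram_comb]
  congr 1
  funext a
  exact E4_expand (b a)

variable {n : ℕ} (X : ToricData M n)

/-- The Hodge operator in an arbitrary basis. -/
theorem hodge_basis {p q : ℕ} (h : p + q = 4) (α : Form M p) (x : M) {b : Fin 4 → E4}
    (hb : (gram X.metric x b).det ≠ 0) (w : Fin q → E4) :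
    hodge X h α x w = ((p.factorial : ℕ) : ℂ)⁻¹ * ∑ i : Fin p → Fin 4, ∑ j : Fin p → Fin 4,
      ((∏ k, (gram X.metric x b)⁻¹ (i k) (j k) : ℝ) : ℂ) * α x (b ∘ i) *
        insertFirst h (X.vol x) (b ∘ j) w := by
  set B : Matrix (Fin 4) (Fin 4) ℝ := Matrix.of fun i a => b a i with hB
  set H := (gram X.metric x b)⁻¹ with hH
  -- The inverse Gram matrix is a contravariant tensor; its transition matrices turn the standard
  -- vectors in `α` and in the volume form into the vectors of `b`.
  have hG : (gram X.metric x stdVec)⁻¹ = B * H * B.transpose := by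
    have h1 := gram_eq_coord X.metric x b
    rw [← hB] at h1
    have h2 : H * (B.transpose * gram X.metric x stdVec) * B = 1 := by
      rw [mul_assoc, ← h1, hH, Matrix.nonsing_inv_mul _ (isUnit_iff_ne_zero.2 hb)]
    have h3 := mul_eq_one_comm.1 h2
    exact Matrix.inv_eq_left_inv (by rw [← h3]; simp only [mul_assoc])
  have hα : ∀ c : Fin p → Fin 4, α x (b ∘ c) =
      ∑ i : Fin p → Fin 4, ((∏ l, B (i l) (c l) : ℝ) : ℂ) * α x (stdVec ∘ i) := fun c =>
    cov_expand _ _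
  have hμ : ∀ c : Fin p → Fin 4, insertFirst h (X.vol x) (b ∘ c) w =
      ∑ i : Fin p → Fin 4, ((∏ l, B (i l) (c l) : ℝ) : ℂ) *
        insertFirst h (X.vol x) (stdVec ∘ i) w := fun c =>
    multilinear_expand (insertLast h (X.vol x) w) _
  have hprod : ∀ i j : Fin p → Fin 4, (∏ k, (gram X.metric x stdVec)⁻¹ (i k) (j k)) =
      ∑ c : Fin p → Fin 4, ∑ d : Fin p → Fin 4,
        (∏ k, H (c k) (d k)) * (∏ k, B (i k) (c k)) * ∏ k, B (j k) (d k) := fun i j => by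
    rw [hG]
    have h1 : ∀ k, (B * H * B.transpose) (i k) (j k) =
        ∑ c, ∑ d, H c d * B (i k) c * B (j k) d := fun k => by
      simp only [Matrix.mul_apply, Matrix.transpose_apply, Finset.sum_mul]
      rw [Finset.sum_comm]
      exact Finset.sum_congr rfl fun _ _ => Finset.sum_congr rfl fun _ _ => by ring
    simp only [h1, Fintype.prod_sum, Finset.prod_mul_distrib]
  have hL : hodge X h α x w = ((p.factorial : ℕ) : ℂ)⁻¹ * ∑ i : Fin p → Fin 4,
      ∑ j : Fin p → Fin 4, ((∏ k, (gram X.metric x stdVec)⁻¹ (i k) (j k) : ℝ) : ℂ) *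
        α x (stdVec ∘ i) * insertFirst h (X.vol x) (stdVec ∘ j) w := by
    simp only [hodge, ContinuousAlternatingMap.smul_apply, ContinuousAlternatingMap.sum_apply,
      smul_eq_mul]
  rw [hL]
  congr 1
  simp only [hprod, hα, hμ]
  simp only [Complex.ofReal_sum, Complex.ofReal_mul]
  exact sum_change_of_basis _ _ _ _

end Hodge

/-! ### Orthonormal frames and the Hodge operator on two-forms -/

section Frames

variable {M : Type*} [TopologicalSpace M] [ChartedSpace E4 M] [IsManifold (𝓡 4) ∞ M]

/-- Orthonormal frames of the tangent space at `x`. -/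
def IsFrame (g : Metric4 M) (x : M) (e : Fin 4 → E4) : Prop := gram g x e = 1

variable {g : Metric4 M} {x : M} {e : Fin 4 → E4}

theorem gram_stdVec_posDef (g : Metric4 M) (x : M) : (gram g x stdVec).PosDef := by
  refine Matrix.PosDef.of_dotProduct_mulVec_pos ?_ fun v hv => ?_
  · ext i j
    exact g.symm x _ _
  · have h : star v ⬝ᵥ (gram g x stdVec).mulVec v =
        metricAt g x (∑ i, v i • stdVec i) (∑ i, v i • stdVec i) := by
      simp only [_root_.map_sum, map_smul, _root_.sum_apply, _root_.smul_apply, smul_eq_mul,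
        dotProduct, Matrix.mulVec, Finset.mul_sum, star_trivial]
      rw [Finset.sum_comm]
      refine Finset.sum_congr rfl fun i _ => Finset.sum_congr rfl fun j _ => ?_
      change v j * (metricAt g x (stdVec j) (stdVec i) * v i) = _
      ring
    rw [h]
    refine g.pos x _ fun h0 => hv ?_
    funext i
    have := congrFun (congrArg (fun w : E4 => (w : Fin 4 → ℝ)) ((E4_expand (WithLp.toLp 2 v)).trans h0)) i
    exact this

open scoped MatrixOrder in
-- If the Gram matrix is CᵀC, the columns of C⁻¹ are the coordinates of an orthonormal frame.
theorem exists_frame (g : Metric4 M) (x : M) : ∃ e, IsFrame g x e := by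
  obtain ⟨C, hC⟩ : ∃ C : Matrix (Fin 4) (Fin 4) ℝ, gram g x stdVec = C.transpose * C := by
    obtain ⟨C, hC⟩ := CStarAlgebra.nonneg_iff_eq_star_mul_self.mp
      (gram_stdVec_posDef g x).posSemidef.nonneg
    exact ⟨C, hC⟩
  have hdet : IsUnit C.det := by
    have h := (gram_stdVec_posDef g x).det_pos
    rw [hC, Matrix.det_mul, Matrix.det_transpose] at h
    exact isUnit_iff_ne_zero.2 fun h0 => by simp [h0] at h
  refine ⟨fun a => ∑ i, C⁻¹ i a • stdVec i, ?_⟩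
  rw [IsFrame, gram_comb, hC, Matrix.transpose_nonsing_inv]
  calc _ = (C.transpose⁻¹ * C.transpose) * (C * C⁻¹) := by simp only [mul_assoc]
    _ = 1 := by
      rw [Matrix.nonsing_inv_mul _ (by rwa [Matrix.det_transpose]), Matrix.mul_nonsing_inv _ hdet,
        one_mul]

theorem IsFrame.inner_eq (he : IsFrame g x e) (i j : Fin 4) :
    metricAt g x (e i) (e j) = if i = j then 1 else 0 := by
  rw [← Matrix.one_apply, ← he]
  rfl

theorem IsFrame.comp_perm (he : IsFrame g x e) (σ : Equiv.Perm (Fin 4)) :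
    IsFrame g x (e ∘ σ) := by
  ext i j
  have := he.inner_eq (σ i) (σ j)
  simp only [EmbeddingLike.apply_eq_iff_eq] at this
  rw [Matrix.one_apply, ← this]
  rfl

theorem IsFrame.linearIndependent (he : IsFrame g x e) : LinearIndependent ℝ e := by
  rw [Fintype.linearIndependent_iff]
  intro c hc j
  have h := congrArg (fun w => metricAt g x w (e j)) hc
  simpa [he.inner_eq] using h

/-- An orthonormal frame as a basis. -/
def IsFrame.basis (he : IsFrame g x e) : Module.Basis (Fin 4) ℝ E4 :=
  basisOfLinearIndependentOfCardEqFinrank he.linearIndependent (by simp)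

theorem IsFrame.coe_basis (he : IsFrame g x e) : ⇑he.basis = e :=
  coe_basisOfLinearIndependentOfCardEqFinrank _ _

theorem IsFrame.ext (he : IsFrame g x e) {k : ℕ} {α β : Cov k}
    (h : ∀ v : Fin k → Fin 4, Function.Injective v → α (e ∘ v) = β (e ∘ v)) : α = β := by
  refine ContinuousAlternatingMap.toAlternatingMap_injective
    (he.basis.ext_alternating fun v hv => ?_)
  rw [he.coe_basis]
  exact h v hv

variable {n : ℕ} {X : ToricData M n}

theorem IsFrame.vol_sq (he : IsFrame X.metric x e) : X.vol x e * X.vol x e = 1 := by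
  rw [← pow_two, X.vol_sq, he, Matrix.det_one, Complex.ofReal_one]

theorem IsFrame.hodge_eq (he : IsFrame X.metric x e) {p q : ℕ} (h : p + q = 4) (α : Form M p)
    (w : Fin q → E4) :
    hodge X h α x w = ((p.factorial : ℕ) : ℂ)⁻¹ * ∑ c : Fin p → Fin 4,
      α x (e ∘ c) * insertFirst h (X.vol x) (e ∘ c) w := by
  have hd : (gram X.metric x e).det ≠ 0 := by rw [he, Matrix.det_one]; exact one_ne_zero
  rw [hodge_basis X h α x hd, he, inv_one]
  congr 1
  refine Finset.sum_congr rfl fun i _ => ?_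
  rw [Finset.sum_eq_single i]
  · simp
  · intro j _ hj
    obtain ⟨k, hk⟩ := Function.ne_iff.1 hj
    have h0 : ∏ k, (1 : Matrix (Fin 4) (Fin 4) ℝ) (i k) (j k) = 0 :=
      Finset.prod_eq_zero (Finset.mem_univ k) (Matrix.one_apply_ne hk.symm)
    rw [h0, Complex.ofReal_zero, zero_mul, zero_mul]
  · simp

/-- Only the 4! index tuples that are permutations contribute, and equally, since the sign occurs in
both factors; this cancels 1/4!. -/
theorem IsFrame.hodge_top (he : IsFrame X.metric x e) (ω' : Form M 4) :
    hodge X (show 4 + 0 = 4 from rfl) ω' x ![] = ω' x e * X.vol x e := by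
  rw [he.hodge_eq]
  have h1 : ∑ σ : Equiv.Perm (Fin 4), ω' x e * X.vol x e = ∑ c : Fin 4 → Fin 4,
      ω' x (e ∘ c) * insertFirst (show 4 + 0 = 4 from rfl) (X.vol x) (e ∘ c) ![] := by
    refine Fintype.sum_of_injective (fun σ : Equiv.Perm (Fin 4) => (σ : Fin 4 → Fin 4))
      DFunLike.coe_injective _ _ (fun c hc => ?_) fun σ => ?_
    · have hinj : ¬ Function.Injective (e ∘ c) := fun hi => hc
        ⟨Equiv.ofBijective c (Finite.injective_iff_bijective.1 hi.of_comp), rfl⟩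
      rw [(ω' x).map_eq_zero_of_not_injective _ hinj, zero_mul]
    · have h2 := (ω' x).toAlternatingMap.map_perm e σ
      have h3 := (X.vol x).toAlternatingMap.map_perm e σ
      simp only [ContinuousAlternatingMap.coe_toAlternatingMap] at h2 h3
      have h4 : insertFirst (show 4 + 0 = 4 from rfl) (X.vol x) (e ∘ σ) ![] =
          X.vol x (e ∘ σ) := by
        rw [insertFirst_apply]
        congr 1
        funext k
        exact Fin.append_left (e ∘ σ) ![] k
      rw [h4, h2, h3, Units.smul_def, Units.smul_def, zsmul_eq_mul, zsmul_eq_mul]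
      linear_combination (-(ω' x e * X.vol x e)) * sign_sq σ
  rw [← h1]
  have h24 : ((Nat.factorial 4 : ℕ) : ℂ) ≠ 0 := Nat.cast_ne_zero.2 (Nat.factorial_ne_zero 4)
  simp only [Finset.sum_const, Finset.card_univ, Fintype.card_perm, Fintype.card_fin, nsmul_eq_mul]
  rw [inv_mul_cancel_left₀ h24]

theorem cov_two_swap (α : Cov 2) (a b : E4) : α ![b, a] = -α ![a, b] := by
  have h := α.toAlternatingMap.map_swap ![a, b] (show (0 : Fin 2) ≠ 1 by decide)
  rw [← ContinuousAlternatingMap.coe_toAlternatingMap, ← h]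
  congr 1
  funext i
  fin_cases i <;> rfl

theorem insertFirst_two (μ : Cov 4) (u v : Fin 2 → E4) :
    insertFirst (show 2 + 2 = 4 from rfl) μ u v = μ ![u 0, u 1, v 0, v 1] := by
  rw [insertFirst_apply]
  congr 1
  funext k
  fin_cases k <;> rfl

theorem cov_four_zero (μ : Cov 4) {v : Fin 4 → E4} {i j : Fin 4} (hij : i ≠ j) (h : v i = v j) :
    μ v = 0 := μ.map_eq_zero_of_eq v h hij

/-- Only the index pairs (0,1) and (1,0) avoid repeating e₂ or e₃ in the volume form. Their equal
contributions cancel the factor 1/2. -/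
theorem IsFrame.hodge_two (he : IsFrame X.metric x e) (α : Form M 2) :
    hodge X (show 2 + 2 = 4 from rfl) α x ![e 2, e 3] = X.vol x e * α x ![e 0, e 1] := by
  rw [he.hodge_eq, Fintype.sum_equiv (finTwoArrowEquiv (Fin 4)) _
    (fun c : Fin 4 × Fin 4 => α x ![e c.1, e c.2] * X.vol x ![e c.1, e c.2, e 2, e 3])
    (fun c => by
      rw [insertFirst_two]
      congr 2
      funext i
      fin_cases i <;> rfl)]
  have hz1 : ∀ a : Fin 4, ∀ b : Fin 4, a = 2 → X.vol x ![e a, e b, e 2, e 3] = 0 :=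
    fun a b h => cov_four_zero _ (show (0 : Fin 4) ≠ 2 by decide) (by simp [h])
  have hz2 : ∀ a : Fin 4, ∀ b : Fin 4, a = 3 → X.vol x ![e a, e b, e 2, e 3] = 0 :=
    fun a b h => cov_four_zero _ (show (0 : Fin 4) ≠ 3 by decide) (by simp [h])
  have hz3 : ∀ a : Fin 4, ∀ b : Fin 4, b = 2 → X.vol x ![e a, e b, e 2, e 3] = 0 :=
    fun a b h => cov_four_zero _ (show (1 : Fin 4) ≠ 2 by decide) (by simp [h])
  have hz4 : ∀ a : Fin 4, ∀ b : Fin 4, b = 3 → X.vol x ![e a, e b, e 2, e 3] = 0 :=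
    fun a b h => cov_four_zero _ (show (1 : Fin 4) ≠ 3 by decide) (by simp [h])
  have hz5 : ∀ a : Fin 4, X.vol x ![e a, e a, e 2, e 3] = 0 :=
    fun a => cov_four_zero _ (show (0 : Fin 4) ≠ 1 by decide) rfl
  have h01 : X.vol x ![e 0, e 1, e 2, e 3] = X.vol x e := by
    congr 1
    funext i
    fin_cases i <;> rfl
  have h10 : X.vol x ![e 1, e 0, e 2, e 3] = -X.vol x e := by
    have h := (X.vol x).toAlternatingMap.map_swap e (show (0 : Fin 4) ≠ 1 by decide)
    rw [← ContinuousAlternatingMap.coe_toAlternatingMap, ← h]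
    congr 1
    funext i
    fin_cases i <;> rfl
  simp only [Fintype.sum_prod_type, Fin.sum_univ_four, hz1 2 _ rfl, hz2 3 _ rfl, hz3 _ 2 rfl,
    hz4 _ 3 rfl, hz5, h01, h10, cov_two_swap (α x) (e 0) (e 1)]
  norm_num
  ring

theorem exists_perm_two (a b : Fin 4) (h : a ≠ b) :
    ∃ σ : Equiv.Perm (Fin 4), σ 2 = a ∧ σ 3 = b := by
  revert a b
  decide

/-- The square of the Hodge operator on two-forms. -/
theorem hodge_hodge (α : Form M 2) :
    hodge X (show 2 + 2 = 4 from rfl) (hodge X (show 2 + 2 = 4 from rfl) α) = α := by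
  funext x
  obtain ⟨e, he⟩ := exists_frame X.metric x
  refine he.ext fun v hv => ?_
  obtain ⟨σ, h2, h3⟩ := exists_perm_two (v 0) (v 1) (fun h => absurd (hv h) (by decide))
  have hf := he.comp_perm σ
  -- Exchanging the two halves of the frame is an even permutation, so both applications of * carry
  -- the same value of the volume form, whose square is 1.
  let τ : Equiv.Perm (Fin 4) := Equiv.swap 0 2 * Equiv.swap 1 3
  have hf' := hf.comp_perm τ
  have e1 := hf.hodge_two (hodge X (show 2 + 2 = 4 from rfl) α)
  have e2 := hf'.hodge_two α
  have hvol : X.vol x ((e ∘ σ) ∘ τ) = X.vol x (e ∘ σ) := by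
    have h := (X.vol x).toAlternatingMap.map_perm (e ∘ σ) τ
    have hs : Equiv.Perm.sign τ = 1 := by decide
    rw [hs, one_smul] at h
    exact h
  have t0 : τ 0 = 2 := by decide
  have t1 : τ 1 = 3 := by decide
  have t2 : τ 2 = 0 := by decide
  have t3 : τ 3 = 1 := by decide
  rw [hvol] at e2
  simp only [Function.comp_apply, t0, t1, t2, t3, h2, h3] at e1 e2
  have hev : e ∘ v = ![e (v 0), e (v 1)] := by
    funext i
    fin_cases i <;> rfl
  rw [hev, e1, e2, ← mul_assoc, hf.vol_sq, one_mul]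

/-- The perms that preserve the first two of four positions. -/
theorem perm_four_blocks (σ : Equiv.Perm (Fin 4)) (h2 : 2 ≤ σ 2) (h3 : 2 ≤ σ 3) :
    σ = 1 ∨ σ = Equiv.swap 0 1 ∨ σ = Equiv.swap 2 3 ∨ σ = Equiv.swap 0 1 * Equiv.swap 2 3 := by
  revert σ
  decide

theorem wedge_two_apply (α β : Cov 2) (v : Fin 4 → E4) :
    wedge (show 2 + 2 = 4 from rfl) α β v = (4 : ℂ)⁻¹ * ∑ σ : Equiv.Perm (Fin 4),
      ((Equiv.Perm.sign σ : ℤ) : ℂ) *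
        (α ![v (σ 0), v (σ 1)] * β ![v (σ 2), v (σ 3)]) := by
  rw [wedge_apply, alt]
  norm_num
  refine Finset.sum_congr rfl fun σ _ => ?_
  rw [jux]
  congr 3
  · funext i
    fin_cases i <;> rfl
  · funext i
    fin_cases i <;> rfl

/-- A permutation that sends one of the first two vectors into the volume form repeats an argument.
The four others preserve both blocks and contribute equally, which cancels 1/4. -/
theorem wedge_insertFirst_apply (α : Cov 2) (μ : Cov 4) (v : Fin 4 → E4) :
    wedge (show 2 + 2 = 4 from rfl) α
      (insertFirst (show 2 + 2 = 4 from rfl) μ ![v 0, v 1]) v = α ![v 0, v 1] * μ v := by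
  rw [wedge_two_apply]
  have hz : ∀ a b : Fin 4, a < 2 ∨ b < 2 → μ ![v 0, v 1, v a, v b] = 0 := by
    intro a b h
    have h' : a = 0 ∨ a = 1 ∨ b = 0 ∨ b = 1 := by omega
    rcases h' with rfl | rfl | rfl | rfl
    · exact cov_four_zero _ (show (0 : Fin 4) ≠ 2 by decide) rfl
    · exact cov_four_zero _ (show (1 : Fin 4) ≠ 2 by decide) rfl
    · exact cov_four_zero _ (show (0 : Fin 4) ≠ 3 by decide) rfl
    · exact cov_four_zero _ (show (1 : Fin 4) ≠ 3 by decide) rfl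
  have h23 : μ ![v 0, v 1, v 2, v 3] = μ v := by
    congr 1
    funext i
    fin_cases i <;> rfl
  have h32 : μ ![v 0, v 1, v 3, v 2] = -μ v := by
    have h := μ.toAlternatingMap.map_swap v (show (2 : Fin 4) ≠ 3 by decide)
    rw [← ContinuousAlternatingMap.coe_toAlternatingMap, ← h]
    congr 1
    funext i
    fin_cases i <;> rfl
  rw [← Finset.sum_subset (Finset.subset_univ ({1, Equiv.swap 0 1, Equiv.swap 2 3,
    Equiv.swap 0 1 * Equiv.swap 2 3} : Finset (Equiv.Perm (Fin 4))))]
  · rw [Finset.sum_insert (by decide), Finset.sum_insert (by decide),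
      Finset.sum_insert (by decide), Finset.sum_singleton]
    have s1 : Equiv.Perm.sign (1 : Equiv.Perm (Fin 4)) = 1 := by decide
    have s2 : Equiv.Perm.sign (Equiv.swap 0 1 : Equiv.Perm (Fin 4)) = -1 := by decide
    have s3 : Equiv.Perm.sign (Equiv.swap 2 3 : Equiv.Perm (Fin 4)) = -1 := by decide
    have s4 : Equiv.Perm.sign (Equiv.swap 0 1 * Equiv.swap 2 3 : Equiv.Perm (Fin 4)) = 1 := by
      decide
    have a0 : (Equiv.swap 0 1 : Equiv.Perm (Fin 4)) 0 = 1 := by decide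
    have a1 : (Equiv.swap 0 1 : Equiv.Perm (Fin 4)) 1 = 0 := by decide
    have a2 : (Equiv.swap 0 1 : Equiv.Perm (Fin 4)) 2 = 2 := by decide
    have a3 : (Equiv.swap 0 1 : Equiv.Perm (Fin 4)) 3 = 3 := by decide
    have b0 : (Equiv.swap 2 3 : Equiv.Perm (Fin 4)) 0 = 0 := by decide
    have b1 : (Equiv.swap 2 3 : Equiv.Perm (Fin 4)) 1 = 1 := by decide
    have b2 : (Equiv.swap 2 3 : Equiv.Perm (Fin 4)) 2 = 3 := by decide
    have b3 : (Equiv.swap 2 3 : Equiv.Perm (Fin 4)) 3 = 2 := by decide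
    simp only [s1, s2, s3, s4, a0, a1, a2, a3, b0, b1, b2, b3, Equiv.Perm.mul_apply,
      Equiv.Perm.one_apply, insertFirst_two, Matrix.cons_val_zero, Matrix.cons_val_one, h23, h32,
      cov_two_swap α (v 0) (v 1)]
    push_cast
    ring
  · intro σ _ hσ
    rw [insertFirst_two]
    have h : σ 2 < 2 ∨ σ 3 < 2 := by
      by_contra! h
      have := perm_four_blocks σ h.1 h.2
      simp only [Finset.mem_insert, Finset.mem_singleton] at hσ
      exact hσ this
    have := hz _ _ h
    simp only [Matrix.cons_val_zero, Matrix.cons_val_one]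
    rw [this, mul_zero, mul_zero]

/-- `α ∧ *β = ⟨α, β⟩ vol` for two-forms. -/
theorem IsFrame.hodge_wedge_hodge (he : IsFrame X.metric x e) (α β : Form M 2) :
    hodge X (show 4 + 0 = 4 from rfl) (fun y => wedge (show 2 + 2 = 4 from rfl) (α y)
      (hodge X (show 2 + 2 = 4 from rfl) β y)) x ![] =
      (2 : ℂ)⁻¹ * ∑ c : Fin 2 → Fin 4, α x (e ∘ c) * β x (e ∘ c) := by
  have h1 : hodge X (show 2 + 2 = 4 from rfl) β x = ∑ c : Fin 2 → Fin 4,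
      ((2 : ℂ)⁻¹ * β x (e ∘ c)) • insertFirst (show 2 + 2 = 4 from rfl) (X.vol x) (e ∘ c) := by
    ext w
    rw [he.hodge_eq]
    simp only [ContinuousAlternatingMap.sum_apply, ContinuousAlternatingMap.smul_apply,
      smul_eq_mul, Finset.mul_sum]
    norm_num [mul_assoc]
  have h2 : ∀ c : Fin 2 → Fin 4, wedge (show 2 + 2 = 4 from rfl) (α x)
      (insertFirst (show 2 + 2 = 4 from rfl) (X.vol x) (e ∘ c)) e =
        α x (e ∘ c) * X.vol x e := by
    intro c
    by_cases hc : c 0 = c 1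
    · have z1 : α x (e ∘ c) = 0 :=
        (α x).map_eq_zero_of_eq _ (congrArg e hc) (show (0 : Fin 2) ≠ 1 by decide)
      have z2 : insertFirst (show 2 + 2 = 4 from rfl) (X.vol x) (e ∘ c) = 0 := by
        ext w
        rw [insertFirst_two]
        exact cov_four_zero _ (show (0 : Fin 4) ≠ 1 by decide) (congrArg e hc)
      rw [z1, z2, zero_mul]
      exact congrArg (fun w : Cov 4 => w e)
        (wedgeR (show 2 + 2 = 4 from rfl) (α x)).map_zero
    -- Distinct indices extend to a reordering of the frame; its sign appears on both sides of the
    -- identity.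
    · obtain ⟨σ, h0, h1⟩ : ∃ σ : Equiv.Perm (Fin 4), σ 0 = c 0 ∧ σ 1 = c 1 := by
        revert hc
        generalize c 0 = a
        generalize c 1 = b
        revert a b
        decide
      have h := wedge_insertFirst_apply (α x) (X.vol x) (e ∘ σ)
      have hc' : e ∘ c = ![(e ∘ σ) 0, (e ∘ σ) 1] := by
        funext i
        fin_cases i
        · exact congrArg e h0.symm
        · exact congrArg e h1.symm
      rw [← hc'] at h
      have h3 := (X.vol x).toAlternatingMap.map_perm e σ
      have h4 := (wedge (show 2 + 2 = 4 from rfl) (α x)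
        (insertFirst (show 2 + 2 = 4 from rfl) (X.vol x) (e ∘ c))).toAlternatingMap.map_perm e σ
      simp only [ContinuousAlternatingMap.coe_toAlternatingMap] at h3 h4
      rw [h3, h4, Units.smul_def, Units.smul_def, zsmul_eq_mul, zsmul_eq_mul] at h
      have h5 := congrArg (fun z => ((Equiv.Perm.sign σ : ℤ) : ℂ) * z) h
      rw [← mul_assoc, sign_sq, one_mul] at h5
      rw [h5]
      linear_combination (α x (e ∘ c) * X.vol x e) * sign_sq σ
  rw [he.hodge_top]
  simp only [h1]
  have h3 : wedge (show 2 + 2 = 4 from rfl) (α x) (∑ c : Fin 2 → Fin 4,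
      ((2 : ℂ)⁻¹ * β x (e ∘ c)) • insertFirst (show 2 + 2 = 4 from rfl) (X.vol x) (e ∘ c)) =
      ∑ c : Fin 2 → Fin 4, ((2 : ℂ)⁻¹ * β x (e ∘ c)) • wedge (show 2 + 2 = 4 from rfl) (α x)
        (insertFirst (show 2 + 2 = 4 from rfl) (X.vol x) (e ∘ c)) := by
    rw [← wedgeR_apply, _root_.map_sum]
    exact Finset.sum_congr rfl fun c _ => wedge_smul_right _ _ _ _
  rw [h3]
  simp only [ContinuousAlternatingMap.sum_apply, ContinuousAlternatingMap.smul_apply,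
    smul_eq_mul, h2, Finset.mul_sum, Finset.sum_mul]
  refine Finset.sum_congr rfl fun c _ => ?_
  linear_combination ((2 : ℂ)⁻¹ * β x (e ∘ c) * α x (e ∘ c)) * he.vol_sq

end Frames

/-! ### Smoothness of the metric coefficients -/

section ChartGram

open Bundle

variable {M : Type*} [TopologicalSpace M] [ChartedSpace E4 M] [IsManifold (𝓡 4) ∞ M]

/-- A coordinate vector field is the image of a constant field under the tangent map of the inverse
chart. -/
theorem contMDiffOn_chartFrame (c : M) (v : E4) :
    ContMDiffOn (𝓡 4) (𝓡 4).tangent ∞ (fun y : E4 =>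
      (⟨(chartAt E4 c).symm y, chartSymmDeriv c y v⟩ : TangentBundle (𝓡 4) M))
      (chartAt E4 c).target := by
  have ho : IsOpen (chartAt E4 c).target := (chartAt E4 c).open_target
  have h1 := (contMDiffOn_chart_symm (I := 𝓡 4) (n := ∞) (x := c)).contMDiffOn_tangentMapWithin
    (m := ∞) (by simp) ho.uniqueMDiffOn
  have h2 : ContMDiff (𝓡 4) (𝓡 4).tangent ∞ (fun y : E4 => (⟨y, v⟩ : TangentBundle (𝓡 4) E4)) := by
    exact (contMDiff_vectorSpace_iff_contDiff (𝕜 := ℝ) (E := E4) (V := fun _ => v)).2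
      contDiff_const
  refine (h1.comp h2.contMDiffOn (fun y hy => hy)).congr fun y hy => ?_
  simp only [Function.comp_apply, tangentMapWithin, mfderivWithin_of_isOpen ho hy]
  rfl

theorem contDiffOn_chartGram (g : Metric4 M) (c : M) (i j : Fin 4) :
    ContDiffOn ℝ ∞ (fun y => gram g ((chartAt E4 c).symm y)
      (fun k => chartSymmDeriv c y (stdVec k)) i j) (chartAt E4 c).target := by
  rw [← contMDiffOn_iff_contDiffOn]
  have h : ContMDiffOn (𝓡 4) ((𝓡 4).prod 𝓘(ℝ)) ∞ (fun y : E4 =>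
      TotalSpace.mk' ℝ (E := Bundle.Trivial M ℝ) ((chartAt E4 c).symm y)
        (g.inner ((chartAt E4 c).symm y) (chartSymmDeriv c y (stdVec i))
          (chartSymmDeriv c y (stdVec j)))) (chartAt E4 c).target := by
    refine ContMDiffOn.clm_bundle_apply₂ (F₁ := E4) (F₂ := E4) ?_ (contMDiffOn_chartFrame c _)
      (contMDiffOn_chartFrame c _)
    exact g.contMDiff.comp_contMDiffOn contMDiffOn_chart_symm
  intro y hy
  have := h y hy
  simp only [contMDiffWithinAt_totalSpace] at this
  exact this.2

end ChartGram

/-! ### The Hodge operator on smooth forms: smoothness, invariance, linearity -/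

section HodgeSmooth

variable {M : Type*} [TopologicalSpace M] [ChartedSpace E4 M] [IsManifold (𝓡 4) ∞ M]

/-- Serves twice: for the positivity of the coordinate Gram determinant and for the Jacobian in the
change of variables. -/
theorem gram_det_comp (g : Metric4 M) (x : M) (L A : E4 →L[ℝ] E4) :
    (gram g x fun i => L (A (stdVec i))).det =
      A.det ^ 2 * (gram g x fun i => L (stdVec i)).det := by
  let b := (EuclideanSpace.basisFun (Fin 4) ℝ).toBasis
  let B : Matrix (Fin 4) (Fin 4) ℝ := LinearMap.toMatrix b b (A : E4 →ₗ[ℝ] E4)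
  have hB : ∀ i a, B i a = A (stdVec a) i := fun i a => by
    simp [B, b, LinearMap.toMatrix_apply, stdVec]
  have h1 : (fun a => L (A (stdVec a))) = fun a => ∑ i, B i a • L (stdVec i) := by
    funext a
    conv_lhs => rw [E4_expand (A (stdVec a))]
    simp only [_root_.map_sum, map_smul, hB]
  have h2 : B.det = A.det := LinearMap.det_toMatrix b _
  rw [h1, gram_comb, Matrix.det_mul, Matrix.det_mul, Matrix.det_transpose, h2]
  ring

theorem chartSymmDeriv_det_ne_zero (c : M) {y : E4} (hy : y ∈ (chartAt E4 c).target) :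
    (chartSymmDeriv c y).det ≠ 0 := by
  have h := congrArg ContinuousLinearMap.det (chartDeriv_comp_chartSymmDeriv c hy)
  intro h0
  have h1 : (chartDeriv c ((chartAt E4 c).symm y)).det * (chartSymmDeriv c y).det = 1 := by
    rw [ContinuousLinearMap.det, ContinuousLinearMap.det, ← LinearMap.det_comp]
    refine h.trans ?_
    exact LinearMap.det_id
  rw [h0, mul_zero] at h1
  exact zero_ne_one h1

theorem chartGram_det_pos (g : Metric4 M) (c : M) {y : E4} (hy : y ∈ (chartAt E4 c).target) :
    0 < (gram g ((chartAt E4 c).symm y) fun k => chartSymmDeriv c y (stdVec k)).det := by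
  have h := gram_det_comp g ((chartAt E4 c).symm y) (ContinuousLinearMap.id ℝ E4)
    (chartSymmDeriv c y)
  simp only [ContinuousLinearMap.id_apply] at h
  rw [h]
  have h1 := chartSymmDeriv_det_ne_zero c hy
  exact mul_pos (by positivity) (gram_stdVec_posDef g _).det_pos

theorem contDiffOn_det {D : Type*} [NormedAddCommGroup D] [NormedSpace ℝ D] {S : Set D}
    {A : D → Matrix (Fin 4) (Fin 4) ℝ} (hA : ∀ i j, ContDiffOn ℝ ∞ (fun y => A y i j) S) :
    ContDiffOn ℝ ∞ (fun y => (A y).det) S := by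
  simp only [Matrix.det_apply, Units.smul_def, zsmul_eq_mul]
  exact ContDiffOn.sum fun σ _ => contDiffOn_const.mul (contDiffOn_prod fun i _ => hA _ _)

theorem contDiffOn_inv {D : Type*} [NormedAddCommGroup D] [NormedSpace ℝ D] {S : Set D}
    {A : D → Matrix (Fin 4) (Fin 4) ℝ} (hA : ∀ i j, ContDiffOn ℝ ∞ (fun y => A y i j) S)
    (h0 : ∀ y ∈ S, (A y).det ≠ 0) (i j : Fin 4) :
    ContDiffOn ℝ ∞ (fun y => (A y)⁻¹ i j) S := by
  simp only [Matrix.inv_def, Ring.inverse_eq_inv', Matrix.smul_apply, smul_eq_mul,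
    Matrix.adjugate_apply]
  refine ((contDiffOn_det hA).inv h0).mul (contDiffOn_det fun k l => ?_)
  by_cases hk : k = j
  · subst hk
    simpa using contDiffOn_const
  · simpa [Matrix.updateRow_ne hk] using hA k l

theorem insertFirst_comp {p q : ℕ} (h : p + q = 4) (μ : Cov 4) (L : E4 →L[ℝ] E4)
    (u : Fin p → E4) (w : Fin q → E4) :
    insertFirst h (μ.compContinuousLinearMap L) u w =
      insertFirst h μ (fun i => L (u i)) fun i => L (w i) := by
  rw [insertFirst_apply, insertFirst_apply]
  change μ _ = μ _
  congr 1
  funext k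
  rcases pos_cases h k with ⟨i, rfl⟩ | ⟨j, rfl⟩
  · simp [leftPos]
  · simp [rightPos]

variable {n : ℕ} (X : ToricData M n)

/-- The standard vectors in the definition refer to the preferred chart at each point and need not
vary smoothly. `hodge_basis` allows the coordinate frame of one chart instead, where every
ingredient is smooth. -/
theorem IsSmooth.hodge {p q : ℕ} (h : p + q = 4) {α : Form M p} (hα : IsSmooth α) :
    IsSmooth (hodge X h α) := by
  intro c
  refine contDiffOn_cov fun l => ?_
  have e : ∀ y ∈ (chartAt E4 c).target, inChart c (NCYM.hodge X h α) y (stdVec ∘ l) =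
      ((p.factorial : ℕ) : ℂ)⁻¹ * ∑ i : Fin p → Fin 4, ∑ j : Fin p → Fin 4,
        ((∏ k, (gram X.metric ((chartAt E4 c).symm y)
          (fun k => chartSymmDeriv c y (stdVec k)))⁻¹ (i k) (j k) : ℝ) : ℂ) *
          inChart c α y (stdVec ∘ i) *
          insertFirst h (inChart c X.vol y) (stdVec ∘ j) (stdVec ∘ l) := fun y hy => by
    have h1 := hodge_basis X h α ((chartAt E4 c).symm y) (chartGram_det_pos X.metric c hy).ne'
      (fun i => chartSymmDeriv c y (stdVec (l i)))
    refine h1.trans ?_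
    congr 1
    refine Finset.sum_congr rfl fun i _ => Finset.sum_congr rfl fun j _ => ?_
    exact congrArg₂ (· * ·) rfl (insertFirst_comp h (X.vol _) (chartSymmDeriv c y)
      (stdVec ∘ j) (stdVec ∘ l)).symm
  refine ContDiffOn.congr ?_ e
  refine contDiffOn_const.mul (ContDiffOn.sum fun i _ => ContDiffOn.sum fun j _ =>
    (ContDiffOn.mul ?_ ?_).mul ?_)
  · have h1 : ContDiffOn ℝ ∞ (fun y => ∏ k, (gram X.metric ((chartAt E4 c).symm y)
        (fun k => chartSymmDeriv c y (stdVec k)))⁻¹ (i k) (j k)) (chartAt E4 c).target :=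
      contDiffOn_prod fun k _ => contDiffOn_inv (contDiffOn_chartGram X.metric c)
        (fun y hy => (chartGram_det_pos X.metric c hy).ne') _ _
    exact Complex.ofRealCLM.contDiff.comp_contDiffOn h1
  · exact contDiffOn_cov_apply (hα c) fun _ => contDiffOn_const
  · exact contDiffOn_cov_apply (X.vol_smooth c) (v := fun k _ =>
      Fin.append (stdVec ∘ j) (stdVec ∘ l) (Fin.cast h.symm k)) fun _ => contDiffOn_const

/-! ### Invariance under the torus action -/

theorem IsFrame.act {x : M} {e : Fin 4 → E4} (he : IsFrame X.metric x e) (s : Fin n → ℝ) :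
    IsFrame X.metric (X.act s x) fun i => tderiv (X.act s) x (e i) := by
  rw [IsFrame, ← he]
  ext i j
  exact X.act_isometric s x _ _

theorem IsFrame.ext_top {g : Metric4 M} {x : M} {e : Fin 4 → E4} (he : IsFrame g x e)
    {α β : Cov 4} (h : α e = β e) : α = β := by
  refine he.ext fun v hv => ?_
  have h1 := α.toAlternatingMap.map_perm e
    (Equiv.ofBijective v (Finite.injective_iff_bijective.1 hv))
  have h2 := β.toAlternatingMap.map_perm e
    (Equiv.ofBijective v (Finite.injective_iff_bijective.1 hv))
  exact h1.trans (Eq.trans (congrArg _ h) h2.symm)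

/-- An isometry preserves the volume form up to sign. The sign depends continuously on `s` in the
connected space ℝⁿ and is +1 at `s = 0`, so the action preserves the orientation. -/
theorem sigma_vol (s : Fin n → ℝ) : sigma X s X.vol = X.vol := by
  funext x
  obtain ⟨e, he⟩ := exists_frame X.metric x
  refine he.ext_top ?_
  have hc : Continuous fun t => sigma X t X.vol x e :=
    (ContinuousAlternatingMap.apply ℝ E4 ℂ e).continuous.comp
      (contDiff_sigma X X.vol_smooth x).continuous
  have hsq : ∀ t, sigma X t X.vol x e ^ 2 = X.vol x e ^ 2 := fun t => by
    have h := (he.act X t).vol_sq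
    rw [pow_two, pow_two, he.vol_sq]
    exact h
  have hne : X.vol x e ≠ 0 := fun h0 => by
    have := he.vol_sq
    rw [h0, mul_zero] at this
    exact zero_ne_one this
  exact isPreconnected_univ.eq_of_sq_eq hc.continuousOn
    (continuousOn_const (c := X.vol x e)) (fun t _ => hsq t) (fun _ => hne)
    (Set.mem_univ (0 : Fin n → ℝ)) (by rw [sigma_zero]) (Set.mem_univ s)

/-- The action carries orthonormal frames to orthonormal frames and preserves the volume form, so
the frame formula for * is preserved. -/
theorem sigma_hodge {p q : ℕ} (h : p + q = 4) (s : Fin n → ℝ) (α : Form M p) :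
    sigma X s (hodge X h α) = hodge X h (sigma X s α) := by
  funext x
  obtain ⟨e, he⟩ := exists_frame X.metric x
  ext w
  rw [he.hodge_eq, sigma_apply, (he.act X s).hodge_eq]
  congr 1
  refine Finset.sum_congr rfl fun c _ => ?_
  have h1 := congrFun (sigma_vol X s) x
  rw [← h1]
  exact congrArg₂ (· * ·) rfl (insertFirst_comp h (X.vol (X.act s x)) (tderiv (X.act s) x)
    (e ∘ c) w).symm

/-! ### Pointwise linearity -/

/-- The Hodge operator at a point. -/
def hodgeL {p q : ℕ} (h : p + q = 4) (x : M) : Cov p →L[ℝ] Cov q :=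
  LinearMap.toContinuousLinearMap
    { toFun := fun a => hodge X h (fun _ => a) x
      map_add' := fun a b => by
        ext w
        simp only [hodge, ContinuousAlternatingMap.add_apply, ContinuousAlternatingMap.smul_apply,
          ContinuousAlternatingMap.sum_apply, smul_eq_mul, mul_add, add_mul,
          Finset.sum_add_distrib]
      map_smul' := fun r a => by
        ext w
        simp only [hodge, ContinuousAlternatingMap.smul_apply,
          ContinuousAlternatingMap.sum_apply, smul_eq_mul, Complex.real_smul, Finset.mul_sum,
          RingHom.id_apply]
        exact Finset.sum_congr rfl fun i _ => Finset.sum_congr rfl fun j _ => by ring }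

theorem hodge_apply {p q : ℕ} (h : p + q = 4) (α : Form M p) (x : M) :
    hodge X h α x = hodgeL X h x (α x) := rfl

theorem hodgeL_smul {p q : ℕ} (h : p + q = 4) (x : M) (c : ℂ) (a : Cov p) :
    hodgeL X h x (c • a) = c • hodgeL X h x a := by
  ext w
  change hodge X h (fun _ => c • a) x w = c • hodge X h (fun _ => a) x w
  simp only [hodge, ContinuousAlternatingMap.smul_apply,
    ContinuousAlternatingMap.sum_apply, smul_eq_mul, Finset.mul_sum]
  exact Finset.sum_congr rfl fun i _ => Finset.sum_congr rfl fun j _ => by ring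

theorem component_hodge {p q : ℕ} (h : p + q = 4) {α : Form M p} (hα : IsSmooth α)
    (m : Fin n → ℤ) (x : M) :
    component X m (hodge X h α) x = hodgeL X h x (component X m α x) := by
  have h1 := map_fcoef (contDiff_sigma X hα x).continuous m (hodgeL X h x) (hodgeL_smul X h x)
  rw [component_eq, component_eq, h1]
  congr 1
  funext s
  rw [sigma_hodge]
  rfl

/-- The Hodge operator is left linear over the functions. -/
theorem hodge_starMul_left {p q : ℕ} (h : p + q = 4) (h1 : 0 + p = p) (h2 : 0 + q = q)
    {f : Form M 0} {α : Form M p} (hf : IsSmooth f) (hα : IsSmooth α) :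
    hodge X h (starMul X h1 f α) = starMul X h2 f (hodge X h α) := by
  funext x
  rw [hodge_apply, starMul_apply, starMul_apply,
    (hodgeL X h x).map_tsum (summable_starMul X h1 hf hα x)]
  refine tsum_congr fun m => ?_
  rw [wedge_zero_left, wedge_zero_left, hodgeL_smul, sigma_hodge]
  rfl

/-- The Hodge operator is right linear over the functions. -/
theorem hodge_starMul_right {p q : ℕ} (h : p + q = 4) (h1 : p + 0 = p) (h2 : q + 0 = q)
    {f : Form M 0} {α : Form M p} (hf : IsSmooth f) (hα : IsSmooth α) :
    hodge X h (starMul X h1 α f) = starMul X h2 (hodge X h α) f := by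
  funext x
  rw [hodge_apply, starMul_apply, starMul_apply,
    (hodgeL X h x).map_tsum (summable_starMul X h1 hα hf x)]
  refine tsum_congr fun m => ?_
  rw [wedge_zero_right, wedge_zero_right, hodgeL_smul, component_hodge X h hα]

/-- The Hodge operator on smooth forms. -/
def hodgeS {p q : ℕ} (h : p + q = 4) : SForm M p →ₗ[ℂ] SForm M q where
  toFun α := ⟨hodge X h α, α.2.hodge X h⟩
  map_add' α β := Subtype.ext (funext fun x => (hodgeL X h x).map_add (α.1 x) (β.1 x))
  map_smul' c α := Subtype.ext (funext fun x => hodgeL_smul X h x c (α.1 x))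

theorem coe_hodgeS {p q : ℕ} (h : p + q = 4) (α : SForm M p) :
    (hodgeS X h α : Form M q) = hodge X h α := rfl

end HodgeSmooth

/-! ### The Riemannian volume measure -/

section Volume

variable {M : Type*} [TopologicalSpace M] [ChartedSpace E4 M] [IsManifold (𝓡 4) ∞ M]
variable [MeasurableSpace M] [BorelSpace M] (g : Metric4 M)

/-- The density of the Riemannian volume in the chart at `c`. -/
def chartDensity (c : M) (y : E4) : ℝ :=
  Real.sqrt (gram g ((chartAt E4 c).symm y) fun i => chartSymmDeriv c y (stdVec i)).det

omit [MeasurableSpace M] [BorelSpace M] in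
theorem chartDensity_pos {c : M} {y : E4} (hy : y ∈ (chartAt E4 c).target) :
    0 < chartDensity g c y := Real.sqrt_pos.2 (chartGram_det_pos g c hy)

omit [MeasurableSpace M] [BorelSpace M] in
theorem contDiffOn_chartDensity (c : M) :
    ContDiffOn ℝ ∞ (chartDensity g c) (chartAt E4 c).target :=
  (contDiffOn_det (contDiffOn_chartGram g c)).sqrt fun _ hy => (chartGram_det_pos g c hy).ne'

theorem aemeasurable_chart_symm (c : M) :
    AEMeasurable (chartAt E4 c).symm
      (((volume : Measure E4).restrict (chartAt E4 c).target).withDensity fun y =>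
        ENNReal.ofReal (chartDensity g c y)) :=
  ((chartAt E4 c).continuousOn_symm.aemeasurable (chartAt E4 c).open_target.measurableSet).mono_ac
    (withDensity_absolutelyContinuous _ _)

omit [IsManifold (𝓡 4) ∞ M] in
theorem measurableSet_chart_preimage (c : M) {A : Set M} (hA : MeasurableSet A) :
    MeasurableSet ((chartAt E4 c).target ∩ (chartAt E4 c).symm ⁻¹' A) := by
  have h1 : Measurable ((chartAt E4 c).target.domRestrict (chartAt E4 c).symm) :=
    (continuousOn_iff_continuous_domRestrict.1 (chartAt E4 c).continuousOn_symm).measurable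
  have h2 := (chartAt E4 c).open_target.measurableSet.subtype_image (h1 hA)
  convert h2 using 1
  ext y
  constructor
  · rintro ⟨h, h'⟩
    exact ⟨⟨y, h⟩, h', rfl⟩
  · rintro ⟨⟨y, h⟩, h', rfl⟩
    exact ⟨h, h'⟩

theorem chartVolume_apply (c : M) {A : Set M} (hA : MeasurableSet A) :
    chartVolume g c A = ∫⁻ y in (chartAt E4 c).target ∩ (chartAt E4 c).symm ⁻¹' A,
      ENNReal.ofReal (chartDensity g c y) := by
  have hT := (chartAt E4 c).open_target.measurableSet
  have hm := measurableSet_chart_preimage c hA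
  have h1 : chartVolume g c A = (((volume : Measure E4).restrict (chartAt E4 c).target).withDensity
      fun y => ENNReal.ofReal (chartDensity g c y)) ((chartAt E4 c).symm ⁻¹' A) :=
    Measure.map_apply_of_aemeasurable (aemeasurable_chart_symm g c) hA
  have h2 : (((volume : Measure E4).restrict (chartAt E4 c).target).withDensity
      fun y => ENNReal.ofReal (chartDensity g c y)) (chartAt E4 c).targetᶜ = 0 :=
    withDensity_absolutelyContinuous _ _ (by rw [Measure.restrict_apply hT.compl]; simp)
  have h3 : (((volume : Measure E4).restrict (chartAt E4 c).target).withDensity fun y =>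
      ENNReal.ofReal (chartDensity g c y))
        ((chartAt E4 c).symm ⁻¹' A \ (chartAt E4 c).target) = 0 :=
    measure_mono_null (fun y hy => hy.2) h2
  rw [h1, ← measure_inter_add_sdiff _ hT, h3, add_zero, Set.inter_comm, withDensity_apply _ hm,
    Measure.restrict_restrict_of_subset Set.inter_subset_left]

theorem chartVolume_compl_source (c : M) : chartVolume g c (chartAt E4 c).sourceᶜ = 0 := by
  rw [chartVolume_apply g c (chartAt E4 c).open_source.measurableSet.compl]
  have : (chartAt E4 c).target ∩ (chartAt E4 c).symm ⁻¹' (chartAt E4 c).sourceᶜ = ∅ := by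
    ext y
    simp only [Set.mem_inter_iff, Set.mem_preimage, Set.mem_compl_iff, Set.mem_empty_iff_false,
      iff_false, not_and, not_not]
    exact fun hy => (chartAt E4 c).map_target hy
  rw [this]
  simp

theorem chartVolume_restrict_source (c : M) :
    (chartVolume g c).restrict (chartAt E4 c).source = chartVolume g c :=
  Measure.restrict_eq_self_of_ae_mem (by
    rw [ae_iff]
    exact chartVolume_compl_source g c)

/-- Isometries preserve the Riemannian volume. -/
theorem chartVolume_image {f : M → M} (hf : ContMDiff (𝓡 4) (𝓡 4) ∞ f)
    (hinj : Function.Injective f) (hiso : ∀ (x : M) (v w : E4),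
      metricAt g (f x) (tderiv f x v) (tderiv f x w) = metricAt g x v w) {c c' : M} {A : Set M}
    (hA : MeasurableSet A) (hAc : A ⊆ (chartAt E4 c).source) (hfA : MeasurableSet (f '' A))
    (hAc' : f '' A ⊆ (chartAt E4 c').source) :
    chartVolume g c' (f '' A) = chartVolume g c A := by
  have hmem : ∀ y ∈ (chartAt E4 c).target ∩ (chartAt E4 c).symm ⁻¹' A,
      f ((chartAt E4 c).symm y) ∈ (chartAt E4 c').source := fun y hy =>
    hAc' (Set.mem_image_of_mem f hy.2)
  have himg : (chartAt E4 c').target ∩ (chartAt E4 c').symm ⁻¹' (f '' A) =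
      (fun z => chartAt E4 c' (f ((chartAt E4 c).symm z))) ''
        ((chartAt E4 c).target ∩ (chartAt E4 c).symm ⁻¹' A) := by
    ext z
    constructor
    · rintro ⟨hz, x, hx, hxz⟩
      refine ⟨chartAt E4 c x, ⟨(chartAt E4 c).map_source (hAc hx), ?_⟩, ?_⟩
      · rw [Set.mem_preimage, (chartAt E4 c).left_inv (hAc hx)]
        exact hx
      · simp only
        rw [(chartAt E4 c).left_inv (hAc hx), hxz, (chartAt E4 c').right_inv hz]
    · rintro ⟨y, hy, rfl⟩
      refine ⟨(chartAt E4 c').map_source (hmem y hy), ?_⟩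
      rw [Set.mem_preimage, (chartAt E4 c').left_inv (hmem y hy)]
      exact Set.mem_image_of_mem f hy.2
  have hm := measurableSet_chart_preimage c hA
  rw [chartVolume_apply g c' hfA, chartVolume_apply g c hA, himg,
    lintegral_image_eq_lintegral_abs_det_fderiv_mul volume hm
      (f' := fderiv ℝ (fun z => chartAt E4 c' (f ((chartAt E4 c).symm z))))]
  -- The Gram matrix of the coordinate frame is preserved by the isometry, so the Jacobian times the
  -- density at the image is the density at the point.
  · refine setLIntegral_congr_fun hm fun y hy => ?_
    have h1 := fderiv_chart_comp hy.1 (hf.mdifferentiable (by simp) _) (hmem y hy)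
    have h2 : ∀ v, chartSymmDeriv c' (chartAt E4 c' (f ((chartAt E4 c).symm y)))
        (fderiv ℝ (fun z => chartAt E4 c' (f ((chartAt E4 c).symm z))) y v) =
          tderiv f ((chartAt E4 c).symm y) (chartSymmDeriv c y v) := fun v => by
      rw [h1]
      exact DFunLike.congr_fun (chartSymmDeriv_comp_chartDeriv c' (hmem y hy)) _
    have h3 := gram_det_comp g (f ((chartAt E4 c).symm y))
      (chartSymmDeriv c' (chartAt E4 c' (f ((chartAt E4 c).symm y))))
      (fderiv ℝ (fun z => chartAt E4 c' (f ((chartAt E4 c).symm z))) y)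
    simp only [h2] at h3
    have h4 : gram g (f ((chartAt E4 c).symm y)) (fun i =>
        tderiv f ((chartAt E4 c).symm y) (chartSymmDeriv c y (stdVec i))) =
        gram g ((chartAt E4 c).symm y) fun i => chartSymmDeriv c y (stdVec i) := by
      ext i j
      exact hiso _ _ _
    rw [h4] at h3
    simp only [chartDensity]
    rw [(chartAt E4 c').left_inv (hmem y hy), h3, ← ENNReal.ofReal_mul (abs_nonneg _),
      Real.sqrt_mul (sq_nonneg _), Real.sqrt_sq_eq_abs]
  · intro y hy
    exact ((contDiffAt_chart_comp hf hy.1 (hmem y hy)).differentiableAt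
      (by simp)).hasFDerivAt.hasFDerivWithinAt
  · intro y hy z hz h
    have h1 := congrArg (chartAt E4 c').symm h
    simp only at h1
    rw [(chartAt E4 c').left_inv (hmem y hy), (chartAt E4 c').left_inv (hmem z hz)] at h1
    have h2 := congrArg (chartAt E4 c) (hinj h1)
    rwa [(chartAt E4 c).right_inv hy.1, (chartAt E4 c).right_inv hz.1] at h2

/-- The identity map as an isometry: chart volumes agree on overlaps, which is what makes their
supremum a gluing. -/
theorem chartVolume_congr {c c' : M} {A : Set M} (hA : MeasurableSet A)
    (hc : A ⊆ (chartAt E4 c).source) (hc' : A ⊆ (chartAt E4 c').source) :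
    chartVolume g c' A = chartVolume g c A := by
  have h := chartVolume_image g (f := fun x => x) contMDiff_id Function.injective_id
    (fun x v w => ?_) hA hc (by rwa [Set.image_id']) (by rwa [Set.image_id'])
  · rwa [Set.image_id'] at h
  · have h1 : ∀ v, tderiv (fun x : M => x) x v = v :=
      fun v => DFunLike.congr_fun (mfderiv_id (I := 𝓡 4) (x := x)) v
    rw [h1, h1]

variable [CompactSpace M]

omit [IsManifold (𝓡 4) ∞ M] [MeasurableSpace M] [BorelSpace M] in
theorem exists_chart_sequence [Nonempty M] :
    ∃ c : ℕ → M, ⋃ k, (chartAt E4 (c k)).source = Set.univ := by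
  obtain ⟨t, ht⟩ := CompactSpace.elim_nhds_subcover (fun c : M => (chartAt E4 c).source)
    fun c => (chartAt E4 c).open_source.mem_nhds (mem_chart_source E4 c)
  have hne : (t : Set M).Nonempty := by
    obtain ⟨x⟩ := ‹Nonempty M›
    have : x ∈ (⊤ : Set M) := trivial
    rw [← ht] at this
    simp only [Set.mem_iUnion] at this
    obtain ⟨i, hi, -⟩ := this
    exact ⟨i, hi⟩
  obtain ⟨c, hc⟩ := t.countable_toSet.exists_eq_range hne
  refine ⟨c, Set.eq_univ_of_forall fun x => ?_⟩
  have : x ∈ (⊤ : Set M) := trivial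
  rw [← ht] at this
  simp only [Set.mem_iUnion] at this
  obtain ⟨i, hi, hx⟩ := this
  have hi' : i ∈ Set.range c := hc ▸ hi
  obtain ⟨k, rfl⟩ := hi'
  exact Set.mem_iUnion.2 ⟨k, hx⟩

/-- In the domain of a chart, the Riemannian volume is the volume of the chart. -/
theorem riemannianVolume_restrict (c : M) :
    (riemannianVolume g).restrict (chartAt E4 c).source = chartVolume g c := by
  have : Nonempty M := ⟨c⟩
  obtain ⟨b, hb⟩ := exists_chart_sequence (M := M)
  let U : ℕ → Set M := fun k => (chartAt E4 (b k)).source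
  have hU : ∀ k, MeasurableSet (U k) := fun k => (chartAt E4 (b k)).open_source.measurableSet
  have hd : ∀ k, MeasurableSet (disjointed U k) := fun k => MeasurableSet.disjointed hU k
  have hsplit : ∀ m : Measure M, m = Measure.sum fun k => m.restrict (disjointed U k) := fun m => by
    rw [← Measure.restrict_iUnion (disjoint_disjointed U) hd, iUnion_disjointed, hb,
      Measure.restrict_univ]
  -- The glued measure on disjoint pieces of chart domains. It restricts to every chart volume,
  -- hence dominates all of them, and piece by piece it lies below their supremum.
  let μ : Measure M := Measure.sum fun k => (chartVolume g (b k)).restrict (disjointed U k)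
  have hμ : ∀ c, μ.restrict (chartAt E4 c).source = chartVolume g c := fun c => by
    rw [Measure.restrict_sum _ (chartAt E4 c).open_source.measurableSet,
      ← chartVolume_restrict_source g c]
    conv_rhs => rw [hsplit (chartVolume g c)]
    rw [Measure.restrict_sum _ (chartAt E4 c).open_source.measurableSet]
    congr 1
    funext k
    ext A hA
    have hms := (chartAt E4 c).open_source.measurableSet
    rw [Measure.restrict_apply hA, Measure.restrict_apply hA,
      Measure.restrict_apply (hA.inter hms), Measure.restrict_apply (hA.inter hms)]
    exact chartVolume_congr g ((hA.inter hms).inter (hd k)) (fun x hx => hx.1.2)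
      fun x hx => disjointed_subset U k hx.2
  have hle : ∀ c, chartVolume g c ≤ μ := fun c => (hμ c).symm.trans_le Measure.restrict_le_self
  have heq : riemannianVolume g = μ := by
    refine le_antisymm (iSup_le hle) ?_
    have h1 : ∀ c, chartVolume g c ≤ riemannianVolume g := fun c => le_iSup (chartVolume g) c
    rw [hsplit (riemannianVolume g)]
    refine Measure.le_iff.2 fun A hA => ?_
    rw [Measure.sum_apply _ hA, Measure.sum_apply _ hA]
    exact ENNReal.tsum_le_tsum fun k => Measure.restrict_mono le_rfl (h1 _) A
  rw [heq, hμ]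

theorem riemannianVolume_apply (c : M) {A : Set M} (hA : MeasurableSet A)
    (hc : A ⊆ (chartAt E4 c).source) :
    riemannianVolume g A = ∫⁻ y in (chartAt E4 c).target ∩ (chartAt E4 c).symm ⁻¹' A,
      ENNReal.ofReal (chartDensity g c y) := by
  rw [← chartVolume_apply g c hA, ← riemannianVolume_restrict, Measure.restrict_apply hA,
    Set.inter_eq_left.2 hc]

/-- The density is continuous, hence bounded near the point; compactness of M then gives finite
total volume. -/
theorem riemannianVolume_finiteAtNhds (x : M) :
    (riemannianVolume g).FiniteAtFilter (nhds x) := by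
  set c := chartAt E4 x
  have hx : c x ∈ c.target := c.map_source (mem_chart_source E4 x)
  have hcont := (contDiffOn_chartDensity g x).continuousOn.continuousAt
    (c.open_target.mem_nhds hx)
  obtain ⟨U, hU, hUo, hxU⟩ := mem_nhds_iff.1 (Filter.inter_mem (c.open_target.mem_nhds hx)
    (Filter.inter_mem (hcont.eventually_lt continuousAt_const (lt_add_one _))
      (Metric.ball_mem_nhds (c x) one_pos)))
  refine ⟨c.source ∩ c ⁻¹' U, (c.isOpen_inter_preimage hUo).mem_nhds
    ⟨mem_chart_source E4 x, hxU⟩, ?_⟩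
  rw [riemannianVolume_apply g x (c.isOpen_inter_preimage hUo).measurableSet
    Set.inter_subset_left]
  have hsub : c.target ∩ c.symm ⁻¹' (c.source ∩ c ⁻¹' U) ⊆ U := fun y hy => by
    have := hy.2.2
    rwa [Set.mem_preimage, c.right_inv hy.1] at this
  refine (lintegral_mono_set hsub).trans_lt ?_
  refine (setLIntegral_mono' hUo.measurableSet fun y hy =>
    ENNReal.ofReal_le_ofReal (hU hy).2.1.le).trans_lt ?_
  rw [setLIntegral_const]
  exact ENNReal.mul_lt_top ENNReal.ofReal_lt_top
    ((measure_mono fun y hy => (hU hy).2.2).trans_lt measure_ball_lt_top)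

instance : IsFiniteMeasure (riemannianVolume g) :=
  ⟨IsCompact.measure_lt_top_of_nhdsWithin isCompact_univ fun x _ => by
    rw [nhdsWithin_univ]
    exact riemannianVolume_finiteAtNhds g x⟩

/-- Full support yields definiteness of the inner product: a continuous nonnegative function of
integral zero vanishes. -/
instance : Measure.IsOpenPosMeasure (riemannianVolume g) := by
  refine ⟨fun U hU ⟨x, hx⟩ h0 => ?_⟩
  set c := chartAt E4 x
  have hV : IsOpen (c.target ∩ c.symm ⁻¹' U) := c.isOpen_inter_preimage_symm hU
  have hxV : c x ∈ c.target ∩ c.symm ⁻¹' U := ⟨c.map_source (mem_chart_source E4 x), by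
    rw [Set.mem_preimage, c.left_inv (mem_chart_source E4 x)]
    exact hx⟩
  have h1 := measure_mono_null (Set.inter_subset_left (s := U) (t := c.source)) h0
  rw [riemannianVolume_apply g x (hU.inter c.open_source).measurableSet
    Set.inter_subset_right] at h1
  have h2 : c.target ∩ c.symm ⁻¹' U ⊆ c.target ∩ c.symm ⁻¹' (U ∩ c.source) := fun y hy =>
    ⟨hy.1, hy.2, c.map_target hy.1⟩
  have h3 := le_antisymm ((lintegral_mono_set h2).trans_eq h1) zero_le
  have hm : AEMeasurable (fun y => ENNReal.ofReal (chartDensity g x y))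
      (volume.restrict (c.target ∩ c.symm ⁻¹' U)) :=
    (((contDiffOn_chartDensity g x).continuousOn.mono Set.inter_subset_left).aemeasurable
      hV.measurableSet).ennreal_ofReal
  rw [lintegral_eq_zero_iff' hm, Filter.EventuallyEq, ae_restrict_iff' hV.measurableSet] at h3
  have h4 : (volume : Measure E4) (c.target ∩ c.symm ⁻¹' U) = 0 := by
    refine measure_mono_null (fun y hy => ?_) (ae_iff.1 h3)
    simp only [Set.mem_ofPred_eq, not_forall]
    refine ⟨hy, ?_⟩
    simpa using chartDensity_pos g hy.1
  exact hV.measure_ne_zero volume ⟨_, hxV⟩ h4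

/-- The integral of a function supported in the domain of a chart. -/
theorem setIntegral_source {E : Type*} [NormedAddCommGroup E] [NormedSpace ℝ E] (c : M)
    (f : M → E) (hf : AEStronglyMeasurable f (riemannianVolume g)) :
    ∫ x in (chartAt E4 c).source, f x ∂(riemannianVolume g) =
      ∫ y in (chartAt E4 c).target, chartDensity g c y • f ((chartAt E4 c).symm y) := by
  have hT := (chartAt E4 c).open_target.measurableSet
  have h1 : AEStronglyMeasurable f (chartVolume g c) := by
    rw [← riemannianVolume_restrict]
    exact hf.restrict
  rw [riemannianVolume_restrict]
  refine (integral_map (aemeasurable_chart_symm g c) h1).trans ?_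
  have h2 : AEMeasurable (fun y => (chartDensity g c y).toNNReal)
      ((volume : Measure E4).restrict (chartAt E4 c).target) :=
    ((contDiffOn_chartDensity g c).continuousOn.aemeasurable hT).real_toNNReal
  refine (integral_withDensity_eq_integral_smul₀ h2 _).trans ?_
  refine setIntegral_congr_fun hT fun y hy => ?_
  simp only [NNReal.smul_def, Real.coe_toNNReal _ (chartDensity_pos g hy).le]

/-- Diffeomorphic isometries preserve the Riemannian volume. -/
theorem measurePreserving_riemannianVolume {f f' : M → M} (hf : ContMDiff (𝓡 4) (𝓡 4) ∞ f)
    (hf' : Continuous f') (hl : Function.LeftInverse f' f) (hr : Function.RightInverse f' f)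
    (hiso : ∀ (x : M) (v w : E4),
      metricAt g (f x) (tderiv f x v) (tderiv f x w) = metricAt g x v w) :
    MeasurePreserving f (riemannianVolume g) (riemannianVolume g) := by
  have hfc := hf.continuous
  refine ⟨hfc.measurable, ?_⟩
  rcases isEmpty_or_nonempty M with hM | hM
  · exact Subsingleton.elim _ _
  obtain ⟨b, hb⟩ := exists_chart_sequence (M := M)
  -- Countably many pieces on which a point and its preimage both lie in chart domains, so that
  -- `chartVolume_image` applies.
  let W : ℕ × ℕ → Set M := fun q =>
    (chartAt E4 (b q.1)).source ∩ f' ⁻¹' (chartAt E4 (b q.2)).source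
  have hW : ∀ q, MeasurableSet (W q) := fun q => ((chartAt E4 (b q.1)).open_source.inter
    ((chartAt E4 (b q.2)).open_source.preimage hf')).measurableSet
  have hcov : ⋃ q, W q = Set.univ := by
    refine Set.eq_univ_of_forall fun x => ?_
    have h1 : ∀ x : M, ∃ k, x ∈ (chartAt E4 (b k)).source := fun x => by
      have : x ∈ ⋃ k, (chartAt E4 (b k)).source := hb ▸ Set.mem_univ x
      exact Set.mem_iUnion.1 this
    obtain ⟨i, hi⟩ := h1 x
    obtain ⟨j, hj⟩ := h1 (f' x)
    exact Set.mem_iUnion.2 ⟨(i, j), hi, hj⟩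
  refine (Measure.ext_iff_of_iUnion_eq_univ hcov).2 fun q => ?_
  ext A hA
  rw [Measure.restrict_apply hA, Measure.restrict_apply hA,
    Measure.map_apply hfc.measurable (hA.inter (hW q))]
  have himg : f '' (f ⁻¹' (A ∩ W q)) = A ∩ W q :=
    Set.image_preimage_eq _ hr.surjective
  have h1 : f ⁻¹' (A ∩ W q) ⊆ (chartAt E4 (b q.2)).source := fun x hx => by
    have := hx.2.2
    rwa [Set.mem_preimage, hl x] at this
  have h2 := chartVolume_image g hf hl.injective hiso (c := b q.2) (c' := b q.1)
    (hfc.measurable (hA.inter (hW q))) h1 (by rw [himg]; exact hA.inter (hW q))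
    (by rw [himg]; exact fun x hx => hx.2.1)
  rw [himg] at h2
  rw [riemannianVolume_apply g (b q.2) (hfc.measurable (hA.inter (hW q))) h1,
    riemannianVolume_apply g (b q.1) (hA.inter (hW q)) fun x hx => hx.2.1,
    ← chartVolume_apply g _ (hfc.measurable (hA.inter (hW q))),
    ← chartVolume_apply g _ (hA.inter (hW q)), h2]

end Volume

/-! ## The integral of top degree forms -/

section Integral

variable {M : Type*} [TopologicalSpace M] [ChartedSpace E4 M] [IsManifold (𝓡 4) ∞ M]

omit [IsManifold (𝓡 4) ∞ M] in
theorem IsSmooth.continuous_zero {f : Form M 0} (hf : IsSmooth f) :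
    Continuous fun x => f x ![] := by
  refine continuous_iff_continuousAt.2 fun x => ?_
  have hx := mem_chart_source E4 x
  have h1 : ContinuousAt (fun x' => inChart x f (chartAt E4 x x') ![]) x :=
    ((ContinuousAlternatingMap.apply ℝ E4 ℂ (![] : Fin 0 → E4)).continuous.continuousAt).comp
      (ContinuousAt.comp (f := chartAt E4 x) (g := inChart x f)
        (((hf x).continuousOn).continuousAt ((chartAt E4 x).open_target.mem_nhds
          ((chartAt E4 x).map_source hx))) ((chartAt E4 x).continuousAt hx))
  refine h1.congr ?_
  filter_upwards [(chartAt E4 x).open_source.mem_nhds hx] with x' hx'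
  have h2 : inChart x f (chartAt E4 x x') ![] =
      f ((chartAt E4 x).symm (chartAt E4 x x')) ![] :=
    congrArg (f ((chartAt E4 x).symm (chartAt E4 x x'))) (Subsingleton.elim _ _)
  rw [h2, (chartAt E4 x).left_inv hx']

variable {n : ℕ} (X : ToricData M n)

/-- The function `*α` of a form `α` of top degree. -/
def topFun {r : ℕ} (h : r + 0 = 4) (α : Form M r) (x : M) : ℂ := hodge X h α x ![]

/-- The value at a point of the function `*α`. -/
def topL {r : ℕ} (h : r + 0 = 4) (x : M) : Cov r →L[ℝ] ℂ :=
  (ContinuousAlternatingMap.apply ℝ E4 ℂ (![] : Fin 0 → E4)).comp (hodgeL X h x)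

theorem topL_eq {r : ℕ} (h : r + 0 = 4) (α : Form M r) (x : M) :
    topL X h x (α x) = topFun X h α x := rfl

theorem topL_smul {r : ℕ} (h : r + 0 = 4) (x : M) (c : ℂ) (a : Cov r) :
    topL X h x (c • a) = c • topL X h x a := by
  change hodgeL X h x (c • a) ![] = c * hodgeL X h x a ![]
  rw [hodgeL_smul, ContinuousAlternatingMap.smul_apply, smul_eq_mul]

theorem topFun_smul_vol (α : Form M 4) (x : M) :
    topFun X (show 4 + 0 = 4 from rfl) α x • X.vol x = α x := by
  obtain ⟨e, he⟩ := exists_frame X.metric x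
  refine he.ext_top ?_
  rw [topFun, he.hodge_top, ContinuousAlternatingMap.smul_apply, smul_eq_mul, mul_assoc,
    he.vol_sq, mul_one]

theorem continuous_topFun {r : ℕ} (h : r + 0 = 4) {α : Form M r} (hα : IsSmooth α) :
    Continuous (topFun X h α) :=
  (hα.hodge X _).continuous_zero

theorem topFun_sigma {r : ℕ} (h : r + 0 = 4) (s : Fin n → ℝ) (α : Form M r) (x : M) :
    topFun X h (sigma X s α) x = topFun X h α (X.act s x) := by
  rw [topFun, ← sigma_hodge, sigma_apply]
  exact congrArg (hodge X h α (X.act s x)) (Subsingleton.elim _ _)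

/-- The component of degree zero is the average over the torus. -/
theorem topFun_component {r : ℕ} (h : r + 0 = 4) {α : Form M r} (hα : IsSmooth α) (x : M) :
    topFun X h (component X 0 α) x =
      ∫ s in Set.Icc (0 : Fin n → ℝ) 1, topFun X h α (X.act s x) := by
  have h1 := map_fcoef (contDiff_sigma X hα x).continuous 0 (topL X h x) (topL_smul X h x)
  rw [← topL_eq, component_eq, h1, fcoef_eq]
  simp only [neg_zero, expChar_zero_left, one_smul, topL_eq, topFun_sigma]

variable [CompactSpace M] [MeasurableSpace M] [BorelSpace M]

theorem measurePreserving_act (s : Fin n → ℝ) :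
    MeasurePreserving (X.act s) (riemannianVolume X.metric) (riemannianVolume X.metric) :=
  measurePreserving_riemannianVolume X.metric (act_contMDiff X s)
    (act_contMDiff X (-s)).continuous
    (fun x => by rw [← X.act_add, neg_add_cancel, X.act_zero])
    (fun x => by rw [← X.act_add, add_neg_cancel, X.act_zero]) (X.act_isometric s)

theorem integral_act {f : M → ℂ} (hf : Continuous f) (s : Fin n → ℝ) :
    ∫ x, f (X.act s x) ∂(riemannianVolume X.metric) = ∫ x, f x ∂(riemannianVolume X.metric) := by
  have h := measurePreserving_act X s
  conv_rhs => rw [← h.map_eq]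
  exact (integral_map h.measurable.aemeasurable hf.aestronglyMeasurable).symm

theorem integrable_of_continuous (g : Metric4 M) {f : M → ℂ} (hf : Continuous f) :
    Integrable f (riemannianVolume g) :=
  hf.integrable_of_hasCompactSupport (HasCompactSupport.of_compactSpace f)

/-- Fubini's theorem and invariance of the volume under each `X.act s`. -/
theorem integral_average {f : M → ℂ} (hf : Continuous f) :
    ∫ x, (∫ s in Set.Icc (0 : Fin n → ℝ) 1, f (X.act s x)) ∂(riemannianVolume X.metric) =
      ∫ x, f x ∂(riemannianVolume X.metric) := by
  have : SecondCountableTopology M := ChartedSpace.secondCountable_of_sigmaCompact E4 M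
  obtain ⟨C, hC⟩ := (isCompact_range hf).isBounded.exists_norm_le
  have hvol : volume (Set.Icc (0 : Fin n → ℝ) 1) = 1 := by
    rw [Real.volume_Icc_pi]
    simp
  have : IsFiniteMeasure ((volume : Measure (Fin n → ℝ)).restrict (Set.Icc 0 1)) :=
    ⟨by rw [Measure.restrict_apply_univ, hvol]; exact ENNReal.one_lt_top⟩
  have hint : Integrable (Function.uncurry fun (x : M) (s : Fin n → ℝ) => f (X.act s x))
      ((riemannianVolume X.metric).prod
        ((volume : Measure (Fin n → ℝ)).restrict (Set.Icc 0 1))) := by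
    have hc : Continuous (Function.uncurry fun (x : M) (s : Fin n → ℝ) => f (X.act s x)) :=
      hf.comp (X.act_smooth.continuous.comp continuous_swap)
    exact Integrable.of_bound hc.aestronglyMeasurable C
      (Filter.Eventually.of_forall fun p => hC _ (Set.mem_range_self _))
  rw [integral_integral_swap hint]
  simp only [integral_act X hf]
  rw [integral_const, Measure.real, Measure.restrict_apply_univ, hvol]
  simp

/-- The integral of a form of top degree. -/
def topInt {r : ℕ} (h : r + 0 = 4) (α : Form M r) : ℂ :=
  ∫ x, topFun X h α x ∂(riemannianVolume X.metric)

theorem topInt_component {r : ℕ} (h : r + 0 = 4) {α : Form M r} (hα : IsSmooth α) :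
    topInt X h (component X 0 α) = topInt X h α := by
  rw [topInt]
  simp only [topFun_component X h hα]
  exact integral_average X (continuous_topFun X h hα)

theorem contDiffOn_bilinear {D V W Z : Type*} [NormedAddCommGroup D] [NormedSpace ℝ D]
    [NormedAddCommGroup V] [NormedSpace ℝ V] [NormedAddCommGroup W] [NormedSpace ℝ W]
    [NormedAddCommGroup Z] [NormedSpace ℝ Z] (B : V →L[ℝ] W →L[ℝ] Z) {f : D → V} {g : D → W}
    {S : Set D} {N : WithTop ℕ∞} (hf : ContDiffOn ℝ N f S) (hg : ContDiffOn ℝ N g S) :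
    ContDiffOn ℝ N (fun y => B (f y) (g y)) S :=
  (B.contDiff.comp_contDiffOn hf).clm_apply hg

omit [IsManifold (𝓡 4) ∞ M] [CompactSpace M] [MeasurableSpace M] [BorelSpace M] in
theorem IsSmooth.wedge {p q r : ℕ} (h : p + q = r) {α : Form M p} {β : Form M q}
    (hα : IsSmooth α) (hβ : IsSmooth β) : IsSmooth fun x => wedge h (α x) (β x) := by
  intro c
  have h1 := contDiffOn_bilinear (wedgeR h) (hα c) (hβ c)
  refine h1.congr fun y _ => ?_
  exact wedge_compContinuousLinearMap h _ _ _

omit [CompactSpace M] [MeasurableSpace M] [BorelSpace M] in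
/-- The invariant parts of the deformed and of the undeformed product agree in top degree. -/
theorem component_zero_starMul {p q r : ℕ} (h : p + q = r) {α : Form M p} {β : Form M q}
    (hα : IsSmooth α) (hβ : IsSmooth β) (x : M) :
    component X 0 (starMul X h α β) x = component X 0 (fun x => wedge h (α x) (β x)) x := by
  have h1 := hasSum_component_starMul X h hα hβ x 0
  have h2 := hasSum_fcoef_twisted (wedgeR h) (fun c v w => wedge_smul_right h c v w)
    (summable_norm_component X hα x) (isPeriodic_sigma_apply X β x)
    (contDiff_sigma X hβ x).continuous (fun _ => 0) 0
  -- In total degree zero, m is paired with -m, and the phase is 1; the twisted and the untwisted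
  -- convolution therefore coincide.
  simp only [zero_sub, expChar_neg_twist_self, expChar_zero_right, one_smul, add_zero] at h1 h2
  refine (h1.unique h2).trans ?_
  rw [component_eq]
  congr 1
  funext s
  have h3 := ((wedgeR h).flip (sigma X s β x)).hasSum (hasSum_component X hα x s)
  have h4 : ∀ m : Fin n → ℤ, (wedgeR h).flip (sigma X s β x) (expChar m s • component X m α x) =
      expChar m s • wedgeR h (component X m α x) (sigma X s β x) := fun m =>
    wedge_smul_left h _ _ _
  simp only [h4] at h3
  refine h3.tsum_eq.trans ?_
  exact (wedge_compContinuousLinearMap h _ _ _).symm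

/-- The integral depends only on invariant components, and there the two products agree. Graded
cyclicity then follows from that of the wedge product. -/
theorem topInt_starMul {p q r : ℕ} (h : p + q = r) (h0 : r + 0 = 4) {α : Form M p} {β : Form M q}
    (hα : IsSmooth α) (hβ : IsSmooth β) :
    topInt X h0 (starMul X h α β) = topInt X h0 fun x => wedge h (α x) (β x) := by
  rw [← topInt_component X h0 (hα.starMul X h hβ), ← topInt_component X h0 (hα.wedge h hβ)]
  exact congrArg _ (funext fun x => component_zero_starMul X h hα hβ x)

omit [CompactSpace M] [BorelSpace M] in
theorem topInt_smul {r : ℕ} (h : r + 0 = 4) (c : ℂ) (α : Form M r) :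
    topInt X h (c • α) = c * topInt X h α := by
  rw [topInt, topInt, ← integral_const_mul]
  refine integral_congr_ae (Filter.Eventually.of_forall fun x => ?_)
  exact topL_smul X h x c (α x)

theorem topInt_add {r : ℕ} (h : r + 0 = 4) {α β : Form M r} (hα : IsSmooth α)
    (hβ : IsSmooth β) : topInt X h (α + β) = topInt X h α + topInt X h β := by
  rw [topInt, topInt, topInt, ← integral_add
    (integrable_of_continuous X.metric (continuous_topFun X h hα))
    (integrable_of_continuous X.metric (continuous_topFun X h hβ))]
  refine integral_congr_ae (Filter.Eventually.of_forall fun x => ?_)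
  exact (topL X h x).map_add (α x) (β x)

theorem topInt_cyclic {p q r : ℕ} (h : p + q = r) (h' : q + p = r) (h0 : r + 0 = 4)
    {α : Form M p} {β : Form M q} (hα : IsSmooth α) (hβ : IsSmooth β) :
    topInt X h0 (starMul X h α β) = (-1 : ℂ) ^ (p * q) * topInt X h0 (starMul X h' β α) := by
  rw [topInt_starMul X h h0 hα hβ, topInt_starMul X h' h0 hβ hα, ← topInt_smul]
  exact congrArg _ (funext fun x => wedge_comm h h' (α x) (β x))

end Integral

/-! ## Stokes' theorem -/

section Stokes

/-- Integration by parts against the constant function 1. -/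
theorem integral_fderiv_apply_eq_zero {g : E4 → ℂ} (hg : ContDiff ℝ ∞ g)
    (hs : HasCompactSupport g) (v : E4) : ∫ y, fderiv ℝ g y v = 0 := by
  have hc : Continuous fun y => fderiv ℝ g y v :=
    (hg.continuous_fderiv (by simp)).clm_apply continuous_const
  have hcs : HasCompactSupport fun y => fderiv ℝ g y v := hs.fderiv_apply ℝ v
  have h := integral_mul_fderiv_eq_neg_fderiv_mul_of_integrable (μ := (volume : Measure E4))
    (f := fun _ : E4 => (1 : ℂ)) (g := g) (v := v) (by simp)
    (by simpa using hc.integrable_of_hasCompactSupport hcs)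
    (by simpa using hg.continuous.integrable_of_hasCompactSupport hs)
    (fun _ _ => differentiableAt_const _) fun _ _ => hg.differentiable (by simp) _
  simpa using h

theorem integral_extDeriv {k : ℕ} {ζ : E4 → Cov k} (hζ : ContDiff ℝ ∞ ζ)
    (hs : HasCompactSupport ζ) (w : Fin (k + 1) → E4) : ∫ y, extDeriv ζ y w = 0 := by
  have hd : ∀ (u : Fin k → E4), ContDiff ℝ ∞ fun y => ζ y u := fun u =>
    (ContinuousAlternatingMap.apply ℝ E4 ℂ u).contDiff.comp hζ
  have hds : ∀ (u : Fin k → E4), HasCompactSupport fun y => ζ y u := fun u =>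
    hs.comp_left (g := fun a : Cov k => a u) rfl
  have hf : ∀ (u : Fin k → E4) (v y : E4), fderiv ℝ ζ y v u = fderiv ℝ (fun y => ζ y u) y v :=
    fun u v y => by
      have h1 := ((ContinuousAlternatingMap.apply ℝ E4 ℂ u).hasFDerivAt.comp y
        (hζ.differentiable (by simp) y).hasFDerivAt).fderiv
      exact (DFunLike.congr_fun h1 v).symm
  have hi : ∀ (u : Fin k → E4) (v : E4), Integrable fun y => fderiv ℝ ζ y v u := fun u v => by
    simp only [hf]
    exact (((hd u).continuous_fderiv (by simp)).clm_apply
      continuous_const).integrable_of_hasCompactSupport ((hds u).fderiv_apply ℝ v)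
  simp only [extDeriv, ContinuousAlternatingMap.alternatizeUncurryFin_apply]
  rw [integral_finsetSum (f := fun (i : Fin (k + 1)) y => (-1 : ℤ) ^ (i : ℕ) • fderiv ℝ ζ y (w i) (i.removeNth w))
    _ fun i _ => (hi _ _).smul ((-1 : ℤ) ^ (i : ℕ))]
  refine Finset.sum_eq_zero fun i _ => ?_
  simp only [zsmul_eq_mul]
  rw [integral_const_mul]
  simp only [hf, integral_fderiv_apply_eq_zero (hd _) (hds _), mul_zero]

theorem extDeriv_congr {k : ℕ} {ζ ξ : E4 → Cov k} {y : E4} (h : ζ =ᶠ[nhds y] ξ) :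
    extDeriv ζ y = extDeriv ξ y := by
  rw [extDeriv, extDeriv, h.fderiv_eq]

theorem extDeriv_fun_zero {k : ℕ} (y : E4) : extDeriv (fun _ : E4 => (0 : Cov k)) y = 0 := by
  ext v
  simp [extDeriv, ContinuousAlternatingMap.alternatizeUncurryFin_apply]

theorem extDeriv_complex_smul {k : ℕ} (a : ℂ) {ζ : E4 → Cov k} {y : E4}
    (h : DifferentiableAt ℝ ζ y) : extDeriv (fun y => a • ζ y) y = a • extDeriv ζ y := by
  have h1 : fderiv ℝ (fun y => a • ζ y) y = a • fderiv ℝ ζ y := fderiv_const_smul h a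
  rw [extDeriv, h1, extDeriv]
  ext v
  simp only [ContinuousAlternatingMap.alternatizeUncurryFin_apply,
    ContinuousAlternatingMap.smul_apply, Finset.smul_sum]
  refine Finset.sum_congr rfl fun i _ => ?_
  exact smul_comm _ a _

/-- The square roots of 1 are at distance 2, so a continuous sign is locally constant. -/
theorem eq_of_mul_self_eq_one {a b : ℂ} (ha : a * a = 1) (hb : b * b = 1) (h : ‖a - b‖ < 1) :
    a = b := by
  rcases mul_self_eq_one_iff.1 ha with rfl | rfl <;> rcases mul_self_eq_one_iff.1 hb with rfl | rfl
  · rfl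
  · norm_num at h
  · norm_num at h
  · rfl

variable {M : Type*} [TopologicalSpace M] [ChartedSpace E4 M]

theorem extd_eq_zero {k : ℕ} {η : Form M k} {x : M} (h : ∀ᶠ x' in nhds x, η x' = 0) :
    extd η x = 0 := by
  have hx := mem_chart_source E4 x
  have h1 : inChart x η =ᶠ[nhds (chartAt E4 x x)] fun _ => 0 := by
    have hc := (chartAt E4 x).continuousAt_symm ((chartAt E4 x).map_source hx)
    rw [ContinuousAt, (chartAt E4 x).left_inv hx] at hc
    filter_upwards [hc.eventually h] with y hy
    rw [inChart, hy]
    rfl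
  rw [extd, extDeriv_congr h1, extDeriv_fun_zero]
  rfl

variable [IsManifold (𝓡 4) ∞ M] {n : ℕ} (X : ToricData M n)

/-- The sign of the chart at `c`: whether it is positively or negatively oriented. -/
def chartSign (c : M) (y : E4) : ℂ := inChart c X.vol y stdVec / (chartDensity X.metric c y : ℂ)

theorem chartSign_mul_self {c : M} {y : E4} (hy : y ∈ (chartAt E4 c).target) :
    chartSign X c y * chartSign X c y = 1 := by
  have h1 := X.vol_sq ((chartAt E4 c).symm y) fun i => chartSymmDeriv c y (stdVec i)
  have h2 : (chartDensity X.metric c y : ℂ) ^ 2 = ((gram X.metric ((chartAt E4 c).symm y)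
      fun i => chartSymmDeriv c y (stdVec i)).det : ℂ) := by
    rw [← Complex.ofReal_pow, chartDensity, Real.sq_sqrt (chartGram_det_pos X.metric c hy).le]
  have h3 : (chartDensity X.metric c y : ℂ) ≠ 0 :=
    Complex.ofReal_ne_zero.2 (chartDensity_pos X.metric hy).ne'
  have h4 : (inChart c X.vol y stdVec) ^ 2 = (chartDensity X.metric c y : ℂ) ^ 2 := h1.trans h2.symm
  rw [chartSign, div_mul_div_comm, ← pow_two, h4, ← pow_two, div_self (pow_ne_zero _ h3)]

theorem contDiffOn_chartSign (c : M) :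
    ContDiffOn ℝ ∞ (chartSign X c) (chartAt E4 c).target := by
  have h1 : ContDiffOn ℝ ∞ (fun y => (chartDensity X.metric c y : ℂ)) (chartAt E4 c).target :=
    Complex.ofRealCLM.contDiff.comp_contDiffOn (contDiffOn_chartDensity X.metric c)
  exact (contDiffOn_cov_apply (X.vol_smooth c) (v := fun i _ => stdVec i)
    fun _ => contDiffOn_const).mul (h1.inv fun _ hy =>
      Complex.ofReal_ne_zero.2 (chartDensity_pos X.metric hy).ne')

theorem chartSign_eventually_eq {c : M} {y : E4} (hy : y ∈ (chartAt E4 c).target) :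
    ∀ᶠ z in nhds y, chartSign X c z = chartSign X c y := by
  have hT := (chartAt E4 c).open_target.mem_nhds hy
  filter_upwards [hT, Metric.tendsto_nhds.1 ((contDiffOn_chartSign X c).continuousOn.continuousAt hT)
    1 one_pos] with z hz hd
  rw [dist_eq_norm] at hd
  exact eq_of_mul_self_eq_one (chartSign_mul_self X hz) (chartSign_mul_self X hy) hd

/-- Translates the Riemannian integral of *α in a chart into the coordinate integral of the
coefficient of α, up to the orientation sign of the chart. -/
theorem chartDensity_mul_topFun {r : ℕ} (h : r + 0 = 4) (α : Form M r) {c : M} {y : E4}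
    (hy : y ∈ (chartAt E4 c).target) :
    chartDensity X.metric c y • topFun X h α ((chartAt E4 c).symm y) =
      chartSign X c y * inChart c α y fun i => stdVec (Fin.cast h i) := by
  have hr : r = 4 := h
  subst hr
  have h1 : inChart c α y stdVec = topFun X h α ((chartAt E4 c).symm y) * inChart c X.vol y stdVec :=
    (DFunLike.congr_fun (topFun_smul_vol X α ((chartAt E4 c).symm y))
      fun i => chartSymmDeriv c y (stdVec i)).symm
  have h3 : (chartDensity X.metric c y : ℂ) ≠ 0 :=
    Complex.ofReal_ne_zero.2 (chartDensity_pos X.metric hy).ne'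
  have h5 : inChart c X.vol y stdVec = chartSign X c y * chartDensity X.metric c y := by
    rw [chartSign, div_mul_cancel₀ _ h3]
  have h6 : inChart c α y (fun i => stdVec (Fin.cast h i)) = inChart c α y stdVec := rfl
  rw [h6, h1, h5, Complex.real_smul]
  linear_combination (-(chartDensity X.metric c y : ℂ) *
    topFun X h α ((chartAt E4 c).symm y)) * chartSign_mul_self X hy

variable [CompactSpace M] [T2Space M] [MeasurableSpace M] [BorelSpace M]

/-- Stokes' theorem for forms supported in the domain of a chart. -/
theorem topInt_extd_of_support {k : ℕ} (h : k + 1 + 0 = 4) {η : Form M k} (hη : IsSmooth η) (c : M)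
    {K : Set M} (hK : IsCompact K) (hKc : K ⊆ (chartAt E4 c).source) (hs : ∀ x ∉ K, η x = 0) :
    topInt X h (extd η) = 0 := by
  set T := (chartAt E4 c).target with hT
  have hTo : IsOpen T := (chartAt E4 c).open_target
  -- The coordinate expression with its orientation sign, extended by zero. It is smooth because the
  -- sign is locally constant and the support is compact inside the target.
  let ζ : E4 → Cov k := T.indicator fun y => chartSign X c y • inChart c η y
  have hL : IsCompact (chartAt E4 c '' K) :=
    hK.image_of_continuousOn ((chartAt E4 c).continuousOn.mono hKc)
  have hζ0 : ∀ y ∉ chartAt E4 c '' K, ζ y = 0 := fun y hy => by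
    by_cases hyT : y ∈ T
    · have h1 : (chartAt E4 c).symm y ∉ K := fun hk =>
        hy ⟨_, hk, (chartAt E4 c).right_inv hyT⟩
      have h2 : inChart c η y = 0 := by
        rw [inChart, hs _ h1]
        rfl
      exact (Set.indicator_of_mem hyT _).trans (by
        rw [h2]
        ext v
        exact mul_zero _)
    · exact Set.indicator_of_notMem hyT _
  have hζT : ∀ y ∈ T, ζ =ᶠ[nhds y] fun z => chartSign X c y • inChart c η z := fun y hy => by
    filter_upwards [hTo.mem_nhds hy, chartSign_eventually_eq X hy] with z hz h1
    exact (Set.indicator_of_mem hz _).trans (by rw [h1])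
  have hζs : ContDiff ℝ ∞ ζ := by
    refine contDiff_iff_contDiffAt.2 fun y => ?_
    by_cases hy : y ∈ T
    · exact ((hη.contDiffAt hy).const_smul _).congr_of_eventuallyEq (hζT y hy)
    · have hyL : y ∉ chartAt E4 c '' K := by
        rintro ⟨x, hx, rfl⟩
        exact hy ((chartAt E4 c).map_source (hKc hx))
      refine (contDiffAt_const (c := (0 : Cov k))).congr_of_eventuallyEq ?_
      filter_upwards [hL.isClosed.isOpen_compl.mem_nhds hyL] with z hz
      exact hζ0 z hz
  have hζc : HasCompactSupport ζ := HasCompactSupport.intro hL hζ0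
  have hout : ∀ x ∉ (chartAt E4 c).source, topFun X h (extd η) x = 0 := fun x hx => by
    have h1 : extd η x = 0 := extd_eq_zero (by
      filter_upwards [hK.isClosed.isOpen_compl.mem_nhds fun hk => hx (hKc hk)] with z hz
      exact hs z hz)
    rw [← topL_eq, h1, map_zero]
  rw [topInt, ← setIntegral_eq_integral_of_forall_compl_eq_zero hout,
    setIntegral_source X.metric c _ (continuous_topFun X h hη.extd).aestronglyMeasurable]
  rw [← integral_extDeriv hζs hζc fun i => stdVec (Fin.cast h i)]
  rw [← setIntegral_eq_integral_of_forall_compl_eq_zero (s := T) (f := fun y => extDeriv ζ y _)]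
  · refine setIntegral_congr_fun hTo.measurableSet fun y hy => ?_
    rw [chartDensity_mul_topFun X h _ hy, inChart_extd hη hy, extDeriv_congr (hζT y hy),
      extDeriv_complex_smul _ ((hη.contDiffAt hy).differentiableAt (by simp))]
    rfl
  · intro y hy
    have hyL : y ∉ chartAt E4 c '' K := by
      rintro ⟨x, hx, rfl⟩
      exact hy ((chartAt E4 c).map_source (hKc hx))
    have h1 : ζ =ᶠ[nhds y] fun _ => 0 := by
      filter_upwards [hL.isClosed.isOpen_compl.mem_nhds hyL] with z hz
      exact hζ0 z hz
    rw [extDeriv_congr h1, extDeriv_fun_zero]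
    rfl

omit [CompactSpace M] [T2Space M] [MeasurableSpace M] [BorelSpace M] in
theorem IsSmooth.smul_fun {k : ℕ} {η : Form M k} (hη : IsSmooth η) {ψ : M → ℝ}
    (hψ : ContMDiff (𝓡 4) 𝓘(ℝ) ∞ ψ) : IsSmooth fun x => ψ x • η x := by
  intro c
  have h1 : ContDiffOn ℝ ∞ (fun y => ψ ((chartAt E4 c).symm y)) (chartAt E4 c).target := by
    rw [← contMDiffOn_iff_contDiffOn]
    exact hψ.comp_contMDiffOn (contMDiffOn_chart_symm (x := c))
  exact h1.smul (hη c)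

/-- The integral of forms of top degree as a linear form. -/
def topIntL {r : ℕ} (h : r + 0 = 4) : SForm M r →ₗ[ℂ] ℂ where
  toFun α := topInt X h α
  map_add' α β := topInt_add X h α.2 β.2
  map_smul' c α := topInt_smul X h c α

/-- Stokes' theorem. -/
theorem topIntL_dForm {k : ℕ} (h : k + 1 + 0 = 4) (η : SForm M k) : topIntL X h (dForm k η) = 0 := by
  obtain ⟨t, ht⟩ := CompactSpace.elim_nhds_subcover (fun c : M => (chartAt E4 c).source)
    fun c => (chartAt E4 c).open_source.mem_nhds (mem_chart_source E4 c)
  -- A finite partition of unity subordinate to chart domains writes η as a sum of forms covered by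
  -- the local version.
  obtain ⟨f, hf⟩ := SmoothPartitionOfUnity.exists_isSubordinate (𝓡 4) (isClosed_univ (X := M))
    (fun c : t => (chartAt E4 (c : M)).source) (fun c => (chartAt E4 (c : M)).open_source)
    (fun x _ => by
      have hx : x ∈ (⊤ : Set M) := trivial
      rw [← ht] at hx
      simp only [Set.mem_iUnion] at hx ⊢
      obtain ⟨i, hi, hx⟩ := hx
      exact ⟨⟨i, hi⟩, hx⟩)
  let ηf : t → SForm M k := fun i => ⟨fun x => f i x • η.1 x, η.2.smul_fun (f i).contMDiff⟩
  have hsum : η = ∑ i, ηf i := by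
    refine Subtype.ext (funext fun x => ?_)
    rw [AddSubmonoidClass.coe_finsetSum, Finset.sum_apply]
    have h1 := f.sum_eq_one (Set.mem_univ x)
    rw [finsum_eq_sum_of_fintype] at h1
    rw [← Finset.sum_smul, h1, one_smul]
  rw [hsum, map_sum, map_sum]
  refine Finset.sum_eq_zero fun i _ => ?_
  refine topInt_extd_of_support X h (ηf i).2 i (isClosed_tsupport (f i)).isCompact (hf i)
    fun x hx => ?_
  change f i x • η.1 x = 0
  rw [image_eq_zero_of_notMem_tsupport hx]
  exact zero_smul ℝ (η.1 x)

end Stokes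

/-! ## Curvature and the inner product -/

section Curvature

open DirectSum

variable {M : Type*} [TopologicalSpace M] [ChartedSpace E4 M] [IsManifold (𝓡 4) ∞ M] {n : ℕ}
variable {X : ToricData M n} {N : ℕ}

theorem idem_mul_curvature {P : SMat X N 0} {A : SMat X N 1} {F : SMat X N 2}
    (hPP : of (SMat X N) 0 P * of (SMat X N) 0 P = of (SMat X N) 0 P)
    (hPA : of (SMat X N) 0 P * of (SMat X N) 1 A = of (SMat X N) 1 A)
    (hF : of (SMat X N) 2 F = of (SMat X N) 1 A * of (SMat X N) 1 A +
        of (SMat X N) 1 A * dTotal X N (of (SMat X N) 0 P) +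
        of (SMat X N) 0 P * dTotal X N (of (SMat X N) 1 A) +
        of (SMat X N) 0 P * dTotal X N (of (SMat X N) 0 P) *
          dTotal X N (of (SMat X N) 0 P)) :
    SMat.mul (Nat.zero_add 2) P F = F := by
  refine of_injective (β := SMat X N) 2 ?_
  rw [← of_mul (Nat.zero_add 2), hF]
  simp only [mul_add, ← mul_assoc, hPA, hPP]

/-- In Fp the term A dp p vanishes because A = Ap and p dp p = 0; the lost A dp reappears from dA p
= dA + A dp. -/
theorem curvature_mul_idem {P : SMat X N 0} {A : SMat X N 1} {F : SMat X N 2}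
    (hPP : of (SMat X N) 0 P * of (SMat X N) 0 P = of (SMat X N) 0 P)
    (hPA : of (SMat X N) 0 P * of (SMat X N) 1 A = of (SMat X N) 1 A)
    (hAP : of (SMat X N) 1 A * of (SMat X N) 0 P = of (SMat X N) 1 A)
    (hF : of (SMat X N) 2 F = of (SMat X N) 1 A * of (SMat X N) 1 A +
        of (SMat X N) 1 A * dTotal X N (of (SMat X N) 0 P) +
        of (SMat X N) 0 P * dTotal X N (of (SMat X N) 1 A) +
        of (SMat X N) 0 P * dTotal X N (of (SMat X N) 0 P) *
          dTotal X N (of (SMat X N) 0 P)) :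
    SMat.mul (Nat.add_zero 2) F P = F := by
  have hp : IsHom 0 (of (SMat X N) 0 P) := ⟨P, rfl⟩
  have h1 := idem_dTotal_idem hp hPP
  have h2 := dTotal_mul (X := X) (N := N) ⟨A, rfl⟩ (of (SMat X N) 0 P)
  have h3 := dTotal_mul hp (of (SMat X N) 0 P)
  rw [hAP, pow_one, neg_smul, one_smul] at h2
  rw [hPP, pow_zero, one_smul] at h3
  refine of_injective (β := SMat X N) 2 ?_
  rw [← of_mul (Nat.add_zero 2), hF]
  generalize dTotal X N (of (SMat X N) 1 A) = b at *
  generalize of (SMat X N) 1 A = a at *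
  generalize dTotal X N (of (SMat X N) 0 P) = d at *
  generalize of (SMat X N) 0 P = p at *
  have h4 : b * p = b + a * d := eq_add_of_add_neg_eq h2.symm
  have h5 : a * (d * p) = 0 := by
    conv_lhs => rw [← hAP]
    rw [mul_assoc, ← mul_assoc p, h1, mul_zero]
  have h6 : p * d * d * p = p * d * d := by
    have h7 : d * p = d - p * d := eq_sub_of_add_eq h3.symm
    rw [mul_assoc, h7, mul_sub, ← mul_assoc (p * d) p d, h1, zero_mul, sub_zero]
  have h8 : p * (a * d) = a * d := by rw [← mul_assoc, hPA]
  calc (a * a + a * d + p * b + p * d * d) * p =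
      a * (a * p) + a * (d * p) + p * (b * p) + p * d * d * p := by noncomm_ring
    _ = _ := by
      rw [hAP, h5, h4, h6, mul_add, h8]
      abel

/-- The involution reverses products, with a minus sign for two odd factors. The differentiated
identities for pA = A, Ap = A and p² = p restore the original order. -/
theorem star_curvature {P : SMat X N 0} {A : SMat X N 1} {F : SMat X N 2} (hPs : P.star = P)
    (hAs : A.star = -A)
    (hPP : of (SMat X N) 0 P * of (SMat X N) 0 P = of (SMat X N) 0 P)
    (hPA : of (SMat X N) 0 P * of (SMat X N) 1 A = of (SMat X N) 1 A)
    (hAP : of (SMat X N) 1 A * of (SMat X N) 0 P = of (SMat X N) 1 A)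
    (hF : of (SMat X N) 2 F = of (SMat X N) 1 A * of (SMat X N) 1 A +
        of (SMat X N) 1 A * dTotal X N (of (SMat X N) 0 P) +
        of (SMat X N) 0 P * dTotal X N (of (SMat X N) 1 A) +
        of (SMat X N) 0 P * dTotal X N (of (SMat X N) 0 P) *
          dTotal X N (of (SMat X N) 0 P)) :
    F.star = -F := by
  have hp : IsHom 0 (of (SMat X N) 0 P) := ⟨P, rfl⟩
  have h1 := dTotal_mul (X := X) (N := N) ⟨A, rfl⟩ (of (SMat X N) 0 P)
  have h2 := dTotal_mul hp (of (SMat X N) 1 A)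
  have h3 := dTotal_mul hp (of (SMat X N) 0 P)
  rw [hAP, pow_one, neg_smul, one_smul] at h1
  rw [hPA, pow_zero, one_smul] at h2
  rw [hPP, pow_zero, one_smul] at h3
  have hF' : F = SMat.mul rfl A A + SMat.mul rfl A P.d + SMat.mul (Nat.zero_add 2) P A.d +
      SMat.mul rfl (SMat.mul (Nat.zero_add 1) P P.d) P.d := by
    refine of_injective (β := SMat X N) 2 ?_
    rw [hF, map_add, map_add, map_add, ← of_mul (show 1 + 1 = 2 from rfl),
      ← of_mul (show 1 + 1 = 2 from rfl), ← of_mul (Nat.zero_add 2), ← of_mul (show 1 + 1 = 2 from rfl), ← of_mul (Nat.zero_add 1),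
      dTotal_of, dTotal_of]
  refine of_injective (β := SMat X N) 2 ?_
  have hd : (SMat.d P).star = SMat.d P := by rw [SMat.star_d, hPs]
  have hdA : (SMat.d A).star = -SMat.d A := by rw [SMat.star_d, hAs, map_neg]
  have hst : F.star = -SMat.mul rfl (-A) (-A) - SMat.mul rfl P.d (-A) +
      SMat.mul (Nat.add_zero 2) (-A.d) P - SMat.mul rfl P.d (SMat.mul (Nat.add_zero 1) P.d P) := by
    rw [hF', SMat.star_add, SMat.star_add, SMat.star_add, SMat.star_mul rfl rfl,
      SMat.star_mul (show 1 + 1 = 2 from rfl) rfl, SMat.star_mul (Nat.zero_add 2) (Nat.add_zero 2),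
      SMat.star_mul (show 1 + 1 = 2 from rfl) rfl,
      SMat.star_mul (Nat.zero_add 1) (Nat.add_zero 1), hAs, hd, hdA, hPs]
    simp only [mul_one, pow_one, zero_mul, pow_zero, one_smul, neg_smul, sub_eq_add_neg]
  rw [hst, map_neg, hF, map_sub, map_add, map_sub, map_neg, ← of_mul (show 1 + 1 = 2 from rfl),
    ← of_mul (show 1 + 1 = 2 from rfl), ← of_mul (Nat.add_zero 2),
    ← of_mul (show 1 + 1 = 2 from rfl), ← of_mul (Nat.add_zero 1), map_neg, map_neg, ← dTotal_of,
    ← dTotal_of]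
  generalize dTotal X N (of (SMat X N) 1 A) = b at *
  generalize of (SMat X N) 1 A = a at *
  generalize dTotal X N (of (SMat X N) 0 P) = d at *
  generalize of (SMat X N) 0 P = p at *
  have h4 : d * a = b - p * b := eq_sub_of_add_eq h2.symm
  have h5 : b * p = b + a * d := eq_add_of_add_neg_eq h1.symm
  have h6 : d * (d * p) = p * d * d := by
    have h7 : d * p = d - p * d := eq_sub_of_add_eq h3.symm
    have h8 : p * d = d - d * p := eq_sub_of_add_eq' h3.symm
    calc d * (d * p) = d * (d - p * d) := by rw [h7]
      _ = (d - d * p) * d := by noncomm_ring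
      _ = _ := by rw [← h8]
  have h9 : -(-a * -a) - d * -a + -b * p - d * (d * p) = -(a * a) + d * a - b * p - d * (d * p) := by
    noncomm_ring
  rw [h9, h4, h5, h6]
  abel

end Curvature

/-! ## The inner product on two-forms -/

section Inner

variable {M : Type*} [TopologicalSpace M] [ChartedSpace E4 M] [IsManifold (𝓡 4) ∞ M] {n : ℕ}
variable (X : ToricData M n)

/-- On an orthonormal frame the volume form takes a value ±1, so it is real. -/
theorem conjCov_vol (x : M) : conjCov (X.vol x) = X.vol x := by
  obtain ⟨e, he⟩ := exists_frame X.metric x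
  refine he.ext_top ?_
  rw [conjCov_apply]
  rcases mul_self_eq_one_iff.1 he.vol_sq with h | h <;> rw [h] <;> simp

theorem conjForm_hodge {p q : ℕ} (h : p + q = 4) (α : Form M p) :
    conjForm (hodge X h α) = hodge X h (conjForm α) := by
  funext x
  obtain ⟨e, he⟩ := exists_frame X.metric x
  ext w
  have h1 : ∀ v, (starRingEnd ℂ) (X.vol x v) = X.vol x v := fun v =>
    DFunLike.congr_fun (conjCov_vol X x) v
  rw [conjForm_apply, conjCov_apply, he.hodge_eq, he.hodge_eq]
  simp only [map_mul, map_sum, map_inv₀, map_natCast, insertFirst_apply, h1, conjForm_apply,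
    conjCov_apply]

theorem conjSForm_hodgeS {p q : ℕ} (h : p + q = 4) (α : SForm M p) :
    conjSForm (hodgeS X h α) = hodgeS X h (conjSForm α) :=
  Subtype.ext (conjForm_hodge X h α)

theorem hodgeS_hodgeS (α : SForm M 2) :
    hodgeS X (show 2 + 2 = 4 from rfl) (hodgeS X (show 2 + 2 = 4 from rfl) α) = α :=
  Subtype.ext (by rw [coe_hodgeS, coe_hodgeS, hodge_hodge])

theorem hodgeS_mulForm_left {p q : ℕ} (h : p + q = 4) (f : SForm M 0) (α : SForm M p) :
    hodgeS X h (mulForm X (Nat.zero_add p) f α) =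
      mulForm X (Nat.zero_add q) f (hodgeS X h α) :=
  Subtype.ext (hodge_starMul_left X h _ _ f.2 α.2)

theorem hodgeS_mulForm_right {p q : ℕ} (h : p + q = 4) (α : SForm M p) (f : SForm M 0) :
    hodgeS X h (mulForm X (Nat.add_zero p) α f) =
      mulForm X (Nat.add_zero q) (hodgeS X h α) f :=
  Subtype.ext (hodge_starMul_right X h _ _ f.2 α.2)

/-- In an orthonormal frame both sides are the symmetric expression ½ Σ α(e_i, e_j) β(e_i, e_j). -/
theorem topFun_wedge_hodge_comm (α β : Form M 2) (x : M) :
    topFun X (show 4 + 0 = 4 from rfl) (fun y => wedge (show 2 + 2 = 4 from rfl) (α y)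
      (hodge X (show 2 + 2 = 4 from rfl) β y)) x =
    topFun X (show 4 + 0 = 4 from rfl) (fun y => wedge (show 2 + 2 = 4 from rfl) (β y)
      (hodge X (show 2 + 2 = 4 from rfl) α y)) x := by
  obtain ⟨e, he⟩ := exists_frame X.metric x
  rw [topFun, topFun, he.hodge_wedge_hodge, he.hodge_wedge_hodge]
  simp only [mul_comm]

/-- The pointwise squared norm of a two-form is real and nonnegative, and definite. -/
theorem exists_topFun_wedge_hodge (α : Form M 2) (x : M) :
    ∃ ρ : ℝ, 0 ≤ ρ ∧ (ρ = 0 → α x = 0) ∧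
      topFun X (show 4 + 0 = 4 from rfl) (fun y => wedge (show 2 + 2 = 4 from rfl) (conjForm α y)
        (hodge X (show 2 + 2 = 4 from rfl) α y)) x = ρ := by
  obtain ⟨e, he⟩ := exists_frame X.metric x
  refine ⟨2⁻¹ * ∑ c : Fin 2 → Fin 4, ‖α x (e ∘ c)‖ ^ 2, by positivity, fun h => ?_, ?_⟩
  · have h1 : ∑ c : Fin 2 → Fin 4, ‖α x (e ∘ c)‖ ^ 2 = 0 := by simpa using h
    rw [Finset.sum_eq_zero_iff_of_nonneg fun c _ => by positivity] at h1
    refine he.ext fun v _ => ?_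
    simpa using h1 v (Finset.mem_univ v)
  · rw [topFun, he.hodge_wedge_hodge]
    push_cast
    congr 1
    refine Finset.sum_congr rfl fun c _ => ?_
    rw [conjForm_apply, conjCov_apply, ← Complex.conj_mul']

variable [CompactSpace M] [T2Space M] [MeasurableSpace M] [BorelSpace M]

/-- The integral as a closed graded trace. -/
def intTrace : ClosedTrace X where
  toFun := topIntL X (show 4 + 0 = 4 from rfl)
  cyclic h h' α β := topInt_cyclic X h h' _ α.2 β.2
  closed η := topIntL_dForm X (show 3 + 1 + 0 = 4 from rfl) η

/-- The bilinear form `∫ α ∧ *β` on two-forms. -/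
def pair (α β : SForm M 2) : ℂ :=
  (intTrace X).toFun (mulForm X (show 2 + 2 = 4 from rfl) α
    (hodgeS X (show 2 + 2 = 4 from rfl) β))

theorem pair_eq (α β : SForm M 2) : pair X α β = ∫ x, topFun X (show 4 + 0 = 4 from rfl)
    (fun y => wedge (show 2 + 2 = 4 from rfl) ((α : Form M 2) y)
      (hodge X (show 2 + 2 = 4 from rfl) (β : Form M 2) y)) x ∂(riemannianVolume X.metric) :=
  topInt_starMul X _ _ α.2 (β.2.hodge X _)

theorem pair_comm (α β : SForm M 2) : pair X α β = pair X β α := by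
  rw [pair_eq, pair_eq]
  simp only [topFun_wedge_hodge_comm X (α : Form M 2) (β : Form M 2)]

theorem pair_add_left (α α' β : SForm M 2) : pair X (α + α') β = pair X α β + pair X α' β := by
  simp only [pair, map_add, LinearMap.add_apply]

theorem pair_add_right (α β β' : SForm M 2) : pair X α (β + β') = pair X α β + pair X α β' := by
  simp only [pair, map_add]

theorem pair_hodge_right (α β : SForm M 2) :
    pair X α (hodgeS X (show 2 + 2 = 4 from rfl) β) =
      (intTrace X).toFun (mulForm X (show 2 + 2 = 4 from rfl) α β) := by
  rw [pair, hodgeS_hodgeS]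

/-- Since ** = 1, the two sides are the integrals of βα and αβ, and two-forms commute under the
trace. -/
theorem pair_hodge_left (α β : SForm M 2) :
    pair X (hodgeS X (show 2 + 2 = 4 from rfl) α) β =
      pair X α (hodgeS X (show 2 + 2 = 4 from rfl) β) := by
  rw [pair_comm, pair_hodge_right, pair_hodge_right, (intTrace X).cyclic _ (show 2 + 2 = 4 from rfl)]
  norm_num

/-- Under the integral the deformed product is the wedge product, so this is the classical L² norm.
Definiteness uses continuity of the density and full support of the volume. -/
theorem pair_conj_self (α : SForm M 2) :
    ∃ ρ : ℝ, 0 ≤ ρ ∧ (ρ = 0 → α = 0) ∧ pair X (conjSForm α) α = ρ := by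
  choose ρ h0 h1 h2 using exists_topFun_wedge_hodge X (α : Form M 2)
  have hs : IsSmooth fun y => wedge (show 2 + 2 = 4 from rfl) (conjForm (α : Form M 2) y)
      (hodge X (show 2 + 2 = 4 from rfl) (α : Form M 2) y) :=
    α.2.conjForm.wedge _ (α.2.hodge X _)
  have hc : Continuous fun x => (ρ x : ℂ) :=
    (continuous_topFun X (show 4 + 0 = 4 from rfl) hs).congr h2
  have hρ : Continuous ρ := Complex.continuous_re.comp hc
  refine ⟨∫ x, ρ x ∂(riemannianVolume X.metric), integral_nonneg h0, fun h => ?_, ?_⟩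
  · have hi : Integrable ρ (riemannianVolume X.metric) :=
      hρ.integrable_of_hasCompactSupport (HasCompactSupport.of_compactSpace ρ)
    have h3 := (integral_eq_zero_iff_of_nonneg h0 hi).1 h
    have h4 := (Continuous.ae_eq_iff_eq _ hρ continuous_zero).1 h3
    exact Subtype.ext (funext fun x => h1 x (congrFun h4 x))
  · rw [pair_eq]
    refine Eq.trans (integral_congr_ae (Filter.Eventually.of_forall h2)) ?_
    exact integral_ofReal

end Inner

/-! ## The Yang–Mills functional -/

section YangMills

open DirectSum

variable {M : Type*} [TopologicalSpace M] [ChartedSpace E4 M] [IsManifold (𝓡 4) ∞ M] {n : ℕ}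
variable {X : ToricData M n} {N : ℕ}

/-- The Hodge operator on matrices of two-forms. -/
def SMat.hodge (S : SMat X N 2) : SMat X N 2 :=
  fun i j => hodgeS X (show 2 + 2 = 4 from rfl) (S i j)

theorem hodgeMat_form (S : SMat X N 2) : hodgeMat X S.form = S.hodge.form := rfl

theorem SMat.hodge_mul_left (u : SMat X N 0) (S : SMat X N 2) :
    (SMat.mul (Nat.zero_add 2) u S).hodge = SMat.mul (Nat.zero_add 2) u S.hodge := by
  ext i j : 1
  simp only [SMat.hodge, SMat.mul_apply, map_sum]
  exact Finset.sum_congr rfl fun l _ => hodgeS_mulForm_left X (show 2 + 2 = 4 from rfl) _ _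

theorem SMat.hodge_mul_right (S : SMat X N 2) (u : SMat X N 0) :
    (SMat.mul (Nat.add_zero 2) S u).hodge = SMat.mul (Nat.add_zero 2) S.hodge u := by
  ext i j : 1
  simp only [SMat.hodge, SMat.mul_apply, map_sum]
  exact Finset.sum_congr rfl fun l _ => hodgeS_mulForm_right X (show 2 + 2 = 4 from rfl) _ _

variable [CompactSpace M] [T2Space M] [MeasurableSpace M] [BorelSpace M]

/-- The inner product of matrices of smooth two-forms. -/
def SMat.inner (S T : SMat X N 2) : ℂ := ∑ i, ∑ j, pair X (conjSForm (S i j)) (T i j)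

omit [CompactSpace M] [T2Space M] [BorelSpace M] in
theorem ncInt_hodge {r : ℕ} (h : r + 0 = 4) (α : Form M r) :
    ncInt X (NCYM.hodge X h α) = topInt X h α := rfl

omit [CompactSpace M] [T2Space M] [BorelSpace M] in
theorem formInner_eq_topInt {p q : ℕ} (h : p + q = 4) (α β : Form M p) :
    formInner X h α β = topInt X (show 4 + 0 = 4 from rfl)
      (starMul X h (conjForm α) (NCYM.hodge X h β)) := ncInt_hodge _ _

theorem intTrace_apply (α : SForm M 4) :
    (intTrace X).toFun α = topInt X (show 4 + 0 = 4 from rfl) (α : Form M 4) := rfl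

theorem formInner_eq_pair (α β : SForm M 2) :
    formInner X (show 2 + 2 = 4 from rfl) (α : Form M 2) β = pair X (conjSForm α) β := by
  rw [formInner_eq_topInt, pair, intTrace_apply, coe_mulForm, coe_hodgeS, conjSForm]

theorem homInner_form (S T : SMat X N 2) : homInner X S.form T.form = S.inner T :=
  Finset.sum_congr rfl fun _ _ => Finset.sum_congr rfl fun _ _ =>
    formInner_eq_pair _ _

/-- As a trace of S* *T the inner product becomes accessible to cyclicity. -/
theorem SMat.inner_eq_mat (S T : SMat X N 2) : S.inner T =
    (intTrace X).mat (SMat.mul (show 2 + 2 = 4 from rfl) S.star T.hodge) := by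
  rw [SMat.inner, Finset.sum_comm, ClosedTrace.mat_apply]
  refine Finset.sum_congr rfl fun j _ => ?_
  rw [SMat.mul_apply, map_sum]
  rfl

theorem SMat.inner_add (S T : SMat X N 2) :
    (S + T).inner (S + T) = S.inner S + S.inner T + (T.inner S + T.inner T) := by
  simp only [SMat.inner, SMat.add_apply, conjSForm_add, pair_add_left, pair_add_right,
    Finset.sum_add_distrib]
  ring

theorem SMat.inner_smul_right (S : SMat X N 2) (ε : ℂ) (T : SMat X N 2) :
    S.inner (ε • T) = ε * S.inner T := by
  simp only [SMat.inner, SMat.smul_apply, Finset.mul_sum]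
  refine Finset.sum_congr rfl fun i _ => Finset.sum_congr rfl fun j _ => ?_
  simp only [pair, map_smul, smul_eq_mul]

theorem SMat.inner_smul_left (S : SMat X N 2) (ε : ℂ) (T : SMat X N 2) :
    (ε • S).inner T = (starRingEnd ℂ) ε * S.inner T := by
  simp only [SMat.inner, SMat.smul_apply, Finset.mul_sum]
  refine Finset.sum_congr rfl fun i _ => Finset.sum_congr rfl fun j _ => ?_
  rw [conjSForm_smul]
  simp only [pair, map_smul, LinearMap.smul_apply, smul_eq_mul]

theorem SMat.inner_hodge_hodge (S : SMat X N 2) : S.hodge.inner S.hodge = S.inner S := by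
  refine Finset.sum_congr rfl fun i _ => Finset.sum_congr rfl fun j _ => ?_
  rw [SMat.hodge, conjSForm_hodgeS, pair_hodge_left, hodgeS_hodgeS]

theorem SMat.inner_hodge_left (S : SMat X N 2) : S.hodge.inner S = S.inner S.hodge := by
  refine Finset.sum_congr rfl fun i _ => Finset.sum_congr rfl fun j _ => ?_
  rw [SMat.hodge, conjSForm_hodgeS, pair_hodge_left]

theorem SMat.inner_self (S : SMat X N 2) :
    ∃ ρ : ℝ, 0 ≤ ρ ∧ (ρ = 0 → S = 0) ∧ S.inner S = ρ := by
  choose ρ h0 h1 h2 using fun i j => pair_conj_self X (S i j)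
  refine ⟨∑ i, ∑ j, ρ i j, Finset.sum_nonneg fun i _ => Finset.sum_nonneg fun j _ => h0 i j,
    fun h => ?_, ?_⟩
  · rw [Finset.sum_eq_zero_iff_of_nonneg fun i _ => Finset.sum_nonneg fun j _ => h0 i j] at h
    ext i j : 1
    have h3 := h i (Finset.mem_univ i)
    rw [Finset.sum_eq_zero_iff_of_nonneg fun j _ => h0 i j] at h3
    exact h1 i j (h3 j (Finset.mem_univ j))
  · rw [SMat.inner]
    simp only [h2]
    push_cast
    rfl

/-- The decomposition of the energy into the self-dual and anti-self-dual parts. -/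
theorem SMat.inner_add_smul_hodge (S : SMat X N 2) {ε : ℂ} (hε : (starRingEnd ℂ) ε = ε)
    (hε2 : ε * ε = 1) :
    (S + ε • S.hodge).inner (S + ε • S.hodge) = 2 * (S.inner S + ε * S.inner S.hodge) := by
  rw [SMat.inner_add, SMat.inner_smul_left, SMat.inner_smul_right, SMat.inner_smul_left,
    SMat.inner_smul_right, SMat.inner_hodge_hodge, SMat.inner_hodge_left, hε]
  linear_combination S.inner S * hε2

/-- The squared norms of S + *S and S - *S are c = 2(a + b) and d = 2(a - b). They are real and
nonnegative, so b is real with |b| ≤ a; if one of them vanishes, S is anti-self-dual or self-dual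
respectively. -/
theorem SMat.exists_energy (S : SMat X N 2) :
    ∃ a b : ℝ, S.inner S = a ∧ S.inner S.hodge = b ∧ 0 ≤ a ∧ |b| ≤ a ∧
      (a = b → S.hodge = S) ∧ (a = -b → S.hodge = -S) := by
  obtain ⟨a, ha0, -, ha⟩ := S.inner_self
  obtain ⟨c, hc0, hc1, hc⟩ := (S + (1 : ℂ) • S.hodge).inner_self
  obtain ⟨d, hd0, hd1, hd⟩ := (S + (-1 : ℂ) • S.hodge).inner_self
  rw [S.inner_add_smul_hodge (by simp) (by norm_num), ha] at hc hd
  have hb : S.inner S.hodge = ((c / 2 - a : ℝ) : ℂ) := by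
    push_cast
    linear_combination hc / 2
  have hda : d = 4 * a - c := by
    rw [hb] at hd
    have : ((2 * (a - (c / 2 - a)) : ℝ) : ℂ) = d := by
      rw [← hd]
      push_cast
      ring
    have := Complex.ofReal_injective this
    linarith
  refine ⟨a, c / 2 - a, ha, hb, ha0, abs_le.2 ⟨by linarith, by linarith⟩, fun h => ?_, fun h => ?_⟩
  · have h1 := hd1 (by linarith)
    rw [neg_smul, one_smul, ← sub_eq_add_neg, sub_eq_zero] at h1
    exact h1.symm
  · have h1 := hc1 (by linarith)
    rw [one_smul] at h1
    exact eq_neg_of_add_eq_zero_right h1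

/-- By linearity of * over functions, the transformed trace is that of u* F* (u u*) *F u. Cyclicity
brings the outer u to the front, and u u* = p acts as the identity on F* and *F. -/
theorem SMat.inner_gauge {P u : SMat X N 0} {F : SMat X N 2} (hPs : P.star = P)
    (hPF : SMat.mul (Nat.zero_add 2) P F = F) (hFP : SMat.mul (Nat.add_zero 2) F P = F)
    (huu : SMat.mul (Nat.zero_add 0) u u.star = P) {G : SMat X N 2}
    (hG : G = SMat.mul (Nat.zero_add 2) u.star (SMat.mul (Nat.add_zero 2) F u)) :
    G.inner G = F.inner F := by
  have h1 : G.star = SMat.mul (Nat.add_zero 2) (SMat.mul (Nat.zero_add 2) u.star F.star) u := by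
    rw [hG, SMat.star_mul (Nat.zero_add 2) (Nat.add_zero 2),
      SMat.star_mul (Nat.add_zero 2) (Nat.zero_add 2), SMat.star_star]
    simp
  have h2 : G.hodge = SMat.mul (Nat.zero_add 2) u.star (SMat.mul (Nat.add_zero 2) F.hodge u) := by
    rw [hG, SMat.hodge_mul_left, SMat.hodge_mul_right]
  have h3 : SMat.mul (Nat.zero_add 2) P F.star = F.star := by
    conv_rhs => rw [← hFP, SMat.star_mul (Nat.add_zero 2) (Nat.zero_add 2), hPs]
    simp
  have h4 : SMat.mul (Nat.zero_add 2) P F.hodge = F.hodge := by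
    rw [← SMat.hodge_mul_left, hPF]
  rw [SMat.inner_eq_mat, SMat.inner_eq_mat, ← ClosedTrace.total_of, ← ClosedTrace.total_of,
    ← of_mul, ← of_mul, h1, h2, ← of_mul (Nat.add_zero 2), ← of_mul (Nat.zero_add 2),
    ← of_mul (Nat.zero_add 2), ← of_mul (Nat.add_zero 2)]
  have e1 : of (SMat X N) 0 u * of (SMat X N) 0 u.star = of (SMat X N) 0 P := by
    rw [of_mul (Nat.zero_add 0), huu]
  have e2 : of (SMat X N) 0 P * of (SMat X N) 2 F.star = of (SMat X N) 2 F.star := by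
    rw [of_mul (Nat.zero_add 2), h3]
  have e3 : of (SMat X N) 0 P * of (SMat X N) 2 F.hodge = of (SMat X N) 2 F.hodge := by
    rw [of_mul (Nat.zero_add 2), h4]
  have hp : IsHom 0 (of (SMat X N) 0 P) := ⟨P, rfl⟩
  have hU : IsHom 0 (of (SMat X N) 0 u) := ⟨u, rfl⟩
  have hV : IsHom 0 (of (SMat X N) 0 u.star) := ⟨u.star, rfl⟩
  have hS : IsHom 2 (of (SMat X N) 2 F.star) := ⟨F.star, rfl⟩
  have hH : IsHom 2 (of (SMat X N) 2 F.hodge) := ⟨F.hodge, rfl⟩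
  generalize of (SMat X N) 0 u = U at *
  generalize of (SMat X N) 0 u.star = V at *
  generalize of (SMat X N) 2 F.star = S at *
  generalize of (SMat X N) 2 F.hodge = H at *
  generalize of (SMat X N) 0 P = p at *
  have e4 : V * S * U * (V * (H * U)) = V * (S * p * H) * U := by
    rw [← e1]
    noncomm_ring
  have e5 : U * (V * (S * p * H)) = p * S * (p * H) := by
    rw [← e1]
    noncomm_ring
  rw [e4, (intTrace X).total_mul (hV.mul ((hS.mul hp).mul hH)) hU, e5, e2, e3]
  norm_num

/-- With ** = 1 the metric drops out of the topological action, and F* = -F leaves minus the trace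
of F². -/
theorem SMat.inner_hodge_curvature {F : SMat X N 2} (hF : F.star = -F) :
    F.inner F.hodge =
      -(intTrace X).total (of (SMat X N) 2 F * of (SMat X N) 2 F) := by
  have h1 : F.hodge.hodge = F := by
    ext i j : 1
    exact hodgeS_hodgeS X _
  rw [SMat.inner_eq_mat, h1, hF, ← ClosedTrace.total_of, ← of_mul, map_neg, neg_mul, map_neg]

variable {P : SMat X N 0} {D : Operator M N}

/-- The right-hand side is built from p alone, which is the topological invariance. -/
theorem IsConnection.topAction_eq (hP : IsProjection X P.form) (hD : IsConnection X P.form D) :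
    topAction X P.form D = -(intTrace X).total
      (of (SMat X N) 0 P * dTotal X N (of (SMat X N) 0 P) * dTotal X N (of (SMat X N) 0 P) *
        (of (SMat X N) 0 P * dTotal X N (of (SMat X N) 0 P) * dTotal X N (of (SMat X N) 0 P))) := by
  obtain ⟨A, F, hc, hPA, hAP, hAs, hF⟩ := hD.exists_potential hP
  have hPP : of (SMat X N) 0 P * of (SMat X N) 0 P = of (SMat X N) 0 P := by
    rw [of_mul (Nat.zero_add 0), hP.mul_self]
  rw [topAction, ← hc, hodgeMat_form, homInner_form,
    SMat.inner_hodge_curvature (star_curvature hP.star_self hAs hPP hPA hAP hF),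
    (intTrace X).total_curvature_sq ⟨P, rfl⟩ hPP ⟨A, rfl⟩ hPA hAP hF]

theorem IsConnection.YM_gaugeTransform (hP : IsProjection X P.form) (hD : IsConnection X P.form D)
    {u : SMat X N 0} (hu : IsGauge X P.form u.form) :
    YM X P.form (gaugeTransform X u.form D) = YM X P.form D := by
  obtain ⟨A, F, hc, hPA, hAP, hAs, hF⟩ := hD.exists_potential hP
  have hPP : of (SMat X N) 0 P * of (SMat X N) 0 P = of (SMat X N) 0 P := by
    rw [of_mul (Nat.zero_add 0), hP.mul_self]
  have huu : SMat.mul (Nat.zero_add 0) u u.star = P :=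
    SMat.form_injective (by rw [← matMul_form, ← adj_form, hu.mul_adj])
  rw [YM, YM, ← hD.curvature_gaugeTransform hP hu hc, ← hc, homInner_form, homInner_form]
  exact SMat.inner_gauge hP.star_self (idem_mul_curvature hPP hPA hF)
    (curvature_mul_idem hPP hPA hAP hF) huu rfl

theorem IsConnection.exists_energy (hP : IsProjection X P.form) (hD : IsConnection X P.form D) :
    ∃ a b : ℝ, YM X P.form D = a ∧ topAction X P.form D = b ∧ 0 ≤ a ∧ |b| ≤ a ∧
      (a = |b| ↔ IsSelfDual X P.form D ∨ IsAntiSelfDual X P.form D) := by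
  obtain ⟨A, F, hc, -⟩ := hD.exists_potential hP
  obtain ⟨a, b, ha, hb, h0, hab, h1, h2⟩ := F.exists_energy
  refine ⟨a, b, ?_, ?_, h0, hab, fun h => ?_, fun h => ?_⟩
  · rw [YM, ← hc, homInner_form, ha]
  · rw [topAction, ← hc, hodgeMat_form, homInner_form, hb]
  · rcases abs_choice b with h' | h'
    · left
      rw [IsSelfDual, ← hc, hodgeMat_form, h1 (h.trans h')]
    · right
      rw [IsAntiSelfDual, ← hc, hodgeMat_form, h2 (h.trans h')]
      rfl
  · rcases h with h | h
    · rw [IsSelfDual, ← hc, hodgeMat_form] at h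
      rw [SMat.form_injective h, ha] at hb
      rw [← Complex.ofReal_injective hb, abs_of_nonneg h0]
    · rw [IsAntiSelfDual, ← hc, hodgeMat_form] at h
      have h3 : F.hodge = (-1 : ℂ) • F := by
        rw [neg_one_smul]
        exact SMat.form_injective h
      rw [h3, SMat.inner_smul_right, ha, neg_one_mul] at hb
      have h4 : -a = b := Complex.ofReal_injective (by rw [← hb]; push_cast; rfl)
      rw [← h4, abs_neg, abs_of_nonneg h0]

end YangMills

end NCYM

end

open scoped Manifold ContDiff in
theorem mainTheorem8 {M : Type*} [TopologicalSpace M] [ChartedSpace NCYM.E4 M]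
    [IsManifold (𝓡 4) ∞ M] [CompactSpace M] [T2Space M] [MeasurableSpace M] [BorelSpace M]
    {n : ℕ} (X : NCYM.ToricData M n) {N : ℕ} (P : NCYM.MForm M N 0)
    (hP : NCYM.IsProjection X P) :
    (∀ D : NCYM.Operator M N, NCYM.IsConnection X P D →
      -- gauge invariance
      (∀ u : NCYM.MForm M N 0, NCYM.IsGauge X P u →
        NCYM.IsConnection X P (NCYM.gaugeTransform X u D) ∧
          NCYM.YM X P (NCYM.gaugeTransform X u D) = NCYM.YM X P D) ∧
      -- positivity
      (NCYM.YM X P D).im = 0 ∧ 0 ≤ (NCYM.YM X P D).re ∧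
      -- the lower bound and the case of equality
      ‖NCYM.topAction X P D‖ ≤ (NCYM.YM X P D).re ∧
      ((NCYM.YM X P D).re = ‖NCYM.topAction X P D‖ ↔
        NCYM.IsSelfDual X P D ∨ NCYM.IsAntiSelfDual X P D)) ∧
    -- the topological action does not depend on the connection
    (∀ D D' : NCYM.Operator M N, NCYM.IsConnection X P D → NCYM.IsConnection X P D' →
      NCYM.topAction X P D = NCYM.topAction X P D') ∧
    -- instantons are absolute minima
    (∀ D : NCYM.Operator M N, NCYM.IsConnection X P D →
      NCYM.IsSelfDual X P D ∨ NCYM.IsAntiSelfDual X P D →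
      ∀ D' : NCYM.Operator M N, NCYM.IsConnection X P D' →
        (NCYM.YM X P D).re ≤ (NCYM.YM X P D').re) := by
  obtain ⟨P, rfl⟩ := NCYM.exists_form (X := X) hP.smooth
  have htop : ∀ D D' : NCYM.Operator M N, NCYM.IsConnection X P.form D →
      NCYM.IsConnection X P.form D' →
        NCYM.topAction X P.form D = NCYM.topAction X P.form D' := fun D D' hD hD' => by
    rw [hD.topAction_eq hP, hD'.topAction_eq hP]
  refine ⟨fun D hD => ⟨fun u hu => ?_, ?_⟩, htop, fun D hD hsd D' hD' => ?_⟩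
  · obtain ⟨u, rfl⟩ := NCYM.exists_form (X := X) hu.smooth
    exact ⟨NCYM.isConnection_gaugeTransform hD hu, hD.YM_gaugeTransform hP hu⟩
  · obtain ⟨a, b, ha, hb, h0, hab, h⟩ := hD.exists_energy hP
    rw [ha, hb, Complex.ofReal_im, Complex.ofReal_re, Complex.norm_real, Real.norm_eq_abs]
    exact ⟨rfl, h0, hab, h⟩
  · obtain ⟨a, b, ha, hb, h0, hab, h⟩ := hD.exists_energy hP
    obtain ⟨a', b', ha', hb', h0', hab', h'⟩ := hD'.exists_energy hP
    have hbb : b = b' := Complex.ofReal_injective (by rw [← hb, ← hb', htop D D' hD hD'])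
    -- The energy of `D` equals |b|, and |b| = |b'| bounds the energy of `D'` from below.
    rw [ha, ha', Complex.ofReal_re, Complex.ofReal_re, h.2 hsd, hbb]
    exact hab'
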